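/- **Definitions.** For $x\in\mathbb R$ let $x \bmod 1\in[-1/2,1/2)$ be its representative modulo $\mathbb Z$. *CLWE.* A CLWE sample in dimension $m$ with $n$ samples and parameters $\gamma,\beta$ is a pair $(A,b)$ where $A\sim\mathcal N(0,1)^{m\times n}$, $s$ is uniform on the sphere of radius $\gamma$ in $\mathbb R^m$, $e\sim\mathcal N(0,\beta^2I_n)$ are independent and $b^\top=s^\top A+e^\top \bmod 1$. A null sample is a pair $(A,b)$ with $A\sim\mathcal N(0,1)^{m\times n}$ and $b$ independent and uniform on $[-1/2,1/2)^n$. The advantage of a distinguisher is its probability of outputting $1$ on a CLWE sample minus its probability of outputting $1$ on a null sample. *$k$-SLR.* An instance with $M$ samples in dimension $n$ is $(X,y,\delta)$ with $X\in\mathbb R^{M\times n}$, $y\in\mathbb R^M$, $\delta>0$. A solution is a $\theta\in\mathbb R^n$ with at most $k$ non-zero entries and $\frac1M\|X\theta-y\|_2^2\le\delta^2$. A solver with success probability $q$ is an algorithm that, on every instance which has a solution, outputs a solution with probability at least $q$ over its own randomness. *Computation.* Algorithms are programs of a randomized real RAM: unit-cost addition, subtraction, multiplication, division and comparison of real numbers,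 sampling of uniform random numbers from $[0,1]$, integer constants, and natural-number registers for addressing with unit-cost addition, truncated subtraction and comparison; there is no rounding instruction. Solvers receive the numbers $M,n,k$ and the instance; distinguishers receive $m,n,k$ and $(A,b)$. **Theorem.** Let $G_{k,n}\in\mathbb R^{k\times n}$ (for $k\mid n$) be the block-diagonal matrix with $k$ identical blocks $(1,\dots,1)\in\mathbb R^{1\times n/k}$. There are fixed programs (a pre-processing and a post-processing phase), a polynomial $p$, and $\alpha=\alpha(m,n,k)>0$, $\delta=\delta(m,n,k)>0$, $y=y(m,n,k)\in\mathbb R^{m+k}$ with the following properties. For a program $S$ let $D_S$ be the program that runs the pre-processing, then $S$ once on the instance that the pre-processing has prepared, then the post-processing. 1. For all $m,n,k\ge1$ with $k\mid n$ and every input $(A,b)$, the pre-processing takes at most $p(n,m)$ steps and prepares the $k$-SLR instance $(X,y,\delta)$ with $$X=\begin{pmatrix}X_1\\X_2\end{pmatrix}\in\mathbb R^{(m+k)\times n},\qquad X_1=A,\qquad X_2=\alpha\, G_{k,n}.$$ In particular, both for CLWE samples and for null samples the $m$ rows of $X_1$ are i.i.d. $\mathcal N(0,I_n)$. If $S$ runs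 in time at most $T$ on $k$-SLR instances with $m+k$ samples in dimension $n$, then $D_S$ runs in time at most $T+p(n,m)$. 2. There is a constant $c>0$ such that the following holds for all $\epsilon\in(0,1)$, $C\in\mathbb R$, $q,\eta>0$, all integer sequences $k=k(m)$ with $|k-m^\epsilon|<1$ and all $\beta=\beta(m)\ge0$ with $\beta=o(1/\sqrt k)$. For all sufficiently large $m$ and all multiples $n$ of $k$ with $$k\cdot2^{c\,\frac mk\log_2m}\;\le\; n\;\le\; k\cdot2^{C\,\frac mk\log_2m}$$ (that is, $n=k\cdot 2^{\Theta((m/k)\log m)}$ with a sufficiently large hidden constant): * (completeness) for $A\sim\mathcal N(0,1)^{m\times n}$, the $k$-SLR instance $(X,y,\delta)$ of part 1 has a solution with probability at least $1-\eta$; * for every solver $S$ for $k$-SLR with $m+k$ samples in dimension $n$ and success probability $q$, the distinguisher $D_S$ has advantage at least $q/4$ for CLWE in dimension $m$ with $n$ samples and parameters $\gamma=2\sqrt m$ and $\beta$. -/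

import Mathlib

open MeasureTheory ProbabilityTheory Filter Topology

/-! ### A randomized real RAM with unit-cost steps

Real numbers are stored in *banks* (the analogue of the tapes of a multi-tape machine), each an
array of cells indexed by `ℕ`. Natural-number registers serve for addressing and counting.
The primitive operations are addition, subtraction, multiplication, division and comparison of
reals, addition, truncated subtraction and comparison of register contents, integer constants,
and drawing a fresh uniform random number from `[0, 1]`. There is no rounding instruction. -/

namespace RealRAM

/-- An infinite supply of independent uniform random numbers from `[0, 1]`. -/
abbrev Coins : Type := ℕ → unitInterval

/-- The law of the random supply: i.i.d. uniform on `[0, 1]`. -/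
noncomputable def coinLaw : Measure Coins :=
  Measure.infinitePi (fun _ : ℕ => (volume : Measure unitInterval))

/-- A memory configuration. -/
structure State where
  /-- contents of the natural-number registers -/
  reg : ℕ → ℕ
  /-- `mem b a` is the content of cell `a` of bank `b` -/
  mem : ℕ → ℕ → ℝ
  /-- the random numbers that have not been read yet -/
  coins : Coins

/-- A reference to a real cell (indirect addressing): the cell of bank `bank` whose address is the
content of register `addr`. -/
structure Loc where
  bank : ℕ
  addr : ℕ

inductive ArithOp
  | add
  | sub
  | mul
  | div

noncomputable def ArithOp.eval : ArithOp → ℝ → ℝ → ℝ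
  | add, x, y => x + y
  | sub, x, y => x - y
  | mul, x, y => x * y
  | div, x, y => x / y

/-- The unit-cost instructions. -/
inductive Instr
  /-- `reg d := c` -/
  | setReg (d c : ℕ)
  /-- `reg d := reg r + reg s` -/
  | addReg (d r s : ℕ)
  /-- `reg d := reg r - reg s` (truncated at zero) -/
  | subReg (d r s : ℕ)
  /-- `cell d := c` -/
  | setCell (d : Loc) (c : ℤ)
  /-- `cell d := cell x` -/
  | move (d x : Loc)
  /-- `cell d := cell x ∘ cell y` -/
  | arith (o : ArithOp) (d x y : Loc)
  /-- `cell d :=` the next random number -/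
  | rand (d : Loc)

namespace State

def get (s : State) (l : Loc) : ℝ := s.mem l.bank (s.reg l.addr)

def setReg (s : State) (d v : ℕ) : State :=
  { s with reg := Function.update s.reg d v }

def set (s : State) (l : Loc) (v : ℝ) : State :=
  { s with
    mem := Function.update s.mem l.bank (Function.update (s.mem l.bank) (s.reg l.addr) v) }

/-- The part of the memory that consists of the registers and banks with index at least `w`,
renumbered from `0`. -/
def window (w : ℕ) (s : State) : State where
  reg r := s.reg (r + w)
  mem b := s.mem (b + w)
  coins := s.coins

end State

/-- The effect of an instruction. -/
noncomputable def Instr.run : Instr → State → State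
  | setReg d c, s => s.setReg d c
  | addReg d r t, s => s.setReg d (s.reg r + s.reg t)
  | subReg d r t, s => s.setReg d (s.reg r - s.reg t)
  | setCell d c, s => s.set d (c : ℝ)
  | move d x, s => s.set d (s.get x)
  | arith o d x y, s => s.set d (o.eval (s.get x) (s.get y))
  | rand d, s => { s.set d (s.coins 0 : ℝ) with coins := fun i => s.coins (i + 1) }

/-- The tests. -/
inductive Cond
  /-- `reg r < reg s` -/
  | regLt (r s : ℕ)
  /-- `cell x < cell y` -/
  | cellLt (x y : Loc)

def Cond.holds : Cond → State → Prop
  | regLt r t, s => s.reg r < s.reg t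
  | cellLt x y, s => s.get x < s.get y

/-- Programs. -/
inductive Prog
  | instr (i : Instr)
  | seq (p q : Prog)
  | ite (c : Cond) (p q : Prog)
  | loop (c : Cond) (p : Prog)

/-- `Exec p s t s'`: started in `s`, the program `p` halts after exactly `t` steps in the
state `s'`. Every instruction and every evaluation of a test counts as one step. -/
inductive Exec : Prog → State → ℕ → State → Prop
  | instr (i : Instr) (s : State) : Exec (.instr i) s 1 (i.run s)
  | seq {p q : Prog} {s s' s'' : State} {t u : ℕ} :
      Exec p s t s' → Exec q s' u s'' → Exec (.seq p q) s (t + u) s''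
  | iteTrue {c : Cond} {p q : Prog} {s s' : State} {t : ℕ} :
      c.holds s → Exec p s t s' → Exec (.ite c p q) s (t + 1) s'
  | iteFalse {c : Cond} {p q : Prog} {s s' : State} {t : ℕ} :
      ¬ c.holds s → Exec q s t s' → Exec (.ite c p q) s (t + 1) s'
  | loopTrue {c : Cond} {p : Prog} {s s' s'' : State} {t u : ℕ} :
      c.holds s → Exec p s t s' → Exec (.loop c p) s' u s'' →
        Exec (.loop c p) s (t + u + 1) s''
  | loopFalse {c : Cond} {p : Prog} {s : State} :
      ¬ c.holds s → Exec (.loop c p) s 1 s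

/-- `p`, started in `s`, halts after at most `T` steps. -/
def HaltsWithin (p : Prog) (s : State) (T : ℕ) : Prop :=
  ∃ t ≤ T, ∃ s', Exec p s t s'

/-! Renaming: `p.shift w` is `p` with all bank and register indices increased by `w`; it acts on
the window of the memory that starts at `w` and never touches anything below. -/

def Loc.shift (w : ℕ) (l : Loc) : Loc := ⟨l.bank + w, l.addr + w⟩

def Instr.shift (w : ℕ) : Instr → Instr
  | setReg d c => setReg (d + w) c
  | addReg d r s => addReg (d + w) (r + w) (s + w)
  | subReg d r s => subReg (d + w) (r + w) (s + w)
  | setCell d c => setCell (d.shift w) c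
  | move d x => move (d.shift w) (x.shift w)
  | arith o d x y => arith o (d.shift w) (x.shift w) (y.shift w)
  | rand d => rand (d.shift w)

def Cond.shift (w : ℕ) : Cond → Cond
  | regLt r s => regLt (r + w) (s + w)
  | cellLt x y => cellLt (x.shift w) (y.shift w)

def Prog.shift (w : ℕ) : Prog → Prog
  | instr i => instr (i.shift w)
  | seq p q => seq (p.shift w) (q.shift w)
  | ite c p q => ite (c.shift w) (p.shift w) (q.shift w)
  | loop c p => loop (c.shift w) (p.shift w)

/-- A vector, stored in the first `n` cells of a bank (zero elsewhere). -/
noncomputable def storeVec {n : ℕ} (v : Fin n → ℝ) : ℕ → ℝ :=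
  fun a => if h : a < n then v ⟨a, h⟩ else 0

/-- A matrix, stored row by row: the entry `(i, j)` is in cell `i * n + j` (zero elsewhere). -/
noncomputable def storeMat {M n : ℕ} (X : Fin M → Fin n → ℝ) : ℕ → ℝ :=
  storeVec (fun a : Fin (M * n) => X (finProdFinEquiv.symm a).1 (finProdFinEquiv.symm a).2)

/-- Three parameters in registers `0, 1, 2`; all other registers are zero. -/
def paramRegs (a b c : ℕ) : ℕ → ℕ
  | 0 => a
  | 1 => b
  | 2 => c
  | _ => 0

end RealRAM

open RealRAM

/-! ### Sparse linear regression -/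

/-- An instance of sparse linear regression with `M` samples in dimension `n`: design matrix,
target vector and error parameter. -/
structure SLRInstance (M n : ℕ) where
  X : Matrix (Fin M) (Fin n) ℝ
  y : Fin M → ℝ
  δ : ℝ

/-- `θ` has at most `k` non-zero entries. -/
def IsSparse {n : ℕ} (k : ℕ) (θ : Fin n → ℝ) : Prop :=
  {j | θ j ≠ 0}.ncard ≤ k

/-- `θ` is a `k`-sparse solution: `‖X θ - y‖₂² / M ≤ δ²`. -/
def SLRInstance.IsSolution {M n : ℕ} (I : SLRInstance M n) (k : ℕ) (θ : Fin n → ℝ) : Prop :=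
  IsSparse k θ ∧ (∑ i, ((I.X.mulVec θ) i - I.y i) ^ 2) / M ≤ I.δ ^ 2

/-- The start state of a `k`-SLR solver: `M, n, k` in registers `0, 1, 2`, the design matrix, the
target and `δ` in banks `0, 1, 2`, everything else zero. -/
noncomputable def slrInput {M n : ℕ} (k : ℕ) (I : SLRInstance M n) (ω : Coins) : State where
  reg := paramRegs M n k
  mem
    | 0 => storeMat I.X
    | 1 => storeVec I.y
    | 2 => storeVec (fun _ : Fin 1 => I.δ)
    | _ => fun _ => 0
  coins := ω

/-- The vector that a `k`-SLR solver outputs: the first `n` cells of bank `3`. -/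
def slrOutput (n : ℕ) (s : State) : Fin n → ℝ := fun j => s.mem 3 j

/-- `S` runs in time `T` on `k`-SLR instances with `M` samples in dimension `n`. -/
def SLRTime (S : Prog) (M n k T : ℕ) : Prop :=
  ∀ (I : SLRInstance M n) (ω : Coins), 0 < I.δ → HaltsWithin S (slrInput k I ω) T

/-- `S` solves `k`-SLR with `M` samples in dimension `n`: on every instance that has a `k`-sparse
solution, it outputs one with probability at least `q` over its internal randomness. -/
def SolvesSLR (S : Prog) (M n k : ℕ) (q : ℝ) : Prop :=
  ∀ I : SLRInstance M n, 0 < I.δ → (∃ θ, I.IsSolution k θ) →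
    q ≤ coinLaw.real {ω | ∃ t s, Exec S (slrInput k I ω) t s ∧ I.IsSolution k (slrOutput n s)}

/-! ### Continuous learning with errors -/

/-- The representative of `x` modulo `1` in `[-1/2, 1/2)`. -/
noncomputable def mod1 (x : ℝ) : ℝ := x - round x

/-- `m` i.i.d. rows with law `N(0, I_n)`. -/
noncomputable def gaussianRows (m n : ℕ) : Measure (Fin m → Fin n → ℝ) :=
  Measure.pi fun _ : Fin m => Measure.pi fun _ : Fin n => gaussianReal 0 1

/-- The uniform probability measure on the unit sphere of `ℝ^m`. -/
noncomputable def sphereLaw (m : ℕ) :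
    Measure (Metric.sphere (0 : EuclideanSpace ℝ (Fin m)) 1) :=
  ((volume : Measure (EuclideanSpace ℝ (Fin m))).toSphere Set.univ)⁻¹ •
    (volume : Measure (EuclideanSpace ℝ (Fin m))).toSphere

/-- The CLWE law in dimension `m` with `n` samples: the law of `(A, b)` with
`bᵀ = sᵀ A + eᵀ mod 1`, for independent `A ∼ N(0, 1)^(m × n)`, `s` uniform on the sphere of
radius `γ`, and `e ∼ N(0, β² I_n)`. -/
noncomputable def clweLaw (m n : ℕ) (γ β : ℝ) :
    Measure ((Fin m → Fin n → ℝ) × (Fin n → ℝ)) :=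
  ((gaussianRows m n).prod ((sphereLaw m).prod
      (Measure.pi fun _ : Fin n => gaussianReal 0 (Real.toNNReal (β ^ 2))))).map
    fun x => (x.1, fun j => mod1 (∑ i, γ * (x.2.1 : EuclideanSpace ℝ (Fin m)) i * x.1 i j + x.2.2 j))

/-- The null law: `A ∼ N(0, 1)^(m × n)` and, independently, `b` uniform on `[-1/2, 1/2)^n`. -/
noncomputable def nullLaw (m n : ℕ) : Measure ((Fin m → Fin n → ℝ) × (Fin n → ℝ)) :=
  (gaussianRows m n).prod
    (Measure.pi fun _ : Fin n => (volume : Measure ℝ).restrict (Set.Ico (-1 / 2) (1 / 2)))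

/-- The start state of a distinguisher: `m, n, k` in registers `0, 1, 2`, and `A, b` in banks
`0, 1`, everything else zero. -/
noncomputable def clweInput {m n : ℕ} (k : ℕ) (A : Fin m → Fin n → ℝ) (b : Fin n → ℝ)
    (ω : Coins) : State where
  reg := paramRegs m n k
  mem
    | 0 => storeMat A
    | 1 => storeVec b
    | _ => fun _ => 0
  coins := ω

/-- The probability that `D` outputs `1` (it halts with `1` in register `0`) on a sample from
`μ`. -/
noncomputable def acceptProb {m n : ℕ} (D : Prog) (k : ℕ)
    (μ : Measure ((Fin m → Fin n → ℝ) × (Fin n → ℝ))) : ℝ :=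
  (μ.prod coinLaw).real
    {x | ∃ t s, Exec D (clweInput k x.1.1 x.1.2 x.2) t s ∧ s.reg 0 = 1}

/-- The advantage of `D` in telling CLWE samples from null samples. -/
noncomputable def clweAdvantage (D : Prog) (m n k : ℕ) (γ β : ℝ) : ℝ :=
  acceptProb D k (clweLaw m n γ β) - acceptProb D k (nullLaw m n)

/-! ### Reductions -/

/-- A reduction that makes one call to a solver: `pre` prepares the instance in the window of the
memory that starts at `base`, where the solver then runs, and `post` computes the final answer. -/
structure Reduction where
  pre : Prog
  post : Prog
  base : ℕ

/-- The program obtained by plugging a solver into a reduction. -/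
def Reduction.apply (R : Reduction) (S : Prog) : Prog :=
  .seq R.pre (.seq (S.shift R.base) R.post)

/-- `R.pre`, started in `s`, halts after at most `T` steps and hands over the `k`-SLR instance
`I`: the memory that the solver sees is exactly its start state on `I`. -/
def Reduction.Queries {M n : ℕ} (R : Reduction) (s : State) (T k : ℕ) (I : SLRInstance M n) :
    Prop :=
  ∃ t ≤ T, ∃ s', Exec R.pre s t s' ∧ s'.window R.base = slrInput k I s'.coins

/-- The `k × n` block-diagonal matrix with `k` identical blocks `(1, …, 1)` of length `n / k`. -/
def partiteGadget (k n : ℕ) : Matrix (Fin k) (Fin n) ℝ :=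
  Matrix.of fun i j => if (j : ℕ) / (n / k) = i then 1 else 0

/-- The instance with design matrix `X₁` stacked on top of `α` times the gadget. -/
def gadgetInstance {m n k : ℕ} (X₁ : Fin m → Fin n → ℝ) (α : ℝ) (y : Fin (m + k) → ℝ) (δ : ℝ) :
    SLRInstance (m + k) n where
  X := Matrix.of (Fin.append X₁ (α • partiteGadget k n))
  y := y
  δ := δ

/-! ### Semantics of the real RAM -/

namespace RealRAM

/-! The prepared instance has weight `α = mn`, target `y = (0, …, 0, mn, …, mn)` and `δ = 1/m²`.
Thus a solution `θ` makes `A θ` tiny and every block sum of `θ` extremely close to 1. There are `k`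
blocks and at most `k` non-zero entries, so each block holds exactly one non-zero entry, and it is
close to 1. Rounding at `1/2` then yields a set `T` of `k` columns with `‖A 1_T‖ ≤ 1/m`, provided
that the Frobenius norm of `A` is not abnormally large (`isValid_of_isSolution`).

The post-processing checks `|T| = k` and `‖A 1_T‖² ≤ 1/m²`, and accepts if `∑_{j ∈ T} b_j` is within
`1/4` of an integer. For CLWE this sum is `⟨s, A 1_T⟩ + ∑_{j ∈ T} e_j` modulo 1. The first term is
at most `2√m · 1/m` in absolute value, and the second has variance `kβ² = o(1)`, so a valid `T` is
accepted with probability at least `7/8` (`le_acceptProb_clwe`). For null samples, `T` depends only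
on `A` and the coins, since the solver never sees `b`; hence the sum is uniform modulo 1 and a valid
`T` is accepted with probability at most `1/2` (`acceptProb_null_le`). A valid `T` arises equally
often in both cases, because `A` has the same law, and with probability at least `9q/10`
(`le_measure_validSet`). The advantage is at least `(7/8 - 1/2) · 9q/10 > q/4`.

That a solution exists is shown by the second moment method over the `d^k` ways (`d = n/k`) to
choose one column per block. A choice is good if all `m` row sums are at most `1/m²` in absolute
value. Two choices that agree in `l` blocks are correlated only by a factor of about
`(k/(k-l))^{m/2}`. This is at most `x^l` for `x = m^{4m/k}`, and the sum of `x^l` over all second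
choices factors over the blocks (`sum_pow_agree`). If `d ≥ m^{6m/k}`, then `E Z² / (E Z)² ≤
e^{2/m}`, so Chebyshev's inequality gives a good choice with probability tending to 1
(`measure_small_compl_le`, `measure_small_compl_le_exp`).

The machine side consists of a simulation of the renamed solver (`Exec.shift`, `Exec.unshift`), loop
invariants for the two phases (`triple_pre`, `triple_post`), and measurability of halting events
(`measurableSet_exec`). Together with determinism they reduce acceptance to a statement about the
solver's run alone (`accept_iff`). -/

theorem Exec.det {p : Prog} {s : State} {t : ℕ} {u : State} (h : Exec p s t u) :
    ∀ {t' u'}, Exec p s t' u' → t = t' ∧ u = u' := by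
  induction h with
  | instr i s => intro t' u' h'; cases h'; exact ⟨rfl, rfl⟩
  | seq _ _ ih₁ ih₂ =>
    intro t' u' h'
    cases h' with
    | seq a b =>
      obtain ⟨rfl, rfl⟩ := ih₁ a
      obtain ⟨rfl, rfl⟩ := ih₂ b
      exact ⟨rfl, rfl⟩
  | iteTrue hc _ ih =>
    intro t' u' h'
    cases h' with
    | iteTrue _ a => obtain ⟨rfl, rfl⟩ := ih a; exact ⟨rfl, rfl⟩
    | iteFalse hn _ => exact absurd hc hn
  | iteFalse hc _ ih =>
    intro t' u' h'
    cases h' with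
    | iteTrue hn _ => exact absurd hn hc
    | iteFalse _ a => obtain ⟨rfl, rfl⟩ := ih a; exact ⟨rfl, rfl⟩
  | loopTrue hc _ _ ih₁ ih₂ =>
    intro t' u' h'
    cases h' with
    | loopTrue _ a b =>
      obtain ⟨rfl, rfl⟩ := ih₁ a
      obtain ⟨rfl, rfl⟩ := ih₂ b
      exact ⟨rfl, rfl⟩
    | loopFalse hn => exact absurd hc hn
  | loopFalse hc =>
    intro t' u' h'
    cases h' with
    | loopTrue hn _ _ => exact absurd hn hc
    | loopFalse _ => exact ⟨rfl, rfl⟩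

/-! #### Shifted programs -/

@[ext] theorem State.ext' {s t : State} (h₁ : s.reg = t.reg) (h₂ : s.mem = t.mem)
    (h₃ : s.coins = t.coins) : s = t := by
  cases s; cases t; simp_all

/-- The registers and banks below `w` agree. -/
def AgreeBelow (w : ℕ) (s t : State) : Prop :=
  (∀ r < w, s.reg r = t.reg r) ∧ ∀ b < w, s.mem b = t.mem b

theorem AgreeBelow.refl (w : ℕ) (s : State) : AgreeBelow w s s := ⟨fun _ _ => rfl, fun _ _ => rfl⟩

theorem AgreeBelow.trans {w : ℕ} {s t u : State} (h : AgreeBelow w s t) (h' : AgreeBelow w t u) :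
    AgreeBelow w s u :=
  ⟨fun r hr => (h.1 r hr).trans (h'.1 r hr), fun b hb => (h.2 b hb).trans (h'.2 b hb)⟩

theorem window_setReg (w d v : ℕ) (s : State) :
    (s.setReg (d + w) v).window w = (s.window w).setReg d v := by
  ext r
  · by_cases h : r = d <;> simp [State.window, State.setReg, Function.update, h]
  · rfl
  · rfl

theorem window_set (w : ℕ) (l : Loc) (v : ℝ) (s : State) :
    (s.set (l.shift w) v).window w = (s.window w).set l v := by
  ext b a
  · rfl
  · by_cases h : b = l.bank <;> simp [State.window, State.set, Function.update, h, Loc.shift]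
  · rfl

theorem agreeBelow_setReg (w d v : ℕ) (s : State) : AgreeBelow w s (s.setReg (d + w) v) := by
  refine ⟨fun r hr => ?_, fun _ _ => rfl⟩
  have : r ≠ d + w := by omega
  simp [State.setReg, this]

theorem agreeBelow_set (w : ℕ) (l : Loc) (v : ℝ) (s : State) :
    AgreeBelow w s (s.set (l.shift w) v) := by
  refine ⟨fun _ _ => rfl, fun b hb => ?_⟩
  have : b ≠ l.bank + w := by omega
  simp [State.set, Loc.shift, this]

theorem Instr.window_run (w : ℕ) (i : Instr) (s : State) :
    ((i.shift w).run s).window w = i.run (s.window w) := by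
  cases i with
  | setReg d c => exact window_setReg ..
  | addReg d r t => exact window_setReg ..
  | subReg d r t => exact window_setReg ..
  | setCell d c => exact window_set ..
  | move d x => exact window_set ..
  | arith o d x y => exact window_set ..
  | rand d =>
    have := window_set w d (s.coins 0 : ℝ) s
    ext b a
    · rfl
    · exact congrFun (congrFun (congrArg State.mem this) b) a
    · rfl

theorem Instr.agreeBelow_run (w : ℕ) (i : Instr) (s : State) :
    AgreeBelow w s ((i.shift w).run s) := by
  cases i with
  | setReg d c => exact agreeBelow_setReg ..
  | addReg d r t => exact agreeBelow_setReg ..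
  | subReg d r t => exact agreeBelow_setReg ..
  | setCell d c => exact agreeBelow_set ..
  | move d x => exact agreeBelow_set ..
  | arith o d x y => exact agreeBelow_set ..
  | rand d => exact agreeBelow_set w d _ s

theorem Cond.holds_shift (w : ℕ) (c : Cond) (s : State) :
    (c.shift w).holds s ↔ c.holds (s.window w) := by
  cases c <;> exact Iff.rfl

/-- A renamed instruction acts on the window exactly as the original acts on the whole memory, and
this propagates along the run with the same step count. Agreement below `w` is carried along because
the post-processing later reads data stored there. -/
theorem Exec.shift {w : ℕ} {p : Prog} {v : State} {t : ℕ} {u : State} (h : Exec p v t u) :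
    ∀ s : State, s.window w = v →
      ∃ s', Exec (p.shift w) s t s' ∧ s'.window w = u ∧ AgreeBelow w s s' := by
  induction h with
  | instr i v =>
    rintro s rfl
    exact ⟨_, .instr _ _, Instr.window_run .., Instr.agreeBelow_run ..⟩
  | seq _ _ ih₁ ih₂ =>
    intro s hs
    obtain ⟨s', e, h', a⟩ := ih₁ s hs
    obtain ⟨s'', e', h'', a'⟩ := ih₂ s' h'
    exact ⟨s'', .seq e e', h'', a.trans a'⟩
  | iteTrue hc _ ih =>
    rintro s rfl
    obtain ⟨s', e, h', a⟩ := ih s rfl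
    exact ⟨s', .iteTrue ((Cond.holds_shift ..).2 hc) e, h', a⟩
  | iteFalse hc _ ih =>
    rintro s rfl
    obtain ⟨s', e, h', a⟩ := ih s rfl
    exact ⟨s', .iteFalse (mt (Cond.holds_shift ..).1 hc) e, h', a⟩
  | loopTrue hc _ _ ih₁ ih₂ =>
    rintro s rfl
    obtain ⟨s', e, h', a⟩ := ih₁ s rfl
    obtain ⟨s'', e', h'', a'⟩ := ih₂ s' h'
    exact ⟨s'', .loopTrue ((Cond.holds_shift ..).2 hc) e e', h'', a.trans a'⟩
  | loopFalse hc =>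
    rintro s rfl
    exact ⟨s, .loopFalse (mt (Cond.holds_shift ..).1 hc), rfl, .refl ..⟩

/-- Converse simulation: solvers may diverge, so from a halting run of the composed program one must
recover a halting run of the solver itself. The program is kept general, with an equation, to permit
induction on the run. -/
theorem Exec.unshift {w : ℕ} {p' : Prog} {s : State} {t : ℕ} {s' : State} (h : Exec p' s t s') :
    ∀ p : Prog, p' = p.shift w → Exec p (s.window w) t (s'.window w) := by
  induction h with
  | instr i s =>
    intro p hp
    cases p <;> simp only [Prog.shift, reduceCtorEq, Prog.instr.injEq] at hp
    subst hp
    rw [Instr.window_run]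
    exact .instr _ _
  | seq _ _ ih₁ ih₂ =>
    intro p hp
    cases p <;> simp only [Prog.shift, reduceCtorEq, Prog.seq.injEq] at hp
    exact .seq (ih₁ _ hp.1) (ih₂ _ hp.2)
  | iteTrue hc _ ih =>
    intro p hp
    cases p <;> simp only [Prog.shift, reduceCtorEq, Prog.ite.injEq] at hp
    exact .iteTrue ((Cond.holds_shift ..).1 (hp.1 ▸ hc)) (ih _ hp.2.1)
  | iteFalse hc _ ih =>
    intro p hp
    cases p <;> simp only [Prog.shift, reduceCtorEq, Prog.ite.injEq] at hp
    exact .iteFalse (mt (Cond.holds_shift ..).2 (hp.1 ▸ hc)) (ih _ hp.2.2)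
  | loopTrue hc _ _ ih₁ ih₂ =>
    intro p hp
    have h₂ := ih₂ p hp
    cases p <;> simp only [Prog.shift, reduceCtorEq, Prog.loop.injEq] at hp
    exact .loopTrue ((Cond.holds_shift ..).1 (hp.1 ▸ hc)) (ih₁ _ hp.2) h₂
  | loopFalse hc =>
    intro p hp
    cases p <;> simp only [Prog.shift, reduceCtorEq, Prog.loop.injEq] at hp
    exact .loopFalse (mt (Cond.holds_shift ..).2 (hp.1 ▸ hc))

/-! #### Total correctness with a time bound -/

/-- Started in any state satisfying `P`, the program `p` halts after at most `T` steps in a state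
satisfying `Q`. -/
def Triple (P : State → Prop) (p : Prog) (T : ℕ) (Q : State → Prop) : Prop :=
  ∀ s, P s → ∃ t ≤ T, ∃ s', Exec p s t s' ∧ Q s'

theorem Triple.seq {P Q R : State → Prop} {p q : Prog} {T U : ℕ} (h : Triple P p T Q)
    (h' : Triple Q q U R) : Triple P (.seq p q) (T + U) R := by
  intro s hs
  obtain ⟨t, ht, s', e, hs'⟩ := h s hs
  obtain ⟨u, hu, s'', e', hs''⟩ := h' s' hs'
  exact ⟨t + u, by omega, s'', .seq e e', hs''⟩

theorem Triple.mono {P P' Q Q' : State → Prop} {p : Prog} {T T' : ℕ} (h : Triple P p T Q)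
    (hP : ∀ s, P' s → P s) (hT : T ≤ T') (hQ : ∀ s, Q s → Q' s) : Triple P' p T' Q' := by
  intro s hs
  obtain ⟨t, ht, s', e, hs'⟩ := h s (hP s hs)
  exact ⟨t, ht.trans hT, s', e, hQ _ hs'⟩

/-- The invariant is indexed by the number of completed passes, and `hc` fixes that number to `N`.
Each pass costs the body and one test; the final `+ 1` is the failing test. -/
theorem Triple.loop {c : Cond} {p : Prog} {B N : ℕ} (I : ℕ → State → Prop)
    (hc : ∀ j ≤ N, ∀ s, I j s → (c.holds s ↔ j < N))
    (hp : ∀ j < N, Triple (I j) p B (I (j + 1))) :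
    Triple (I 0) (.loop c p) (N * (B + 1) + 1) (I N) := by
  suffices H : ∀ i j, j + i = N → Triple (I j) (.loop c p) (i * (B + 1) + 1) (I N) from
    H N 0 (by omega)
  intro i
  induction i with
  | zero =>
    intro j hj s hs
    have : j = N := by omega
    subst this
    exact ⟨1, by omega, s, .loopFalse (by simp [hc j le_rfl s hs]), hs⟩
  | succ i ih =>
    intro j hj s hs
    obtain ⟨t, ht, s', e, hs'⟩ := hp j (by omega) s hs
    obtain ⟨u, hu, s'', e', hs''⟩ := ih (j + 1) (by omega) s' hs'
    refine ⟨t + u + 1, ?_, s'', .loopTrue ((hc j (by omega) s hs).2 (by omega)) e e', hs''⟩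
    rw [Nat.succ_mul]
    omega

/-- The effect of a program without loops. -/
noncomputable def Prog.eval : Prog → State → State
  | instr i, s => i.run s
  | seq p q, s => q.eval (p.eval s)
  | ite c p q, s => open Classical in if c.holds s then p.eval s else q.eval s
  | loop _ _, s => s

def Prog.LoopFree : Prog → Prop
  | instr _ => True
  | seq p q => p.LoopFree ∧ q.LoopFree
  | ite _ p q => p.LoopFree ∧ q.LoopFree
  | loop _ _ => False

/-- A bound for the running time of a program without loops. -/
def Prog.cost : Prog → ℕ
  | instr _ => 1
  | seq p q => p.cost + q.cost
  | ite _ p q => p.cost + q.cost + 1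
  | loop _ _ => 0

theorem Prog.exec_eval (p : Prog) (hp : p.LoopFree) (s : State) :
    ∃ t ≤ p.cost, Exec p s t (p.eval s) := by
  induction p generalizing s with
  | instr i => exact ⟨1, le_rfl, .instr i s⟩
  | seq p q ihp ihq =>
    obtain ⟨t, ht, e⟩ := ihp hp.1 s
    obtain ⟨u, hu, e'⟩ := ihq hp.2 (p.eval s)
    exact ⟨t + u, Nat.add_le_add ht hu, .seq e e'⟩
  | ite c p q ihp ihq =>
    obtain ⟨t, ht, e⟩ := ihp hp.1 s
    obtain ⟨u, hu, e'⟩ := ihq hp.2 s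
    by_cases hc : c.holds s
    · refine ⟨t + 1, by simp only [Prog.cost]; omega, ?_⟩
      rw [Prog.eval, if_pos hc]
      exact .iteTrue hc e
    · refine ⟨u + 1, by simp only [Prog.cost]; omega, ?_⟩
      rw [Prog.eval, if_neg hc]
      exact .iteFalse hc e'
  | loop c p => exact hp.elim

theorem Triple.loopFree {P Q : State → Prop} {p : Prog} {T : ℕ} (hp : p.LoopFree)
    (hT : p.cost ≤ T) (h : ∀ s, P s → Q (p.eval s)) : Triple P p T Q := by
  intro s hs
  obtain ⟨t, ht, e⟩ := p.exec_eval hp s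
  exact ⟨t, ht.trans hT, _, e, h s hs⟩

/-- Straight-line programs. -/
def block (i : Instr) : List Instr → Prog
  | [] => .instr i
  | j :: l => .seq (.instr i) (block j l)

/-! ### Rewriting rules for symbolic execution of straight-line code. -/

@[simp] theorem State.reg_setReg (s : State) (d v r : ℕ) :
    (s.setReg d v).reg r = if r = d then v else s.reg r := by
  simp [State.setReg, Function.update_apply]

@[simp] theorem State.mem_setReg (s : State) (d v b a : ℕ) :
    (s.setReg d v).mem b a = s.mem b a := rfl

@[simp] theorem State.coins_setReg (s : State) (d v : ℕ) : (s.setReg d v).coins = s.coins := rfl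

@[simp] theorem State.reg_set (s : State) (l : Loc) (v : ℝ) (r : ℕ) :
    (s.set l v).reg r = s.reg r := rfl

@[simp] theorem State.mem_set (s : State) (l : Loc) (v : ℝ) (b a : ℕ) :
    (s.set l v).mem b a =
      if b = l.bank then if a = s.reg l.addr then v else s.mem b a else s.mem b a := by
  by_cases h : b = l.bank
  · subst h; simp [State.set, Function.update_apply]
  · simp [State.set, h]

@[simp] theorem State.coins_set (s : State) (l : Loc) (v : ℝ) : (s.set l v).coins = s.coins := rfl

@[simp] theorem State.get_eq (s : State) (l : Loc) : s.get l = s.mem l.bank (s.reg l.addr) := rfl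

/-! #### Measurability -/

instance instMeasurableSpaceState : MeasurableSpace State :=
  MeasurableSpace.comap (fun s => (s.reg, s.mem, s.coins)) inferInstance

theorem measurable_toProd : Measurable (fun s : State => (s.reg, s.mem, s.coins)) :=
  comap_measurable _

theorem measurable_reg (r : ℕ) : Measurable (fun s : State => s.reg r) :=
  (measurable_pi_apply r).comp (measurable_fst.comp measurable_toProd)

theorem measurable_mem (b a : ℕ) : Measurable (fun s : State => s.mem b a) :=
  (measurable_pi_apply a).comp ((measurable_pi_apply b).comp
    (measurable_fst.comp (measurable_snd.comp measurable_toProd)))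

theorem measurable_coins : Measurable (fun s : State => s.coins) :=
  measurable_snd.comp (measurable_snd.comp measurable_toProd)

theorem measurable_state {α : Type*} [MeasurableSpace α] {f : α → State}
    (h₁ : ∀ r, Measurable fun x => (f x).reg r) (h₂ : ∀ b a, Measurable fun x => (f x).mem b a)
    (h₃ : Measurable fun x => (f x).coins) : Measurable f := by
  refine Measurable.of_comap_le ?_
  have : Measurable fun x => ((f x).reg, (f x).mem, (f x).coins) :=
    (measurable_pi_lambda _ h₁).prodMk
      ((measurable_pi_lambda _ fun b => measurable_pi_lambda _ (h₂ b)).prodMk h₃)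
  rw [instMeasurableSpaceState, MeasurableSpace.comap_comp]
  exact this.comap_le

/-- Under indirect addressing the address is part of the state, but it takes only countably many
values; on each of them a fixed coordinate is read. -/
theorem measurable_get (l : Loc) : Measurable (fun s : State => s.get l) := by
  intro B hB
  have : (fun s : State => s.get l) ⁻¹' B =
      ⋃ n : ℕ, {s | s.reg l.addr = n} ∩ {s | s.mem l.bank n ∈ B} := by
    ext s; simp [State.get]
  rw [this]
  exact MeasurableSet.iUnion fun n => (measurable_reg _ (measurableSet_singleton n)).inter
    (measurable_mem _ _ hB)

theorem measurable_setReg {v : State → ℕ} (hv : Measurable v) (d : ℕ) :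
    Measurable fun s : State => s.setReg d (v s) := by
  refine measurable_state (f := fun s : State => s.setReg d (v s)) (fun r => ?_) measurable_mem
    measurable_coins
  by_cases h : r = d
  · subst h; simpa [State.setReg] using hv
  · simpa [State.setReg, h] using measurable_reg r

theorem measurable_set {v : State → ℝ} (hv : Measurable v) (l : Loc) :
    Measurable fun s : State => s.set l (v s) := by
  refine measurable_state (f := fun s : State => s.set l (v s)) measurable_reg (fun b a => ?_)
    measurable_coins
  by_cases h : b = l.bank
  · subst h
    have : (fun s => (s.set l (v s)).mem l.bank a) =
        fun s => if a = s.reg l.addr then v s else s.mem l.bank a := by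
      funext x; simp [State.set, Function.update_apply]
    rw [this]
    exact Measurable.ite (measurable_reg l.addr (MeasurableSet.of_discrete (s := {n | a = n})))
      hv (measurable_mem _ _)
  · simpa [State.set, h] using measurable_mem b a

theorem ArithOp.measurable_eval (o : ArithOp) {α : Type*} [MeasurableSpace α] {f g : α → ℝ}
    (hf : Measurable f) (hg : Measurable g) : Measurable fun x => o.eval (f x) (g x) := by
  cases o
  · exact hf.add hg
  · exact hf.sub hg
  · exact hf.mul hg
  · exact hf.div hg

theorem Instr.measurable_run (i : Instr) : Measurable i.run := by
  cases i with
  | setReg d c => exact measurable_setReg measurable_const d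
  | addReg d r t =>
    exact measurable_setReg ((measurable_reg r).add (measurable_reg t)) d
  | subReg d r t =>
    exact measurable_setReg ((measurable_reg r).sub (measurable_reg t)) d
  | setCell d c => exact measurable_set measurable_const d
  | move d x => exact measurable_set (measurable_get x) d
  | arith o d x y =>
    exact measurable_set (o.measurable_eval (measurable_get x) (measurable_get y)) d
  | rand d =>
    have hc : Measurable fun s : State => ((s.coins 0 : unitInterval) : ℝ) :=
      measurable_subtype_coe.comp ((measurable_pi_apply 0).comp measurable_coins)
    have := measurable_set hc d
    exact measurable_state (f := (Instr.rand d).run) measurable_reg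
      (fun b a => show Measurable fun s : State => (s.set d (s.coins 0 : ℝ)).mem b a from
        (measurable_mem b a).comp this)
      (measurable_pi_lambda _ fun i => (measurable_pi_apply (i + 1)).comp measurable_coins)

theorem Cond.measurableSet (c : Cond) : MeasurableSet {s | c.holds s} := by
  cases c with
  | regLt r t => exact measurableSet_lt (measurable_reg r) (measurable_reg t)
  | cellLt x y => exact measurableSet_lt (measurable_get x) (measurable_get y)

/-- With the running time `t` fixed, a run splits into subruns in finitely many ways, so the event
is a countable combination of preimages under measurable instructions. Halting at any time is then a
countable union over `t`. -/
theorem measurableSet_exec (p : Prog) : ∀ (t : ℕ) {B : Set State}, MeasurableSet B →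
    MeasurableSet {s | ∃ s', Exec p s t s' ∧ s' ∈ B} := by
  induction p with
  | instr i =>
    intro t B hB
    by_cases ht : t = 1
    · subst ht
      convert i.measurable_run hB using 1
      ext s
      constructor
      · rintro ⟨s', h, hs'⟩; cases h; exact hs'
      · intro h; exact ⟨_, .instr i s, h⟩
    · convert MeasurableSet.empty using 1
      ext s
      simp only [Set.mem_ofPred_eq, Set.mem_empty_iff_false, iff_false]
      rintro ⟨s', h, -⟩; cases h; exact ht rfl
  | seq p q ihp ihq =>
    intro t B hB
    have : {s | ∃ s', Exec (.seq p q) s t s' ∧ s' ∈ B} = ⋃ (a : ℕ) (b : ℕ) (_ : a + b = t),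
        {s | ∃ s', Exec p s a s' ∧ s' ∈ {s' | ∃ s'', Exec q s' b s'' ∧ s'' ∈ B}} := by
      ext s
      simp only [Set.mem_ofPred_eq, Set.mem_iUnion]
      constructor
      · rintro ⟨s', h, hs'⟩
        cases h with
        | seq h₁ h₂ => exact ⟨_, _, rfl, _, h₁, _, h₂, hs'⟩
      · rintro ⟨a, b, rfl, s', h₁, s'', h₂, hs⟩
        exact ⟨_, .seq h₁ h₂, hs⟩
    rw [this]
    exact .iUnion fun a => .iUnion fun b => .iUnion fun _ => ihp a (ihq b hB)
  | ite c p q ihp ihq =>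
    intro t B hB
    have : {s | ∃ s', Exec (.ite c p q) s t s' ∧ s' ∈ B} = ⋃ (a : ℕ) (_ : a + 1 = t),
        ({s | c.holds s} ∩ {s | ∃ s', Exec p s a s' ∧ s' ∈ B}) ∪
        ({s | c.holds s}ᶜ ∩ {s | ∃ s', Exec q s a s' ∧ s' ∈ B}) := by
      ext s
      simp only [Set.mem_ofPred_eq, Set.mem_iUnion, Set.mem_union, Set.mem_inter_iff,
        Set.mem_compl_iff]
      constructor
      · rintro ⟨s', h, hs'⟩
        cases h with
        | iteTrue hc h => exact ⟨_, rfl, .inl ⟨hc, _, h, hs'⟩⟩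
        | iteFalse hc h => exact ⟨_, rfl, .inr ⟨hc, _, h, hs'⟩⟩
      · rintro ⟨a, rfl, ⟨hc, s', h, hs⟩ | ⟨hc, s', h, hs⟩⟩
        · exact ⟨_, .iteTrue hc h, hs⟩
        · exact ⟨_, .iteFalse hc h, hs⟩
    rw [this]
    exact .iUnion fun a => .iUnion fun _ =>
      (c.measurableSet.inter (ihp a hB)).union (c.measurableSet.compl.inter (ihq a hB))
  | loop c p ihp =>
    intro t
    -- After one pass the same loop is run again, but with strictly less time left.
    induction t using Nat.strong_induction_on with
    | _ t iht =>
    intro B hB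
    have : {s | ∃ s', Exec (.loop c p) s t s' ∧ s' ∈ B} =
        (⋃ (a : ℕ) (b : ℕ) (_ : a + b + 1 = t), {s | c.holds s} ∩
        {s | ∃ s', Exec p s a s' ∧ s' ∈ {s' | ∃ s'', Exec (.loop c p) s' b s'' ∧ s'' ∈ B}}) ∪
        ⋃ (_ : t = 1), {s | c.holds s}ᶜ ∩ B := by
      ext s
      simp only [Set.mem_ofPred_eq, Set.mem_iUnion, Set.mem_union, Set.mem_inter_iff,
        Set.mem_compl_iff]
      constructor
      · rintro ⟨s', h, hs'⟩
        cases h with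
        | loopTrue hc h h' => exact .inl ⟨_, _, rfl, hc, _, h, _, h', hs'⟩
        | loopFalse hc => exact .inr ⟨rfl, hc, hs'⟩
      · rintro (⟨a, b, rfl, hc, s', h₁, s'', h₂, hs⟩ | ⟨rfl, hc, hs⟩)
        · exact ⟨_, .loopTrue hc h₁ h₂, hs⟩
        · exact ⟨_, .loopFalse hc, hs⟩
    rw [this]
    exact (MeasurableSet.iUnion fun a => .iUnion fun b => .iUnion fun h =>
      c.measurableSet.inter (ihp a (iht b (by omega) hB))).union
      (.iUnion fun _ => c.measurableSet.compl.inter hB)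

end RealRAM

/-! ### The pre-processing -/

namespace GadgetReduction

/-- The scalar cell `0` of bank `b`; register `3` is always zero. -/
def sc (b : ℕ) : Loc := ⟨b, 3⟩

/-- `reg 6 := m * n` and `cell (sc 3) := m`. -/
def preSize : Prog :=
  .loop (.regLt 5 0)
    (block (.addReg 6 6 1) [.arith .add (sc 3) (sc 3) (sc 2), .addReg 5 5 4])

/-- Copies the matrix and sets `cell (sc 4) := m * n`. -/
def preCopy : Prog :=
  .loop (.regLt 5 6)
    (block (.move ⟨16, 5⟩ ⟨0, 5⟩) [.arith .add (sc 4) (sc 4) (sc 2), .addReg 5 5 4])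

/-- `reg 7 := n / k`. -/
def preDiv : Prog :=
  .loop (.regLt 9 1) (block (.addReg 9 9 2) [.addReg 7 7 4])

/-- Writes one row of the gadget. -/
def preRow : Prog :=
  .loop (.regLt 9 7) (block (.move ⟨16, 8⟩ (sc 4)) [.addReg 8 8 4, .addReg 9 9 4])

/-- Writes the gadget and the target. -/
def preGadget : Prog :=
  .loop (.regLt 5 2)
    (.seq (.instr (.setReg 9 0)) (.seq preRow
      (block (.addReg 8 8 1) [.move ⟨17, 10⟩ (sc 4), .addReg 10 10 4, .addReg 5 5 4])))

def pre : Prog :=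
  .seq (block (.setReg 4 1) [.setCell (sc 2) 1]) <| .seq preSize <|
  .seq (.instr (.setReg 5 0)) <| .seq preCopy <| .seq preDiv <|
  .seq (block (.arith .mul (sc 5) (sc 3) (sc 3))
    [.arith .div (sc 5) (sc 2) (sc 5), .move ⟨18, 3⟩ (sc 5), .setReg 5 0, .addReg 8 6 3,
      .addReg 10 0 3, .addReg 16 0 2, .addReg 17 1 3, .addReg 18 2 3])
  preGadget

/-- What the pre-processing leaves unchanged. -/
structure PreFrame (m n k : ℕ) (a₀ b₀ : ℕ → ℝ) (ω : Coins) (s : State) : Prop where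
  r0 : s.reg 0 = m
  r1 : s.reg 1 = n
  r2 : s.reg 2 = k
  r3 : s.reg 3 = 0
  r4 : s.reg 4 = 1
  rs : ∀ r, s.reg (r + 19) = 0
  m0 : ∀ a, s.mem 0 a = a₀ a
  m1 : ∀ a, s.mem 1 a = b₀ a
  m2 : s.mem 2 0 = 1
  ms : ∀ b a, s.mem (b + 19) a = 0
  co : s.coins = ω

structure SizeInv (m n k : ℕ) (a₀ b₀ : ℕ → ℝ) (ω : Coins) (j : ℕ) (s : State) : Prop
    extends PreFrame m n k a₀ b₀ ω s where
  r5 : s.reg 5 = j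
  r6 : s.reg 6 = j * n
  r7 : s.reg 7 = 0
  r9 : s.reg 9 = 0
  m3 : s.mem 3 0 = j
  m4 : s.mem 4 0 = 0
  m16 : ∀ a, s.mem 16 a = 0
  m17 : ∀ a, s.mem 17 a = 0
  m18 : ∀ a, s.mem 18 a = 0

structure CopyInv (m n k : ℕ) (a₀ b₀ : ℕ → ℝ) (ω : Coins) (j : ℕ) (s : State) : Prop
    extends PreFrame m n k a₀ b₀ ω s where
  r5 : s.reg 5 = j
  r6 : s.reg 6 = m * n
  r7 : s.reg 7 = 0
  r9 : s.reg 9 = 0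
  m3 : s.mem 3 0 = m
  m4 : s.mem 4 0 = j
  m16 : ∀ a, s.mem 16 a = if a < j then a₀ a else 0
  m17 : ∀ a, s.mem 17 a = 0
  m18 : ∀ a, s.mem 18 a = 0

structure DivInv (m n k : ℕ) (a₀ b₀ : ℕ → ℝ) (ω : Coins) (j : ℕ) (s : State) : Prop
    extends PreFrame m n k a₀ b₀ ω s where
  r6 : s.reg 6 = m * n
  r7 : s.reg 7 = j
  r9 : s.reg 9 = j * k
  m3 : s.mem 3 0 = m
  m4 : s.mem 4 0 = m * n
  m16 : ∀ a, s.mem 16 a = if a < m * n then a₀ a else 0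
  m17 : ∀ a, s.mem 17 a = 0
  m18 : ∀ a, s.mem 18 a = 0

/-- `F` and `Y` are the final contents of the banks `16` and `17`. -/
structure GadgetFrame (m n k d : ℕ) (a₀ b₀ : ℕ → ℝ) (ω : Coins) (Y : ℕ → ℝ) (j : ℕ)
    (s : State) : Prop extends PreFrame m n k a₀ b₀ ω s where
  r5 : s.reg 5 = j
  r7 : s.reg 7 = d
  r10 : s.reg 10 = m + j
  r16 : s.reg 16 = m + k
  r17 : s.reg 17 = n
  r18 : s.reg 18 = k
  m4 : s.mem 4 0 = m * n
  m5 : s.mem 5 0 = 1 / (m * m)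
  m17 : ∀ a, s.mem 17 a = if a < m + j then Y a else 0
  m18 : ∀ a, s.mem 18 a = if a = 0 then 1 / (m * m : ℝ) else 0

structure GadgetInv (m n k d : ℕ) (a₀ b₀ : ℕ → ℝ) (ω : Coins) (F Y : ℕ → ℝ) (j : ℕ)
    (s : State) : Prop extends GadgetFrame m n k d a₀ b₀ ω Y j s where
  r8 : s.reg 8 = m * n + j * (n + d)
  m16 : ∀ a, s.mem 16 a = if a < m * n + j * (n + d) then F a else 0

structure RowInv (m n k d : ℕ) (a₀ b₀ : ℕ → ℝ) (ω : Coins) (F Y : ℕ → ℝ) (j t : ℕ)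
    (s : State) : Prop extends GadgetFrame m n k d a₀ b₀ ω Y j s where
  r8 : s.reg 8 = m * n + j * (n + d) + t
  r9 : s.reg 9 = t
  m16 : ∀ a, s.mem 16 a = if a < m * n + j * (n + d) + t then F a else 0

variable {m n k d : ℕ} {a₀ b₀ : ℕ → ℝ} {ω : Coins}

theorem triple_preSize :
    Triple (SizeInv m n k a₀ b₀ ω 0) preSize (m * (3 + 1) + 1) (SizeInv m n k a₀ b₀ ω m) := by
  refine Triple.loop _ (fun j _ s h => ?_) (fun j _ => ?_)
  · simp [Cond.holds, h.r5, h.r0]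
  · refine Triple.loopFree (by simp [block, Prog.LoopFree]) (by simp [block, Prog.cost])
      fun s h => ?_
    obtain ⟨⟨⟩, _⟩ := h
    constructor
    · constructor <;> simp [block, Prog.eval, Instr.run, sc, ArithOp.eval, *]
    all_goals simp [block, Prog.eval, Instr.run, sc, ArithOp.eval, *]
    ring

theorem triple_preCopy :
    Triple (CopyInv m n k a₀ b₀ ω 0) preCopy (m * n * (3 + 1) + 1)
      (CopyInv m n k a₀ b₀ ω (m * n)) := by
  refine Triple.loop _ (fun j _ s h => ?_) (fun j _ => ?_)
  · simp [Cond.holds, h.r5, h.r6]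
  · refine Triple.loopFree (by simp [block, Prog.LoopFree]) (by simp [block, Prog.cost])
      fun s h => ?_
    obtain ⟨⟨⟩, _⟩ := h
    constructor
    · constructor <;> simp [block, Prog.eval, Instr.run, sc, ArithOp.eval, *]
    all_goals simp [block, Prog.eval, Instr.run, sc, ArithOp.eval, *]
    intro a
    rcases lt_trichotomy a j with h | h | h
    · simp [h, h.ne, h.le]
    · simp [h]
    · simp [h.ne', h.not_gt, h.not_ge]

/-- The quotient is found by counting how often `k` must be added to reach `n`; exact divisibility
makes the loop stop after precisely `d` passes. -/
theorem triple_preDiv (hk : 0 < k) (hn : n = d * k) :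
    Triple (DivInv m n k a₀ b₀ ω 0) preDiv (d * (2 + 1) + 1) (DivInv m n k a₀ b₀ ω d) := by
  refine Triple.loop _ (fun j _ s h => ?_) (fun j _ => ?_)
  · simp [Cond.holds, h.r9, h.r1, hn, hk]
  · refine Triple.loopFree (by simp [block, Prog.LoopFree]) (by simp [block, Prog.cost])
      fun s h => ?_
    obtain ⟨⟨⟩, _⟩ := h
    constructor
    · constructor <;> simp [block, Prog.eval, Instr.run, *]
    all_goals simp [block, Prog.eval, Instr.run, *]
    ring

theorem triple_preRow {F Y : ℕ → ℝ} {j : ℕ}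
    (hF : ∀ t < d, F (m * n + j * (n + d) + t) = m * n) :
    Triple (RowInv m n k d a₀ b₀ ω F Y j 0) preRow (d * (3 + 1) + 1)
      (RowInv m n k d a₀ b₀ ω F Y j d) := by
  refine Triple.loop _ (fun j _ s h => ?_) (fun t ht => ?_)
  · simp [Cond.holds, h.r9, h.r7]
  · refine Triple.loopFree (by simp [block, Prog.LoopFree]) (by simp [block, Prog.cost])
      fun s h => ?_
    specialize hF t ht
    obtain ⟨⟨⟨⟩, _⟩, _⟩ := h
    constructor
    · constructor
      · constructor <;> simp [block, Prog.eval, Instr.run, sc, *]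
      all_goals simp [block, Prog.eval, Instr.run, sc, *]
    all_goals simp [block, Prog.eval, Instr.run, sc, *]
    · omega
    · intro a
      rcases lt_trichotomy a (m * n + j * (n + d) + t) with h | h | h
      · simp [h, h.ne, show a < m * n + j * (n + d) + (t + 1) by omega]
      · simp [h, hF]
      · simp [h.ne', h.not_gt, show ¬ a < m * n + j * (n + d) + (t + 1) by omega]

/-- In row-major order the entries `α` of gadget row `j` begin at `(m + j) n + j d = m n + j (n +
d)`. So the write address advances by `d` while writing and then jumps by `n`. Skipped cells are
already zero, which is what `hF'` demands of the final content. -/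
theorem triple_preGadget {F Y : ℕ → ℝ}
    (hF : ∀ j < k, ∀ t < d, F (m * n + j * (n + d) + t) = m * n)
    (hF' : ∀ j < k, ∀ t < n, F (m * n + j * (n + d) + d + t) = 0)
    (hY : ∀ j < k, Y (m + j) = m * n) :
    Triple (GadgetInv m n k d a₀ b₀ ω F Y 0) preGadget (k * (d * (3 + 1) + 6 + 1) + 1)
      (GadgetInv m n k d a₀ b₀ ω F Y k) := by
  refine Triple.loop _ (fun j _ s h => ?_) (fun j hj => ?_)
  · simp [Cond.holds, h.r5, h.r2]
  · have h1 : Triple (GadgetInv m n k d a₀ b₀ ω F Y j) (.instr (.setReg 9 0)) 1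
        (RowInv m n k d a₀ b₀ ω F Y j 0) := by
      refine Triple.loopFree trivial le_rfl fun s h => ?_
      obtain ⟨⟨⟨⟩, _⟩, _⟩ := h
      constructor
      · constructor
        · constructor <;> simp [Prog.eval, Instr.run, *]
        all_goals simp [Prog.eval, Instr.run, *]
      all_goals simp [Prog.eval, Instr.run, *]
    have h3 : Triple (RowInv m n k d a₀ b₀ ω F Y j d)
        (block (.addReg 8 8 1) [.move ⟨17, 10⟩ (sc 4), .addReg 10 10 4, .addReg 5 5 4]) 4
        (GadgetInv m n k d a₀ b₀ ω F Y (j + 1)) := by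
      refine Triple.loopFree (by simp [block, Prog.LoopFree]) (by simp [block, Prog.cost])
        fun s h => ?_
      specialize hF' j hj
      specialize hY j hj
      obtain ⟨⟨⟨⟩, _⟩, _⟩ := h
      constructor
      · constructor
        · constructor <;> simp [block, Prog.eval, Instr.run, sc, *]
        all_goals simp [block, Prog.eval, Instr.run, sc, *]
        · omega
        · intro a
          rcases lt_trichotomy a (m + j) with h | h | h
          · simp [h, h.ne, show a < m + (j + 1) by omega]
          · simp [h, hY]
          · simp [h.ne', h.not_gt, show ¬ a < m + (j + 1) by omega]
      all_goals simp [block, Prog.eval, Instr.run, sc, *]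
      · ring
      · intro a
        have e : m * n + (j + 1) * (n + d) = m * n + j * (n + d) + d + n := by ring
        rw [e]
        by_cases h1 : a < m * n + j * (n + d) + d
        · simp [h1, show a < m * n + j * (n + d) + d + n by omega]
        · by_cases h2 : a < m * n + j * (n + d) + d + n
          · obtain ⟨t, rfl⟩ := Nat.exists_eq_add_of_le (not_lt.1 h1)
            simp [hF' t (by omega)]
          · simp [h1, h2]
    exact (h1.seq ((triple_preRow (hF j hj)).seq h3)).mono (fun _ h => h) (by omega) fun _ h => h

theorem storeMat_of_lt {M n : ℕ} (X : Fin M → Fin n → ℝ) {i j : ℕ} (hi : i < M) (hj : j < n) :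
    storeMat X (i * n + j) = X ⟨i, hi⟩ ⟨j, hj⟩ := by
  have hn : 0 < n := by omega
  have h : i * n + j < M * n := by
    calc i * n + j < i * n + n := by omega
      _ = (i + 1) * n := by ring
      _ ≤ M * n := Nat.mul_le_mul_right _ hi
  have h1 : (i * n + j) / n = i := by
    rw [add_comm, Nat.add_mul_div_right _ _ hn, Nat.div_eq_of_lt hj, zero_add]
  have h2 : (i * n + j) % n = j := by
    rw [add_comm, Nat.add_mul_mod_self_right, Nat.mod_eq_of_lt hj]
  rw [storeMat, storeVec, dif_pos h]
  congr 1
  · ext; simpa [finProdFinEquiv] using h1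
  · ext; simpa [finProdFinEquiv] using h2

theorem storeMat_of_le {M n : ℕ} (X : Fin M → Fin n → ℝ) {c : ℕ} (hc : M * n ≤ c) :
    storeMat X c = 0 := by
  rw [storeMat, storeVec, dif_neg (by omega)]

/-- The target of the instance. -/
noncomputable def target (m n k : ℕ) : Fin (m + k) → ℝ :=
  Fin.append (fun _ => 0) (fun _ => (m * n : ℝ))

theorem storeVec_target_of_lt {m n k a : ℕ} (h : a < m) : storeVec (target m n k) a = 0 := by
  rw [storeVec, dif_pos (by omega)]
  exact Fin.append_left _ _ (⟨a, h⟩ : Fin m)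

theorem storeVec_target_of_ge {m n k j : ℕ} (h : j < k) :
    storeVec (target m n k) (m + j) = m * n := by
  rw [storeVec, dif_pos (by omega)]
  exact Fin.append_right _ _ (⟨j, h⟩ : Fin k)

/-- The instance that the reduction prepares. -/
noncomputable def inst (k : ℕ) {m n : ℕ} (A : Fin m → Fin n → ℝ) : SLRInstance (m + k) n :=
  gadgetInstance (k := k) A (m * n) (target m n k) (1 / (m * m))

/-- The design matrix of the instance. -/
noncomputable def instMat (k : ℕ) {m n : ℕ} (A : Fin m → Fin n → ℝ) : Fin (m + k) → Fin n → ℝ :=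
  fun i j => (inst k A).X i j

theorem storeMat_inst_top {A : Fin m → Fin n → ℝ} {a : ℕ} (ha : a < m * n) :
    storeMat (instMat k A) a = storeMat A a := by
  have hn : 0 < n := Nat.pos_of_ne_zero fun h => by simp [h] at ha
  have h1 : a / n < m := (Nat.div_lt_iff_lt_mul hn).2 ha
  have h2 := Nat.mod_lt a hn
  conv_lhs => rw [← Nat.div_add_mod' a n]
  conv_rhs => rw [← Nat.div_add_mod' a n]
  rw [storeMat_of_lt _ (by omega) h2, storeMat_of_lt _ h1 h2]
  exact congrFun (Fin.append_left A _ (⟨a / n, h1⟩ : Fin m)) _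

theorem storeMat_inst_bot {A : Fin m → Fin n → ℝ} {i j : ℕ} (hi : i < k) (hj : j < n) :
    storeMat (instMat k A) ((m + i) * n + j) = if j / (n / k) = i then (m * n : ℝ) else 0 := by
  rw [storeMat_of_lt _ (by omega : m + i < m + k) hj]
  have := congrFun (Fin.append_right A ((m * n : ℝ) • partiteGadget k n) (⟨i, hi⟩ : Fin k)) ⟨j, hj⟩
  refine Eq.trans this ?_
  simp [partiteGadget]

theorem triple_pre (A : Fin m → Fin n → ℝ) (b : Fin n → ℝ) (hn : 0 < n) (hk : 0 < k)
    (hkn : n = d * k) :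
    Triple (fun s => s = clweInput k A b ω) pre (4 * m + 4 * (m * n) + 14 * n + 20)
      (GadgetInv m n k d (storeMat A) (storeVec b) ω (storeMat (instMat k A))
        (storeVec (target m n k)) k) := by
  have hd : 0 < d := Nat.pos_of_ne_zero fun h => by simp [h] at hkn; omega
  have hnk : n / k = d := by rw [hkn, Nat.mul_div_cancel _ hk]
  have h1 : Triple (fun s => s = clweInput k A b ω) (block (.setReg 4 1) [.setCell (sc 2) 1]) 2
      (SizeInv m n k (storeMat A) (storeVec b) ω 0) := by
    refine Triple.loopFree (by simp [block, Prog.LoopFree]) (by simp [block, Prog.cost])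
      fun s h => ?_
    subst h
    constructor
    · constructor <;> simp [block, Prog.eval, Instr.run, sc, clweInput, paramRegs]
    all_goals simp [block, Prog.eval, Instr.run, sc, clweInput, paramRegs]
  have h3 : Triple (SizeInv m n k (storeMat A) (storeVec b) ω m) (.instr (.setReg 5 0)) 1
      (CopyInv m n k (storeMat A) (storeVec b) ω 0) := by
    refine Triple.loopFree trivial le_rfl fun s h => ?_
    obtain ⟨⟨⟩, _⟩ := h
    constructor
    · constructor <;> simp [Prog.eval, Instr.run, *]
    all_goals simp [Prog.eval, Instr.run, *]
  have h5 : ∀ s, CopyInv m n k (storeMat A) (storeVec b) ω (m * n) s →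
      DivInv m n k (storeMat A) (storeVec b) ω 0 s := by
    intro s h
    obtain ⟨⟨⟩, _⟩ := h
    constructor
    · constructor <;> assumption
    all_goals simp [*]
  have h6 : Triple (DivInv m n k (storeMat A) (storeVec b) ω d)
      (block (.arith .mul (sc 5) (sc 3) (sc 3))
    [.arith .div (sc 5) (sc 2) (sc 5), .move ⟨18, 3⟩ (sc 5), .setReg 5 0, .addReg 8 6 3,
      .addReg 10 0 3, .addReg 16 0 2, .addReg 17 1 3, .addReg 18 2 3]) 9
      (GadgetInv m n k d (storeMat A) (storeVec b) ω (storeMat (instMat k A))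
        (storeVec (target m n k)) 0) := by
    refine Triple.loopFree (by simp [block, Prog.LoopFree]) (by simp [block, Prog.cost])
      fun s h => ?_
    clear hkn hnk
    obtain ⟨⟨⟩, _⟩ := h
    constructor
    · constructor
      · constructor <;> simp [block, Prog.eval, Instr.run, sc, ArithOp.eval, *]
      all_goals simp [block, Prog.eval, Instr.run, sc, ArithOp.eval, *]
      intro a ha
      rw [storeVec_target_of_lt ha]
    · simp [block, Prog.eval, Instr.run, sc, ArithOp.eval, *]
    · intro a
      by_cases ha : a < m * n
      · simp [block, Prog.eval, Instr.run, sc, ArithOp.eval, storeMat_inst_top ha, *]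
      · simp [block, Prog.eval, Instr.run, sc, ArithOp.eval, *]
  have h7 := triple_preGadget (m := m) (n := n) (k := k) (d := d) (a₀ := storeMat A)
    (b₀ := storeVec b) (ω := ω) (F := storeMat (instMat k A)) (Y := storeVec (target m n k))
    (by
      intro j hj t ht
      -- The linear address is split into row `m + j` and column `j d + t`, which lies in block `j`.
      have e : m * n + j * (n + d) + t = (m + j) * n + (j * d + t) := by ring
      have hlt : j * d + t < n := by
        calc j * d + t < (j + 1) * d := by linarith [add_mul j 1 d]
          _ ≤ k * d := Nat.mul_le_mul_right _ hj
          _ = n := by rw [hkn, mul_comm]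
      rw [e, storeMat_inst_bot hj hlt, hnk, if_pos]
      rw [add_comm, Nat.add_mul_div_right _ _ hd, Nat.div_eq_of_lt ht, zero_add])
    (by
      intro j hj t ht
      have e : m * n + j * (n + d) + d + t = (m + j) * n + ((j + 1) * d + t) := by ring
      have hle : (j + 1) * d ≤ n := by
        rw [hkn, mul_comm d]; exact Nat.mul_le_mul_right _ hj
      rw [e]
      by_cases hlt : (j + 1) * d + t < n
      · rw [storeMat_inst_bot hj hlt, hnk, if_neg]
        have : j + 1 ≤ ((j + 1) * d + t) / d := (Nat.le_div_iff_mul_le hd).2 (by omega)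
        omega
      · obtain ⟨u, hu⟩ := Nat.exists_eq_add_of_le (not_lt.1 hlt)
        -- The skipped stretch wraps into the next row, where it ends before that row's own block;
        -- for the last row it lies beyond the matrix.
        have e' : (m + j) * n + ((j + 1) * d + t) = (m + (j + 1)) * n + u := by rw [hu]; ring
        rw [e']
        by_cases hj' : j + 1 < k
        · rw [storeMat_inst_bot hj' (by omega), hnk, if_neg]
          have : u / d < j + 1 := (Nat.div_lt_iff_lt_mul hd).2 (by omega)
          omega
        · have : j + 1 = k := by omega
          rw [this]
          exact storeMat_of_le _ (Nat.le_add_right _ _))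
    (fun j hj => storeVec_target_of_ge hj)
  have h := h1.seq <| triple_preSize.seq <| h3.seq <|
    (triple_preCopy.mono (fun _ h => h) le_rfl h5).seq <|
    (triple_preDiv hk hkn).seq <| h6.seq h7
  refine h.mono (fun _ h => h) ?_ fun _ h => h
  have hdn : d ≤ n := hkn ▸ Nat.le_mul_of_pos_right d hk
  have hkn' : k ≤ n := hkn ▸ Nat.le_mul_of_pos_left k hd
  have : k * (d * (3 + 1) + 6 + 1) = 4 * n + 7 * k := by rw [hkn]; ring
  rw [this]
  omega

theorem GadgetInv.window_eq {A : Fin m → Fin n → ℝ} {s : State}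
    (h : GadgetInv m n k d a₀ b₀ ω (storeMat (instMat k A)) (storeVec (target m n k)) k s) :
    s.window 16 = slrInput k (inst k A) ω := by
  obtain ⟨⟨⟨⟩, _⟩, _⟩ := h
  ext
  · next r =>
    rcases r with _ | _ | _ | r <;> simp [State.window, slrInput, paramRegs, *]
  · next b a =>
    rcases b with _ | _ | _ | b
    · change s.mem 16 a = storeMat (instMat k A) a
      simp only [*]
      -- The last jump carries the address past the end of the matrix, so the invariant covers more
      -- cells than the matrix has; there both sides are zero.
      by_cases hc : (m + k) * n ≤ a
      · rw [storeMat_of_le _ hc, ite_self]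
      · rw [if_pos]
        calc a < (m + k) * n := not_le.1 hc
          _ ≤ m * n + k * (n + d) := by rw [add_mul, mul_add]; omega
    · change s.mem 17 a = storeVec (target m n k) a
      simp only [*]
      by_cases hc : a < m + k
      · rw [if_pos hc]
      · rw [if_neg hc, storeVec, dif_neg hc]
    · simp only [State.window, slrInput, zero_add, Nat.reduceAdd, storeVec, *]
      by_cases hc : a = 0 <;> simp [hc, inst, gadgetInstance]
    · simp [State.window, slrInput, *]
  · simp [State.window, slrInput, *]

end GadgetReduction

/-! ### The post-processing -/

namespace GadgetReduction

noncomputable def half : ℝ := 1 / 2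

noncomputable def quarter : ℝ := 1 / 4

/-- The error parameter of the instance. -/
noncomputable def errParam (m : ℕ) : ℝ := 1 / (m * m)

/-- One step of reduction modulo `1` towards `[-1/2, 1/2]`. -/
noncomputable def reduce (x : ℝ) : ℝ :=
  if half < x then x - 1 else if x < -half then x + 1 else x

/-- The sum of the entries of `b` that are selected by `θ`, reduced modulo `1`. -/
noncomputable def phase (b θ : ℕ → ℝ) : ℕ → ℝ
  | 0 => 0
  | j + 1 => if half < θ j then reduce (phase b θ j + b j) else phase b θ j

/-- The number of selected coordinates. -/
noncomputable def count (θ : ℕ → ℝ) : ℕ → ℕ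
  | 0 => 0
  | j + 1 => if half < θ j then count θ j + 1 else count θ j

/-- The sum of the entries of `a` that are selected by `θ`. -/
noncomputable def selSum (a θ : ℕ → ℝ) : ℕ → ℝ
  | 0 => 0
  | j + 1 => if half < θ j then selSum a θ j + a j else selSum a θ j

/-- The squared norm of the sum of the selected columns. -/
noncomputable def normSq (a θ : ℕ → ℝ) (n : ℕ) : ℕ → ℝ
  | 0 => 0
  | i + 1 => normSq a θ n i + selSum (fun t => a (i * n + t)) θ n ^ 2

/-- This has no effect, since register `3` is zero throughout. -/
def skip : Prog := .instr (.setReg 3 0)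

def postInit : Prog :=
  block (.setReg 5 0) [.setReg 6 0, .setReg 8 0, .arith .add (sc 6) (sc 2) (sc 2),
    .arith .div (sc 6) (sc 2) (sc 6), .arith .mul (sc 7) (sc 6) (sc 6), .setCell (sc 9) 0,
    .setCell (sc 10) 0, .arith .sub (sc 12) (sc 9) (sc 6), .arith .sub (sc 8) (sc 9) (sc 7)]

def postPhase : Prog :=
  .loop (.regLt 5 1) <| .seq
    (.ite (.cellLt (sc 6) ⟨19, 5⟩)
      (.seq (block (.addReg 6 6 4) [.arith .add (sc 9) (sc 9) ⟨1, 5⟩])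
        (.ite (.cellLt (sc 6) (sc 9)) (.instr (.arith .sub (sc 9) (sc 9) (sc 2)))
          (.ite (.cellLt (sc 9) (sc 12)) (.instr (.arith .add (sc 9) (sc 9) (sc 2))) skip)))
      skip)
    (.instr (.addReg 5 5 4))

def postRow : Prog :=
  .loop (.regLt 9 1) <| .seq
    (.ite (.cellLt (sc 6) ⟨19, 9⟩) (.instr (.arith .add (sc 11) (sc 11) ⟨0, 8⟩)) skip)
    (block (.addReg 9 9 4) [.addReg 8 8 4])

def postNorm : Prog :=
  .loop (.regLt 5 0) <| .seq (block (.setReg 9 0) [.setCell (sc 11) 0]) <| .seq postRow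
    (block (.arith .mul (sc 11) (sc 11) (sc 11)) [.arith .add (sc 10) (sc 10) (sc 11),
      .addReg 5 5 4])

/-- The squared norm is compared with cell `sc 5`, which still holds `δ = 1/m²`. The threshold is
`δ` and not `δ²`: the slack absorbs the rounding of the solver's output. -/
def postDecide : Prog :=
  .ite (.regLt 6 2) (.instr (.setReg 0 0)) <| .ite (.regLt 2 6) (.instr (.setReg 0 0)) <|
  .ite (.cellLt (sc 5) (sc 10)) (.instr (.setReg 0 0)) <|
  .ite (.cellLt (sc 7) (sc 9)) (.instr (.setReg 0 0)) <|
  .ite (.cellLt (sc 9) (sc 8)) (.instr (.setReg 0 0)) (.instr (.setReg 0 1))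

def post : Prog :=
  .seq postInit <| .seq postPhase <| .seq (.instr (.setReg 5 0)) <| .seq postNorm postDecide

/-- What the post-processing reads. -/
structure PostInput (m n k : ℕ) (a₀ b₀ θ : ℕ → ℝ) (s : State) : Prop where
  r0 : s.reg 0 = m
  r1 : s.reg 1 = n
  r2 : s.reg 2 = k
  r3 : s.reg 3 = 0
  r4 : s.reg 4 = 1
  m0 : ∀ a, s.mem 0 a = a₀ a
  m1 : ∀ a, s.mem 1 a = b₀ a
  m2 : s.mem 2 0 = 1
  m5 : s.mem 5 0 = errParam m
  m19 : ∀ a, s.mem 19 a = θ a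

structure PostFrame (m n k : ℕ) (a₀ b₀ θ : ℕ → ℝ) (s : State) : Prop extends
    PostInput m n k a₀ b₀ θ s where
  m6 : s.mem 6 0 = half
  m7 : s.mem 7 0 = quarter
  m8 : s.mem 8 0 = -quarter
  m12 : s.mem 12 0 = -half

structure PhaseInv (m n k : ℕ) (a₀ b₀ θ : ℕ → ℝ) (j : ℕ) (s : State) : Prop extends
    PostFrame m n k a₀ b₀ θ s where
  r5 : s.reg 5 = j
  r6 : s.reg 6 = count θ j
  r8 : s.reg 8 = 0
  m9 : s.mem 9 0 = phase b₀ θ j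
  m10 : s.mem 10 0 = 0

structure NormFrame (m n k : ℕ) (a₀ b₀ θ : ℕ → ℝ) (i : ℕ) (s : State) : Prop extends
    PostFrame m n k a₀ b₀ θ s where
  r5 : s.reg 5 = i
  r6 : s.reg 6 = count θ n
  m9 : s.mem 9 0 = phase b₀ θ n
  m10 : s.mem 10 0 = normSq a₀ θ n i

structure NormInv (m n k : ℕ) (a₀ b₀ θ : ℕ → ℝ) (i : ℕ) (s : State) : Prop extends
    NormFrame m n k a₀ b₀ θ i s where
  r8 : s.reg 8 = i * n

structure NormRowInv (m n k : ℕ) (a₀ b₀ θ : ℕ → ℝ) (i t : ℕ) (s : State) : Prop extends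
    NormFrame m n k a₀ b₀ θ i s where
  r8 : s.reg 8 = i * n + t
  r9 : s.reg 9 = t
  m11 : s.mem 11 0 = selSum (fun t => a₀ (i * n + t)) θ t

variable {m n k : ℕ} {a₀ b₀ θ : ℕ → ℝ}

theorem triple_postInit :
    Triple (PostInput m n k a₀ b₀ θ) postInit 10 (PhaseInv m n k a₀ b₀ θ 0) := by
  refine Triple.loopFree (by simp [postInit, block, Prog.LoopFree])
    (by simp [postInit, block, Prog.cost]) fun s h => ?_
  obtain ⟨⟩ := h
  constructor
  · constructor
    · constructor <;> simp [postInit, block, Prog.eval, Instr.run, sc, ArithOp.eval, *]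
    all_goals simp [postInit, block, Prog.eval, Instr.run, sc, ArithOp.eval, *]
    all_goals norm_num [half, quarter]
  all_goals simp [postInit, block, Prog.eval, Instr.run, sc, ArithOp.eval, count, phase, *]

theorem triple_postPhase :
    Triple (PhaseInv m n k a₀ b₀ θ 0) postPhase (n * (10 + 1) + 1) (PhaseInv m n k a₀ b₀ θ n) := by
  refine Triple.loop _ (fun j _ s h => ?_) (fun j _ => ?_)
  · simp [Cond.holds, h.r5, h.r1]
  · refine Triple.loopFree (by simp [block, Prog.LoopFree, skip])
      (by simp [block, Prog.cost, skip]) fun s h => ?_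
    obtain ⟨⟨⟨⟩, _⟩, _⟩ := h
    by_cases h1 : half < θ j
    · by_cases h2 : half < phase b₀ θ j + b₀ j
      · constructor
        · constructor
          · constructor <;> simp [block, Prog.eval, Cond.holds, Instr.run, sc, ArithOp.eval, *]
          all_goals simp [block, Prog.eval, Cond.holds, Instr.run, sc, ArithOp.eval, *]
        all_goals
          simp [block, Prog.eval, Cond.holds, Instr.run, sc, ArithOp.eval, count, phase, reduce, *]
      · by_cases h3 : phase b₀ θ j + b₀ j < -half
        · constructor
          · constructor
            · constructor <;>
                simp [block, Prog.eval, Cond.holds, Instr.run, sc, ArithOp.eval, *]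
            all_goals
              simp [block, Prog.eval, Cond.holds, Instr.run, sc, ArithOp.eval, *]
          all_goals
            simp [block, Prog.eval, Cond.holds, Instr.run, sc, ArithOp.eval, count, phase, reduce,
              *]
        · constructor
          · constructor
            · constructor <;> simp [block, Prog.eval, Cond.holds, Instr.run, sc, ArithOp.eval, *, skip]
            all_goals simp [block, Prog.eval, Cond.holds, Instr.run, sc, ArithOp.eval, *, skip]
          all_goals
            simp [block, Prog.eval, Cond.holds, Instr.run, sc, ArithOp.eval, count, phase, reduce,
              *, skip]
    · constructor
      · constructor
        · constructor <;> simp [Prog.eval, Cond.holds, Instr.run, sc, *, skip]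
        all_goals simp [Prog.eval, Cond.holds, Instr.run, sc, *, skip]
      all_goals
        simp [Prog.eval, Cond.holds, Instr.run, sc, count, phase, *, skip]

theorem triple_postRow {i : ℕ} :
    Triple (NormRowInv m n k a₀ b₀ θ i 0) postRow (n * (5 + 1) + 1)
      (NormRowInv m n k a₀ b₀ θ i n) := by
  refine Triple.loop _ (fun j _ s h => ?_) (fun t _ => ?_)
  · simp [Cond.holds, h.r9, h.r1]
  · refine Triple.loopFree (by simp [block, Prog.LoopFree, skip])
      (by simp [block, Prog.cost, skip]) fun s h => ?_
    obtain ⟨⟨⟨⟨⟩, _⟩, _⟩, _⟩ := h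
    by_cases h1 : half < θ t
    · constructor
      · constructor
        · constructor
          · constructor <;> simp [block, Prog.eval, Cond.holds, Instr.run, sc, ArithOp.eval, *]
          all_goals simp [block, Prog.eval, Cond.holds, Instr.run, sc, ArithOp.eval, *]
        all_goals simp [block, Prog.eval, Cond.holds, Instr.run, sc, ArithOp.eval, *]
      all_goals
        simp [block, Prog.eval, Cond.holds, Instr.run, sc, ArithOp.eval, selSum, *]
      all_goals rfl
    · constructor
      · constructor
        · constructor
          · constructor <;> simp [block, Prog.eval, Cond.holds, Instr.run, sc, *, skip]
          all_goals simp [block, Prog.eval, Cond.holds, Instr.run, sc, *, skip]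
        all_goals simp [block, Prog.eval, Cond.holds, Instr.run, sc, *, skip]
      all_goals
        simp [block, Prog.eval, Cond.holds, Instr.run, sc, selSum, *, skip]
      all_goals rfl

theorem triple_postNorm :
    Triple (NormInv m n k a₀ b₀ θ 0) postNorm (m * (n * (5 + 1) + 6 + 1) + 1)
      (NormInv m n k a₀ b₀ θ m) := by
  refine Triple.loop _ (fun j _ s h => ?_) (fun i _ => ?_)
  · simp [Cond.holds, h.r5, h.r0]
  · have h1 : Triple (NormInv m n k a₀ b₀ θ i) (block (.setReg 9 0) [.setCell (sc 11) 0]) 2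
        (NormRowInv m n k a₀ b₀ θ i 0) := by
      refine Triple.loopFree (by simp [block, Prog.LoopFree]) (by simp [block, Prog.cost])
        fun s h => ?_
      obtain ⟨⟨⟨⟨⟩, _⟩, _⟩, _⟩ := h
      constructor
      · constructor
        · constructor
          · constructor <;> simp [block, Prog.eval, Instr.run, sc, *]
          all_goals simp [block, Prog.eval, Instr.run, sc, *]
        all_goals simp [block, Prog.eval, Instr.run, sc, *]
      all_goals simp [block, Prog.eval, Instr.run, sc, selSum, *]
    have h3 : Triple (NormRowInv m n k a₀ b₀ θ i n)
        (block (.arith .mul (sc 11) (sc 11) (sc 11)) [.arith .add (sc 10) (sc 10) (sc 11),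
          .addReg 5 5 4]) 3 (NormInv m n k a₀ b₀ θ (i + 1)) := by
      refine Triple.loopFree (by simp [block, Prog.LoopFree]) (by simp [block, Prog.cost])
        fun s h => ?_
      obtain ⟨⟨⟨⟨⟩, _⟩, _⟩, _⟩ := h
      constructor
      · constructor
        · constructor
          · constructor <;> simp [block, Prog.eval, Instr.run, sc, ArithOp.eval, *]
          all_goals simp [block, Prog.eval, Instr.run, sc, ArithOp.eval, *]
        all_goals simp [block, Prog.eval, Instr.run, sc, ArithOp.eval, normSq, sq, *]
      all_goals simp [block, Prog.eval, Instr.run, sc, ArithOp.eval, *]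
      ring
    exact (h1.seq (triple_postRow.seq h3)).mono (fun _ h => h) (by omega) fun _ h => h

/-- The test that the post-processing performs. -/
def Accepts (m n k : ℕ) (a₀ b₀ θ : ℕ → ℝ) : Prop :=
  (count θ n = k ∧ normSq a₀ θ n m ≤ errParam m) ∧ |phase b₀ θ n| ≤ quarter

theorem triple_post :
    Triple (PostInput m n k a₀ b₀ θ) post (11 * n + 7 * m + 6 * (m * n) + 30)
      (fun s => s.reg 0 = 1 ↔ Accepts m n k a₀ b₀ θ) := by
  have h3 : Triple (PhaseInv m n k a₀ b₀ θ n) (.instr (.setReg 5 0)) 1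
      (NormInv m n k a₀ b₀ θ 0) := by
    refine Triple.loopFree trivial le_rfl fun s h => ?_
    obtain ⟨⟨⟨⟩, _⟩, _⟩ := h
    constructor
    · constructor
      · constructor
        · constructor <;> simp [Prog.eval, Instr.run, *]
        all_goals simp [Prog.eval, Instr.run, *]
      all_goals simp [Prog.eval, Instr.run, normSq, *]
    all_goals simp [Prog.eval, Instr.run, *]
  have h5 : Triple (NormInv m n k a₀ b₀ θ m) postDecide 11
      (fun s => s.reg 0 = 1 ↔ Accepts m n k a₀ b₀ θ) := by
    refine Triple.loopFree (by simp [postDecide, Prog.LoopFree])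
      (by simp [postDecide, Prog.cost]) fun s h => ?_
    obtain ⟨⟨⟨⟨⟩, _⟩, _⟩, _⟩ := h
    simp only [postDecide, Prog.eval, Cond.holds, State.get_eq, sc, *]
    rw [Accepts, abs_le]
    split_ifs with c1 c2 c3 c4 c5
    · simp only [Instr.run, State.reg_setReg]; grind
    · simp only [Instr.run, State.reg_setReg]; grind
    · simp only [Instr.run, State.reg_setReg]; grind
    · simp only [Instr.run, State.reg_setReg]; grind
    · simp only [Instr.run, State.reg_setReg]; grind
    · simp only [Instr.run, State.reg_setReg]; grind
  have h := triple_postInit.seq <| triple_postPhase.seq <| h3.seq <| triple_postNorm.seq h5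
  refine h.mono (fun _ h => h) ?_ fun _ h => h
  have : m * (n * (5 + 1) + 6 + 1) = 6 * (m * n) + 7 * m := by ring
  omega

end GadgetReduction

/-! ### The reduction -/

namespace GadgetReduction

def red : Reduction := ⟨pre, post, 16⟩

variable {m n k d : ℕ} {ω : Coins}

/-- The solver's window starts at `16`, so the parameters, `A`, `b` and the constants below it
survive its run. Its output bank `3` is the physical bank `19`. -/
theorem GadgetInv.postInput {a₀ b₀ F Y : ℕ → ℝ} {s s' : State}
    (h : GadgetInv m n k d a₀ b₀ ω F Y k s) (hs : AgreeBelow 16 s s') :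
    PostInput m n k a₀ b₀ ((s'.window 16).mem 3) s' := by
  obtain ⟨⟨⟨⟩, _⟩, _⟩ := h
  obtain ⟨h1, h2⟩ := hs
  constructor
  all_goals first
    | (rw [← h1 _ (by norm_num)]; assumption)
    | (rw [← h2 _ (by norm_num)]; assumption)
    | (intro a; rfl)

theorem exec_apply_of_exec (A : Fin m → Fin n → ℝ) (b : Fin n → ℝ) (hn : 0 < n) (hk : 0 < k)
    (hkn : k ∣ n) (S : Prog) {t : ℕ} {u : State} (h : Exec S (slrInput k (inst k A) ω) t u) :
    ∃ t' ≤ t + (11 * m + 10 * (m * n) + 25 * n + 50), ∃ s,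
      Exec (red.apply S) (clweInput k A b ω) t' s ∧
      (s.reg 0 = 1 ↔ Accepts m n k (storeMat A) (storeVec b) (u.mem 3)) := by
  obtain ⟨d, hd⟩ := hkn
  rw [mul_comm] at hd
  obtain ⟨t₁, ht₁, s₁, e₁, h₁⟩ := triple_pre (ω := ω) A b hn hk hd _ rfl
  obtain ⟨s₂, e₂, rfl, h₂⟩ := h.shift s₁ h₁.window_eq
  obtain ⟨t₃, ht₃, s₃, e₃, h₃⟩ := triple_post s₂ (h₁.postInput h₂)
  exact ⟨t₁ + (t + t₃), by omega, s₃, .seq e₁ (.seq e₂ e₃), h₃⟩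

/-- The right-hand side shows that `b` enters only through the final test and not through the
solver's run, the independence on which the null case rests. Determinism identifies the given run
with the one constructed from the solver's run. -/
theorem accept_iff (A : Fin m → Fin n → ℝ) (b : Fin n → ℝ) (hn : 0 < n) (hk : 0 < k)
    (hkn : k ∣ n) (S : Prog) :
    (∃ t s, Exec (red.apply S) (clweInput k A b ω) t s ∧ s.reg 0 = 1) ↔
      ∃ t u, Exec S (slrInput k (inst k A) ω) t u ∧
        Accepts m n k (storeMat A) (storeVec b) (u.mem 3) := by
  constructor
  · rintro ⟨t, s, e, hs⟩
    have e' := e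
    rw [red, Reduction.apply] at e'
    cases e' with
    | seq e₁ e' =>
      cases e' with
      | seq e₂ e₃ =>
        obtain ⟨d, hd⟩ := hkn
        rw [mul_comm] at hd
        obtain ⟨t₁, ht₁, s₁, f₁, h₁⟩ := triple_pre (ω := ω) A b hn hk hd _ rfl
        obtain ⟨rfl, rfl⟩ := f₁.det e₁
        have h := e₂.unshift S rfl
        simp only at h
        rw [h₁.window_eq] at h
        refine ⟨_, _, h, ?_⟩
        obtain ⟨t', -, s', e'', h'⟩ := exec_apply_of_exec A b hn hk ⟨d, by rw [hd, mul_comm]⟩ S h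
        obtain ⟨rfl, rfl⟩ := e.det e''
        exact h'.1 hs
  · rintro ⟨t, u, e, h⟩
    obtain ⟨t', -, s', e', h'⟩ := exec_apply_of_exec A b hn hk hkn S e
    exact ⟨t', s', e', h'.2 h⟩

/-- A quadratic bound suffices; the exponent `60` appears because one constant serves as both
coefficient and degree. -/
theorem time_le (hm : 0 < m) (hn : 0 < n) :
    11 * m + 10 * (m * n) + 25 * n + 50 ≤ 60 * (n + m) ^ 60 := by
  calc 11 * m + 10 * (m * n) + 25 * n + 50 ≤ 60 * (n + m) ^ 2 := by nlinarith
    _ ≤ _ := Nat.mul_le_mul_left _ (Nat.pow_le_pow_right (by omega) (by norm_num))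

theorem queries (A : Fin m → Fin n → ℝ) (b : Fin n → ℝ) (hm : 0 < m) (hn : 0 < n) (hk : 0 < k)
    (hkn : k ∣ n) (ω : Coins) :
    red.Queries (clweInput k A b ω) (60 * (n + m) ^ 60) k (inst k A) := by
  obtain ⟨d, hd⟩ := hkn
  rw [mul_comm] at hd
  obtain ⟨t, ht, s, e, h⟩ := triple_pre (ω := ω) A b hn hk hd _ rfl
  have := time_le hm hn
  exact ⟨t, by omega, s, e, by rw [show red.base = 16 from rfl, h.window_eq, h.co]⟩

theorem haltsWithin (A : Fin m → Fin n → ℝ) (b : Fin n → ℝ) (hm : 0 < m) (hn : 0 < n)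
    (hk : 0 < k) (hkn : k ∣ n) (ω : Coins) {S : Prog} {T : ℕ} (hS : SLRTime S (m + k) n k T) :
    HaltsWithin (red.apply S) (clweInput k A b ω) (T + 60 * (n + m) ^ 60) := by
  have hδ : 0 < (inst k A).δ := by
    have : (0 : ℝ) < m := by exact_mod_cast hm
    simp only [inst, gadgetInstance]
    positivity
  obtain ⟨t, ht, u, e⟩ := hS (inst k A) ω hδ
  obtain ⟨t', ht', s, e', -⟩ := exec_apply_of_exec A b hn hk hkn S e
  have := time_le hm hn
  exact ⟨t', by omega, s, e'⟩

/-! #### The test as a statement about sums -/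

/-- The coordinates that `θ` selects. -/
noncomputable def sel (n : ℕ) (θ : ℕ → ℝ) : Finset (Fin n) :=
  Finset.univ.filter fun j => half < θ j

theorem sum_sel {M : Type*} [AddCommMonoid M] (θ : ℕ → ℝ) (f : ℕ → M) :
    ∑ j ∈ sel n θ, f j = ∑ j ∈ Finset.range n, if half < θ j then f j else 0 := by
  rw [sel, Finset.sum_filter, Finset.sum_range]

theorem count_eq (θ : ℕ → ℝ) : count θ n = (sel n θ).card := by
  rw [Finset.card_eq_sum_ones, sum_sel θ (fun _ => 1)]
  induction n with
  | zero => rfl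
  | succ n ih => rw [Finset.sum_range_succ, count, ih]; split_ifs <;> rfl

theorem selSum_eq (a θ : ℕ → ℝ) : selSum a θ n = ∑ j ∈ sel n θ, a j := by
  rw [sum_sel]
  induction n with
  | zero => rfl
  | succ n ih => rw [Finset.sum_range_succ, selSum, ih]; split_ifs <;> simp

theorem normSq_eq (A : Fin m → Fin n → ℝ) (θ : ℕ → ℝ) :
    normSq (storeMat A) θ n m = ∑ i, (∑ j ∈ sel n θ, A i j) ^ 2 := by
  have key : ∀ l, normSq (storeMat A) θ n l = ∑ i ∈ Finset.range l,
      selSum (fun t => storeMat A (i * n + t)) θ n ^ 2 := by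
    intro l
    induction l with
    | zero => rfl
    | succ l ih => rw [Finset.sum_range_succ, normSq, ih]
  rw [key, Finset.sum_range]
  refine Finset.sum_congr rfl fun i _ => ?_
  rw [selSum_eq]
  congr 1
  exact Finset.sum_congr rfl fun j _ => storeMat_of_lt A i.2 j.2

theorem exists_reduce_eq (x : ℝ) : ∃ z : ℤ, reduce x = x + z := by
  rw [reduce]
  split_ifs
  · exact ⟨-1, by push_cast; ring⟩
  · exact ⟨1, by push_cast; ring⟩
  · exact ⟨0, by simp⟩

/-- The running phase and the next entry of `b` are each at most `1/2` in absolute value. A single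
conditional shift by one after every addition therefore replaces rounding. -/
theorem abs_reduce_le {x : ℝ} (hx : |x| ≤ 1) : |reduce x| ≤ half := by
  rw [abs_le] at *
  rw [reduce]
  unfold half
  split_ifs <;> constructor <;> linarith

/-- Every step shifts by an integer whatever the size of `b`, so this congruence needs no bound on
the entries. -/
theorem exists_phase_eq (b : Fin n → ℝ) (θ : ℕ → ℝ) :
    ∃ z : ℤ, phase (storeVec b) θ n = ∑ j ∈ sel n θ, b j + z := by
  have key : ∀ l, ∃ z : ℤ, phase (storeVec b) θ l =
      (∑ j ∈ Finset.range l, if half < θ j then storeVec b j else 0) + z := by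
    intro l
    induction l with
    | zero => exact ⟨0, by simp [phase]⟩
    | succ l ih =>
      obtain ⟨z, hz⟩ := ih
      rw [Finset.sum_range_succ, phase]
      split_ifs with h
      · obtain ⟨y, hy⟩ := exists_reduce_eq (phase (storeVec b) θ l + storeVec b l)
        exact ⟨y + z, by rw [hy, hz]; push_cast; ring⟩
      · exact ⟨z, by rw [hz, add_zero]⟩
  obtain ⟨z, hz⟩ := key n
  refine ⟨z, ?_⟩
  rw [hz, ← sum_sel]
  congr 1
  exact Finset.sum_congr rfl fun j _ => by simp [storeVec]

theorem abs_phase_le (b : Fin n → ℝ) (θ : ℕ → ℝ) (hb : ∀ j, |b j| ≤ 1 / 2) :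
    |phase (storeVec b) θ n| ≤ 1 / 2 := by
  have key : ∀ l ≤ n, |phase (storeVec b) θ l| ≤ 1 / 2 := by
    intro l
    induction l with
    | zero => simp [phase]
    | succ l ih =>
      intro hl
      rw [phase]
      split_ifs with h
      · refine abs_reduce_le ?_
        have h1 : |storeVec b l| ≤ 1 / 2 := by
          rw [storeVec, dif_pos (by omega)]; exact hb _
        have := abs_add_le (phase (storeVec b) θ l) (storeVec b l)
        linarith [ih (by omega)]
      · exact ih (by omega)
  exact key n le_rfl

/-- The part of the test that does not look at `b`. -/
def IsValid (k : ℕ) (A : Fin m → Fin n → ℝ) (T : Finset (Fin n)) : Prop :=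
  T.card = k ∧ ∑ i, (∑ j ∈ T, A i j) ^ 2 ≤ 1 / (m * m : ℝ)

theorem isValid_of_accepts {A : Fin m → Fin n → ℝ} {b : Fin n → ℝ} {θ : ℕ → ℝ}
    (h : Accepts m n k (storeMat A) (storeVec b) θ) :
    IsValid k A (sel n θ) ∧ ∃ z : ℤ, |∑ j ∈ sel n θ, b j + z| ≤ 1 / 4 := by
  obtain ⟨⟨h1, h2⟩, h3⟩ := h
  rw [count_eq] at h1
  rw [normSq_eq] at h2
  obtain ⟨z, hz⟩ := exists_phase_eq b θ
  exact ⟨⟨h1, h2⟩, z, hz ▸ h3⟩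

/-- The computed phase lies in `[-1/2, 1/2]` and differs by an integer from a number in `[-1/4,
1/4]`. That integer is at most `3/4` in absolute value, hence zero. -/
theorem accepts_of_isValid {A : Fin m → Fin n → ℝ} {b : Fin n → ℝ} {θ : ℕ → ℝ}
    (h : IsValid k A (sel n θ)) (hb : ∀ j, |b j| ≤ 1 / 2)
    (hz : ∃ z : ℤ, |∑ j ∈ sel n θ, b j + z| ≤ 1 / 4) :
    Accepts m n k (storeMat A) (storeVec b) θ := by
  refine ⟨⟨by rw [count_eq]; exact h.1, by rw [normSq_eq]; exact h.2⟩, ?_⟩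
  obtain ⟨z, hz⟩ := hz
  obtain ⟨y, hy⟩ := exists_phase_eq b θ
  have hp := abs_phase_le b θ hb
  obtain ⟨w, hw⟩ : ∃ w : ℤ, phase (storeVec b) θ n = ∑ j ∈ sel n θ, b j + z + w :=
    ⟨y - z, by rw [hy]; push_cast; ring⟩
  rw [hw] at hp ⊢
  generalize ∑ j ∈ sel n θ, b j + (z : ℝ) = x at *
  rw [abs_le] at hz hp
  have h1 : (w : ℝ) < 1 := by linarith
  have h2 : (-1 : ℝ) < w := by linarith
  have h3 : w < 1 := by exact_mod_cast h1
  have h4 : -1 < w := by exact_mod_cast h2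
  have : w = 0 := by omega
  subst this
  rw [abs_le, quarter]
  constructor <;> push_cast <;> linarith

end GadgetReduction

/-! ### Gaussian estimates -/

namespace GaussianSum

variable {ι : Type*} [Fintype ι]

theorem iIndepFun_eval (μ : Measure ℝ) [IsProbabilityMeasure μ] :
    iIndepFun (fun (j : ι) (a : ι → ℝ) => a j) (Measure.pi fun _ : ι => μ) :=
  iIndepFun_pi (X := fun _ x => x) fun _ => aemeasurable_id

theorem map_sum_pi (v : NNReal) (T : Finset ι) :
    (Measure.pi fun _ : ι => gaussianReal 0 v).map (fun a => ∑ j ∈ T, a j) =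
      gaussianReal 0 (T.card * v) := by
  classical
  induction T using Finset.induction_on with
  | empty =>
    simp only [Finset.sum_empty, Finset.card_empty, Nat.cast_zero, zero_mul, gaussianReal_zero_var]
    rw [Measure.map_const]
    simp
  | insert i T hi ih =>
    have h1 := (iIndepFun_eval (ι := ι) (gaussianReal 0 v)).indepFun_finsetSum_of_notMem
      (fun j => measurable_pi_apply j) hi
    have h2 : (Measure.pi fun _ : ι => gaussianReal 0 v).map (fun a => a i) = gaussianReal 0 v :=
      (measurePreserving_eval (fun _ : ι => gaussianReal 0 v) i).map_eq
    have h3 : (∑ j ∈ T, fun a : ι → ℝ => a j) = fun a => ∑ j ∈ T, a j := by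
      ext a; simp
    rw [h3] at h1
    have := gaussianReal_add_gaussianReal_of_indepFun h1 ih h2
    have e : (fun a : ι → ℝ => ∑ j ∈ insert i T, a j) = (fun a => ∑ j ∈ T, a j) + fun a => a i := by
      ext a; simp [Finset.sum_insert hi, add_comm]
    rw [e, this, Finset.card_insert_of_notMem hi]
    congr 1
    · simp
    · push_cast; ring

/-- The density is largest at its centre, so the bound is uniform in the position `u` of the
interval; this uniformity permits conditioning. -/
theorem gaussian_Icc_le {v : NNReal} (hv : v ≠ 0) (u ρ : ℝ) (hρ : 0 ≤ ρ) :
    (gaussianReal 0 v).real (Set.Icc (u - ρ) (u + ρ)) ≤ 2 * ρ / √(2 * Real.pi * v) := by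
  rw [measureReal_def, gaussianReal_apply_eq_integral 0 hv, ENNReal.toReal_ofReal
    (integral_nonneg fun _ => gaussianPDFReal_nonneg _ _ _)]
  calc ∫ x in Set.Icc (u - ρ) (u + ρ), gaussianPDFReal 0 v x
      ≤ ∫ _ in Set.Icc (u - ρ) (u + ρ), (√(2 * Real.pi * v))⁻¹ := by
        refine setIntegral_mono (integrable_gaussianPDFReal 0 v).integrableOn
          (integrableOn_const (by simp)) fun x => ?_
        rw [gaussianPDFReal]
        refine mul_le_of_le_one_right (by positivity) (Real.exp_le_one_iff.2 ?_)
        have := v.2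
        exact div_nonpos_of_nonpos_of_nonneg (by nlinarith [sq_nonneg (x - 0)]) (by positivity)
    _ = _ := by
        rw [setIntegral_const, measureReal_def, Real.volume_Icc, ENNReal.toReal_ofReal (by linarith),
          smul_eq_mul]
        ring

theorem le_gaussian_Icc {v : NNReal} (hv : v ≠ 0) (ρ : ℝ) (hρ : 0 ≤ ρ) :
    2 * ρ / √(2 * Real.pi * v) * Real.exp (-ρ ^ 2 / (2 * v)) ≤
      (gaussianReal 0 v).real (Set.Icc (-ρ) ρ) := by
  rw [measureReal_def, gaussianReal_apply_eq_integral 0 hv, ENNReal.toReal_ofReal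
    (integral_nonneg fun _ => gaussianPDFReal_nonneg _ _ _)]
  calc _ = ∫ _ in Set.Icc (-ρ) ρ, (√(2 * Real.pi * v))⁻¹ * Real.exp (-ρ ^ 2 / (2 * v)) := by
        rw [setIntegral_const, measureReal_def, Real.volume_Icc, ENNReal.toReal_ofReal (by linarith),
          smul_eq_mul]
        ring
    _ ≤ _ := by
        refine setIntegral_mono_on (integrableOn_const (by simp))
          (integrable_gaussianPDFReal 0 v).integrableOn measurableSet_Icc fun x hx => ?_
        rw [gaussianPDFReal]
        have := v.2
        refine mul_le_mul_of_nonneg_left (Real.exp_le_exp.2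
          (div_le_div_of_nonneg_right ?_ (by positivity))) (by positivity)
        have := sq_le_sq' hx.1 hx.2
        rw [sub_zero]
        linarith

theorem measureReal_abs_sum_le (v : NNReal) (T : Finset ι) (ρ : ℝ) :
    (Measure.pi fun _ : ι => gaussianReal 0 v).real {a | |∑ j ∈ T, a j| ≤ ρ} =
      (gaussianReal 0 (T.card * v)).real (Set.Icc (-ρ) ρ) := by
  rw [← map_sum_pi v T, map_measureReal_apply (by fun_prop) measurableSet_Icc]
  congr 1
  ext a
  simp [abs_le]

/-- Condition on the coordinates in `T`. The remaining part of the sum over `U` is an independent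
Gaussian of variance `|U \ T|`, and it must fall into an interval of length `2ρ` whose centre is
already determined. -/
theorem measureReal_pair_le [DecidableEq ι] (T U : Finset ι) (hU : (U \ T).Nonempty) (ρ : ℝ)
    (hρ : 0 ≤ ρ) :
    (Measure.pi fun _ : ι => gaussianReal 0 1).real
      {a | |∑ j ∈ T, a j| ≤ ρ ∧ |∑ j ∈ U, a j| ≤ ρ} ≤
      (Measure.pi fun _ : ι => gaussianReal 0 1).real {a | |∑ j ∈ T, a j| ≤ ρ} *
        (2 * ρ / √(2 * Real.pi * (U \ T).card)) := by
  set μ := Measure.pi fun _ : ι => gaussianReal 0 1 with hμ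
  set X : (ι → ℝ) → ℝ × ℝ := fun a => (∑ j ∈ T, a j, ∑ j ∈ U ∩ T, a j) with hX
  set Y : (ι → ℝ) → ℝ := fun a => ∑ j ∈ U \ T, a j with hY
  have hXm : Measurable X := by fun_prop
  have hYm : Measurable Y := by fun_prop
  have hXY : IndepFun X Y μ := by
    have h := (iIndepFun_eval (ι := ι) (gaussianReal 0 1)).indepFun_finset T (U \ T)
      Finset.disjoint_sdiff (fun j => measurable_pi_apply j)
    have hf : Measurable fun x : T → ℝ => (∑ j, x j, ∑ j : T, if (j : ι) ∈ U then x j else 0) := by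
      refine Measurable.prodMk (by fun_prop) (Finset.measurable_fun_sum _ fun j _ => ?_)
      split_ifs <;> fun_prop
    have hg : Measurable fun x : (U \ T : Finset ι) → ℝ => ∑ j, x j := by fun_prop
    refine (h.comp hf hg).congr (ae_of_all _ fun a => ?_) (ae_of_all _ fun a => ?_)
    · simp only [Function.comp, hX]
      congr 1
      · exact Finset.sum_coe_sort T a
      · rw [Finset.sum_coe_sort T (fun j => if j ∈ U then a j else 0), ← Finset.sum_filter]
        congr 1
        ext j; simp [and_comm]
    · exact Finset.sum_coe_sort (U \ T) a
  have hmap := (indepFun_iff_map_prod_eq_prod_map_map hXm.aemeasurable hYm.aemeasurable).1 hXY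
  have hYlaw : μ.map Y = gaussianReal 0 (U \ T).card := by
    rw [hY, hμ, map_sum_pi, mul_one]
  have hv : ((U \ T).card : NNReal) ≠ 0 := by
    exact_mod_cast hU.card_pos.ne'
  set K := 2 * ρ / √(2 * Real.pi * (U \ T).card) with hK
  have hK0 : 0 ≤ K := by positivity
  set W : Set ((ℝ × ℝ) × ℝ) := {p | |p.1.1| ≤ ρ ∧ |p.1.2 + p.2| ≤ ρ} with hW
  have hWm : MeasurableSet W := by
    refine MeasurableSet.inter ?_ ?_
    · exact measurableSet_le (f := fun p : (ℝ × ℝ) × ℝ => |p.1.1|) (by fun_prop) measurable_const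
    · exact measurableSet_le (f := fun p : (ℝ × ℝ) × ℝ => |p.1.2 + p.2|) (by fun_prop)
        measurable_const
  have hB : MeasurableSet {p : ℝ × ℝ | |p.1| ≤ ρ} := measurableSet_le (by fun_prop) measurable_const
  have e1 : {a : ι → ℝ | |∑ j ∈ T, a j| ≤ ρ ∧ |∑ j ∈ U, a j| ≤ ρ} = (fun a => (X a, Y a)) ⁻¹' W := by
    ext a
    simp only [hW, hX, hY, Set.mem_preimage, Set.mem_ofPred_eq]
    rw [Finset.sum_inter_add_sum_sdiff]
  have e2 : {a : ι → ℝ | |∑ j ∈ T, a j| ≤ ρ} = X ⁻¹' {p | |p.1| ≤ ρ} := rfl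
  have : IsProbabilityMeasure (μ.map X) := Measure.isProbabilityMeasure_map hXm.aemeasurable
  have key : (μ.map fun a => (X a, Y a)) W ≤ ENNReal.ofReal K * (μ.map X) {p | |p.1| ≤ ρ} := by
    rw [hmap, hYlaw, Measure.prod_apply hWm]
    calc ∫⁻ p, gaussianReal 0 ((U \ T).card : NNReal) (Prod.mk p ⁻¹' W) ∂(μ.map X)
        ≤ ∫⁻ p, ({p : ℝ × ℝ | |p.1| ≤ ρ}.indicator fun _ => ENNReal.ofReal K) p ∂(μ.map X) := by
          refine lintegral_mono fun p => ?_
          by_cases hp : |p.1| ≤ ρ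
          · rw [Set.indicator_of_mem (by exact hp)]
            have : Prod.mk p ⁻¹' W = Set.Icc (-p.2 - ρ) (-p.2 + ρ) := by
              ext y
              simp only [hW, Set.mem_preimage, Set.mem_ofPred_eq, hp, true_and, Set.mem_Icc]
              rw [abs_le]
              constructor <;> rintro ⟨h1, h2⟩ <;> constructor <;> linarith
            rw [this]
            have := gaussian_Icc_le hv (-p.2) ρ hρ
            rw [NNReal.coe_natCast] at this
            exact (ENNReal.le_ofReal_iff_toReal_le (by simp) hK0).2 this
          · have : Prod.mk p ⁻¹' W = ∅ := by
              ext y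
              simp [hW, hp]
            rw [this]; simp
      _ = _ := by rw [lintegral_indicator_const hB]
  rw [Measure.map_apply (hXm.prodMk hYm) hWm, Measure.map_apply hXm hB, ← e1, ← e2] at key
  have := ENNReal.toReal_mono (by simp [ENNReal.mul_eq_top]) key
  rw [ENNReal.toReal_mul, ENNReal.toReal_ofReal hK0, mul_comm] at this
  exact this

end GaussianSum

/-! ### The second moment method -/

/-- Chebyshev's inequality for the number `Z` of events that occur: `κ` bounds `E Z² / (E Z)²`, and
off the union `(Z - E Z)² = (E Z)²`. -/
theorem measureReal_compl_iUnion_le {Ω ι : Type*} [MeasurableSpace Ω] [Fintype ι] [Nonempty ι]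
    (μ : Measure Ω) [IsProbabilityMeasure μ] {E : ι → Set Ω} (hE : ∀ f, MeasurableSet (E f))
    {p κ : ℝ} (hp : 0 < p) (h1 : ∀ f, μ.real (E f) = p)
    (h2 : ∀ f, ∑ g, μ.real (E f ∩ E g) ≤ Fintype.card ι * (p ^ 2 * κ)) :
    μ.real (⋃ f, E f)ᶜ ≤ κ - 1 := by
  classical
  set N : ℝ := (Fintype.card ι : ℝ) with hN
  have hN0 : 0 < N := Nat.cast_pos.2 Fintype.card_pos
  set Z : Ω → ℝ := fun ω => ∑ f, (E f).indicator 1 ω with hZ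
  have hint : ∀ s : Set Ω, MeasurableSet s → Integrable (s.indicator (1 : Ω → ℝ)) μ := fun s hs =>
    (integrable_const (1 : ℝ)).indicator hs
  have hZi : Integrable Z μ := integrable_finsetSum _ fun f _ => hint _ (hE f)
  have hZ1 : ∫ ω, Z ω ∂μ = N * p := by
    rw [hZ, integral_finsetSum _ fun f _ => hint _ (hE f)]
    simp [integral_indicator_one, hE, h1, hN]
  have hsq : (fun ω => Z ω ^ 2) = fun ω => ∑ f, ∑ g, (E f ∩ E g).indicator (1 : Ω → ℝ) ω := by
    ext ω
    rw [hZ, sq, Finset.sum_mul_sum]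
    refine Finset.sum_congr rfl fun f _ => Finset.sum_congr rfl fun g _ => ?_
    rw [Set.inter_indicator_one]; rfl
  have hZ2i : Integrable (fun ω => Z ω ^ 2) μ := by
    rw [hsq]
    exact integrable_finsetSum _ fun f _ => integrable_finsetSum _ fun g _ =>
      hint _ ((hE f).inter (hE g))
  have hZ2 : ∫ ω, Z ω ^ 2 ∂μ ≤ N * (N * (p ^ 2 * κ)) := by
    rw [hsq, integral_finsetSum _ fun f _ => integrable_finsetSum _ fun g _ =>
      hint _ ((hE f).inter (hE g))]
    calc _ = ∑ f, ∑ g, μ.real (E f ∩ E g) := by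
          refine Finset.sum_congr rfl fun f _ => ?_
          rw [integral_finsetSum _ fun g _ => hint _ ((hE f).inter (hE g))]
          exact Finset.sum_congr rfl fun g _ => integral_indicator_one ((hE f).inter (hE g))
      _ ≤ ∑ _f : ι, N * (p ^ 2 * κ) := Finset.sum_le_sum fun f _ => h2 f
      _ = _ := by simp [hN]
  have hC : MeasurableSet (⋃ f, E f)ᶜ := (MeasurableSet.iUnion hE).compl
  have hvar : ∫ ω, (Z ω - N * p) ^ 2 ∂μ = ∫ ω, Z ω ^ 2 ∂μ - (N * p) ^ 2 := by
    have : (fun ω => (Z ω - N * p) ^ 2) = fun ω => Z ω ^ 2 - 2 * (N * p) * Z ω + (N * p) ^ 2 := by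
      ext ω; ring
    have hs : Integrable (fun ω => Z ω ^ 2 - 2 * (N * p) * Z ω) μ := hZ2i.sub (hZi.const_mul _)
    rw [this, integral_add hs (integrable_const _),
      integral_sub hZ2i (hZi.const_mul _), integral_const_mul, hZ1]
    simp; ring
  have hlow : (N * p) ^ 2 * μ.real (⋃ f, E f)ᶜ ≤ ∫ ω, (Z ω - N * p) ^ 2 ∂μ := by
    have hi : Integrable (fun ω => (Z ω - N * p) ^ 2) μ := by
      have : (fun ω => (Z ω - N * p) ^ 2) = fun ω => Z ω ^ 2 - 2 * (N * p) * Z ω + (N * p) ^ 2 := by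
        ext ω; ring
      rw [this]
      exact (hZ2i.sub (hZi.const_mul _)).add (integrable_const _)
    calc _ = ∫ ω, (⋃ f, E f)ᶜ.indicator (fun _ => (N * p) ^ 2) ω ∂μ := by
          rw [integral_indicator_const _ hC, smul_eq_mul, mul_comm]
      _ ≤ _ := by
          refine integral_mono ((integrable_const _).indicator hC) hi fun ω => ?_
          by_cases hω : ω ∈ (⋃ f, E f)ᶜ
          · rw [Set.indicator_of_mem hω]
            have : Z ω = 0 := by
              refine Finset.sum_eq_zero fun f _ => Set.indicator_of_notMem (fun h => hω ?_) _
              exact Set.mem_iUnion.2 ⟨f, h⟩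
            simp [this]
          · rw [Set.indicator_of_notMem hω]; positivity
  have hNp : 0 < (N * p) ^ 2 := by positivity
  have : (N * p) ^ 2 * μ.real (⋃ f, E f)ᶜ ≤ (N * p) ^ 2 * (κ - 1) := by
    rw [hvar] at hlow
    linarith [hlow, hZ2, show N * (N * (p ^ 2 * κ)) - (N * p) ^ 2 = (N * p) ^ 2 * (κ - 1) by ring]
  exact le_of_mul_le_mul_left this hNp

/-! ### Existence of solutions -/

namespace GadgetReduction

open GaussianSum

variable {m n k d : ℕ}

theorem inst_mulVec_castAdd (A : Fin m → Fin n → ℝ) (θ : Fin n → ℝ) (i : Fin m) :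
    (inst k A).X.mulVec θ (Fin.castAdd k i) = ∑ j, A i j * θ j := by
  have h : (inst k A).X (Fin.castAdd k i) = A i :=
    Fin.append_left A ((m * n : ℝ) • partiteGadget k n) i
  simp only [Matrix.mulVec, dotProduct, h]

theorem inst_mulVec_natAdd (A : Fin m → Fin n → ℝ) (θ : Fin n → ℝ) (i : Fin k) :
    (inst k A).X.mulVec θ (Fin.natAdd m i) =
      (m * n) * ∑ j : Fin n, if (j : ℕ) / (n / k) = i then θ j else 0 := by
  have h : ∀ j, (inst k A).X (Fin.natAdd m i) j =
      (m * n : ℝ) * if (j : ℕ) / (n / k) = i then 1 else 0 := fun j =>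
    congrFun (Fin.append_right A ((m * n : ℝ) • partiteGadget k n) i) j
  simp only [Matrix.mulVec, dotProduct, h]
  rw [Finset.mul_sum]
  refine Finset.sum_congr rfl fun j _ => ?_
  split_ifs <;> simp

theorem isSolution_iff (A : Fin m → Fin n → ℝ) (θ : Fin n → ℝ) :
    (inst k A).IsSolution k θ ↔ IsSparse k θ ∧
      (∑ i, (∑ j, A i j * θ j) ^ 2 +
        (m * n : ℝ) ^ 2 * ∑ i : Fin k, ((∑ j : Fin n, if (j : ℕ) / (n / k) = i then θ j else 0) - 1) ^ 2) /
        (m + k) ≤ (1 / (m * m : ℝ)) ^ 2 := by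
  rw [SLRInstance.IsSolution, Fin.sum_univ_add]
  simp only [inst_mulVec_castAdd, inst_mulVec_natAdd]
  have h1 : ∀ i : Fin m, (inst k A).y (Fin.castAdd k i) = 0 := fun i => by
    simp [inst, gadgetInstance, target]
  have h2 : ∀ i : Fin k, (inst k A).y (Fin.natAdd m i) = m * n := fun i => by
    simp [inst, gadgetInstance, target]
  simp only [h1, h2, sub_zero]
  rw [Finset.mul_sum]
  have h3 : ∀ i : Fin k, ((m * n : ℝ) * (∑ j : Fin n, if (j : ℕ) / (n / k) = i then θ j else 0) -
      m * n) ^ 2 =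
      (m * n : ℝ) ^ 2 * ((∑ j : Fin n, if (j : ℕ) / (n / k) = i then θ j else 0) - 1) ^ 2 :=
    fun i => by ring
  simp only [h3, Nat.cast_add]
  rfl

/-- The coordinates that are picked by choosing one element of each block. -/
def pick (f : Fin k → Fin d) : Finset (Fin (k * d)) :=
  Finset.univ.image fun i => finProdFinEquiv (i, f i)

theorem pick_injective (f : Fin k → Fin d) :
    Function.Injective fun i => finProdFinEquiv (i, f i) := fun _ _ h =>
  (Prod.ext_iff.1 (finProdFinEquiv.injective h)).1

theorem card_pick (f : Fin k → Fin d) : (pick f).card = k := by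
  rw [pick, Finset.card_image_of_injective _ (pick_injective f), Finset.card_univ, Fintype.card_fin]

theorem sum_pick {M : Type*} [AddCommMonoid M] (f : Fin k → Fin d) (a : Fin (k * d) → M) :
    ∑ j ∈ pick f, a j = ∑ i, a (finProdFinEquiv (i, f i)) :=
  Finset.sum_image (pick_injective f).injOn

/-- The number of blocks in which two choices agree. -/
def agree (f g : Fin k → Fin d) : ℕ := (Finset.univ.filter fun i => f i = g i).card

theorem agree_lt {f g : Fin k → Fin d} (h : f ≠ g) : agree f g < k := by
  obtain ⟨i, hi⟩ := Function.ne_iff.1 h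
  have : (Finset.univ.filter fun i => f i = g i) ⊂ Finset.univ :=
    Finset.filter_ssubset.2 ⟨i, Finset.mem_univ _, hi⟩
  simpa [agree] using Finset.card_lt_card this

theorem card_pick_sdiff (f g : Fin k → Fin d) : (pick g \ pick f).card = k - agree f g := by
  have h : pick g \ pick f = (Finset.univ.filter fun i => ¬ f i = g i).image
      fun i => finProdFinEquiv (i, g i) := by
    ext j
    simp only [pick, Finset.mem_sdiff, Finset.mem_image, Finset.mem_univ, true_and,
      Finset.mem_filter, not_exists]
    constructor
    · rintro ⟨⟨i, rfl⟩, h⟩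
      exact ⟨i, fun e => h i (by rw [e]), rfl⟩
    · rintro ⟨i, hi, rfl⟩
      refine ⟨⟨i, rfl⟩, fun i' e => ?_⟩
      obtain ⟨rfl, h⟩ := Prod.ext_iff.1 (finProdFinEquiv.injective e)
      exact hi h
  have hc := Finset.card_filter_add_card_filter_not (s := (Finset.univ : Finset (Fin k)))
    (fun i => f i = g i)
  rw [Finset.card_univ, Fintype.card_fin] at hc
  rw [h, Finset.card_image_of_injective _ (pick_injective g), agree]
  omega

/-- The summand is a product over the blocks. In each block one choice of `g` agrees with `f` and
contributes `x`, and the other `d - 1` contribute `1`. -/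
theorem sum_pow_agree (f : Fin k → Fin d) (x : ℝ) :
    ∑ g, x ^ agree f g = (x + (d - 1)) ^ k := by
  have h1 : ∀ g : Fin k → Fin d, x ^ agree f g = ∏ i, if f i = g i then x else 1 := fun g => by
    rw [Finset.prod_ite, Finset.prod_const, Finset.prod_const_one, mul_one, agree]
  have h2 : ∀ i, (∑ t : Fin d, if f i = t then x else 1) = x + (d - 1) := fun i => by
    have : ∀ t : Fin d, (if f i = t then x else 1) = (if f i = t then x - 1 else 0) + 1 := by
      intro t; split_ifs <;> ring
    simp only [this, Finset.sum_add_distrib, Finset.sum_ite_eq, Finset.mem_univ, if_true]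
    simp; ring
  simp only [h1]
  rw [← Fintype.piFinset_univ, ← Finset.prod_univ_sum (fun _ => Finset.univ)
    (fun i t => if f i = t then x else 1)]
  simp [h2]

/-- The event that the chosen columns sum up to a vector with entries at most `ρ`. -/
def small (m : ℕ) (ρ : ℝ) (f : Fin k → Fin d) : Set (Fin m → Fin (k * d) → ℝ) :=
  Set.univ.pi fun _ => {a | |∑ j ∈ pick f, a j| ≤ ρ}

theorem measurableSet_abs_sum_le {ι : Type*} [Fintype ι] (T : Finset ι) (ρ : ℝ) :
    MeasurableSet {a : ι → ℝ | |∑ j ∈ T, a j| ≤ ρ} :=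
  measurableSet_le (f := fun a : ι → ℝ => |∑ j ∈ T, a j|) (by fun_prop) measurable_const

theorem measurableSet_small (m : ℕ) (ρ : ℝ) (f : Fin k → Fin d) : MeasurableSet (small m ρ f) :=
  MeasurableSet.univ_pi fun _ => measurableSet_abs_sum_le _ _

theorem gaussianRows_real_pi (m n : ℕ) (B : Set (Fin n → ℝ)) :
    (gaussianRows m n).real (Set.univ.pi fun _ => B) =
      (Measure.pi fun _ : Fin n => gaussianReal 0 1).real B ^ m := by
  rw [gaussianRows, measureReal_def, Measure.pi_pi, Finset.prod_const, ENNReal.toReal_pow,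
    Finset.card_univ, Fintype.card_fin, measureReal_def]

instance (m n : ℕ) : IsProbabilityMeasure (gaussianRows m n) := by
  unfold gaussianRows; infer_instance

/-- Here `x` is the price of one agreeing block: `hx1` handles pairs of distinct choices, `hx2` the
diagonal, where the joint probability is `q ^ m` instead of about `q ^ (2 * m)`. The factor `exp (ρ²
/ (2k))` compares the peak of the Gaussian density with its value at `ρ`. -/
theorem measure_small_compl_le (hk : 0 < k) (hd : 0 < d) {ρ x : ℝ} (hρ : 0 < ρ) (hx : 1 ≤ x)
    (hx1 : ∀ l < k, √(k / (k - l : ℝ)) ^ m ≤ x ^ l)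
    (hx2 : 1 ≤ (2 * ρ / √(2 * Real.pi * k) * Real.exp (-ρ ^ 2 / (2 * k))) ^ m * x ^ k) :
    (gaussianRows m (k * d)).real (⋃ f : Fin k → Fin d, small m ρ f)ᶜ ≤
      Real.exp (ρ ^ 2 / (2 * k)) ^ m * (1 + (x - 1) / d) ^ k - 1 := by
  have hk' : (0 : ℝ) < k := by exact_mod_cast hk
  have hd' : (0 : ℝ) < d := by exact_mod_cast hd
  have : Nonempty (Fin k → Fin d) := ⟨fun _ => ⟨0, hd⟩⟩
  set q : ℝ := (gaussianReal 0 (k : NNReal)).real (Set.Icc (-ρ) ρ) with hq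
  set q₀ : ℝ := 2 * ρ / √(2 * Real.pi * k) * Real.exp (-ρ ^ 2 / (2 * k)) with hq₀
  set c : ℝ := Real.exp (ρ ^ 2 / (2 * k)) with hc
  have hc1 : 1 ≤ c := Real.one_le_exp (by positivity)
  have hq₀0 : 0 < q₀ := by positivity
  have hqq₀ : q₀ ≤ q := by
    have := le_gaussian_Icc (v := (k : NNReal)) (by exact_mod_cast hk.ne') ρ hρ.le
    rwa [NNReal.coe_natCast] at this
  have hq0 : 0 < q := hq₀0.trans_le hqq₀
  have hrow : ∀ f : Fin k → Fin d, (Measure.pi fun _ : Fin (k * d) => gaussianReal 0 1).real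
      {a | |∑ j ∈ pick f, a j| ≤ ρ} = q := fun f => by
    rw [measureReal_abs_sum_le, card_pick, mul_one]
  have hpair : ∀ f g : Fin k → Fin d, (gaussianRows m (k * d)).real (small m ρ f ∩ small m ρ g) ≤
      (q ^ m) ^ 2 * (c ^ m * x ^ agree f g) := by
    intro f g
    by_cases hfg : f = g
    · subst hfg
      have ha : agree f f = k := by simp [agree]
      rw [Set.inter_self, small, gaussianRows_real_pi, hrow, ha]
      have h1 : q₀ ^ m * x ^ k ≤ q ^ m * (c ^ m * x ^ k) := by
        have : q₀ ^ m ≤ q ^ m := pow_le_pow_left₀ hq₀0.le hqq₀ m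
        have h2 : x ^ k ≤ c ^ m * x ^ k :=
          le_mul_of_one_le_left (by positivity) (one_le_pow₀ hc1)
        exact mul_le_mul this h2 (by positivity) (by positivity)
      calc q ^ m = q ^ m * 1 := (mul_one _).symm
        _ ≤ q ^ m * (q ^ m * (c ^ m * x ^ k)) :=
          mul_le_mul_of_nonneg_left (hx2.trans h1) (by positivity)
        _ = _ := by ring
    · have hl := agree_lt hfg
      set l := agree f g with hl_def
      have hl' : (0 : ℝ) < k - l := sub_pos.2 (by exact_mod_cast hl)
      have hcard := card_pick_sdiff f g
      have hne : (pick g \ pick f).Nonempty := Finset.card_pos.1 (by omega)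
      have h := measureReal_pair_le (pick f) (pick g) hne ρ hρ.le
      rw [hrow, hcard, ← hl_def, Nat.cast_sub hl.le] at h
      -- The conditional probability is measured against the unconditional `q`; the loss is the
      -- ratio of the standard deviations, times `c`.
      have hK : 2 * ρ / √(2 * Real.pi * (k - l : ℝ)) ≤ q * (√(k / (k - l : ℝ)) * c) := by
        have e : 2 * ρ / √(2 * Real.pi * (k - l : ℝ)) = q₀ * (√(k / (k - l : ℝ)) * c) := by
          have hexp : Real.exp (-ρ ^ 2 / (2 * k)) * c = 1 := by
            rw [hc, ← Real.exp_add, neg_div, neg_add_cancel, Real.exp_zero]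
          have hs : √(2 * Real.pi * k) = √(2 * Real.pi * (k - l : ℝ)) * √(k / (k - l : ℝ)) := by
            rw [← Real.sqrt_mul (by positivity)]
            congr 1
            field_simp
          have h1 : 0 < √(2 * Real.pi * (k - l : ℝ)) := by positivity
          have h2 : 0 < √(k / (k - l : ℝ)) := by positivity
          calc _ = 2 * ρ / √(2 * Real.pi * (k - l : ℝ)) * (Real.exp (-ρ ^ 2 / (2 * k)) * c) := by
                rw [hexp, mul_one]
            _ = _ := by rw [hq₀, hs]; field_simp
        rw [e]
        exact mul_le_mul_of_nonneg_right hqq₀ (by positivity)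
      have hset : small m ρ f ∩ small m ρ g = Set.univ.pi fun _ : Fin m =>
          {a : Fin (k * d) → ℝ | |∑ j ∈ pick f, a j| ≤ ρ ∧ |∑ j ∈ pick g, a j| ≤ ρ} := by
        rw [small, small, ← Set.pi_inter_distrib]
        rfl
      rw [hset, gaussianRows_real_pi]
      calc _ ≤ (q * (q * (√(k / (k - l : ℝ)) * c))) ^ m :=
            pow_le_pow_left₀ measureReal_nonneg
              (h.trans (mul_le_mul_of_nonneg_left hK hq0.le)) m
        _ = (q ^ m) ^ 2 * (c ^ m * √(k / (k - l : ℝ)) ^ m) := by ring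
        _ ≤ _ := by
          gcongr
          exact hx1 l hl
  refine measureReal_compl_iUnion_le _ (fun f => measurableSet_small m ρ f) (p := q ^ m)
    (by positivity) (fun f => ?_) fun f => ?_
  · rw [small, gaussianRows_real_pi, hrow]
  · calc _ ≤ ∑ g, (q ^ m) ^ 2 * (c ^ m * x ^ agree f g) := Finset.sum_le_sum fun g _ => hpair f g
      _ = (q ^ m) ^ 2 * (c ^ m * (x + (d - 1)) ^ k) := by
        rw [← Finset.mul_sum, ← Finset.mul_sum, sum_pow_agree]
      _ = _ := by
        have e : (x + (d - 1) : ℝ) = d * (1 + (x - 1) / d) := by field_simp; ring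
        rw [e, mul_pow]
        simp
        ring

/-- The indicator of one column per block satisfies the gadget rows exactly, and each of the other
`m` rows contributes at most `δ²`. -/
theorem isSolution_of_small {A : Fin m → Fin (k * d) → ℝ} {f : Fin k → Fin d} (hm : 0 < m)
    (hk : 0 < k) (h : A ∈ small m (1 / (m * m)) f) :
    (inst k A).IsSolution k fun j => if j ∈ pick f then 1 else 0 := by
  have hm' : (0 : ℝ) < m := by exact_mod_cast hm
  have hkd : k * d / k = d := Nat.mul_div_cancel_left d hk
  rw [isSolution_iff]
  constructor
  · have : {j : Fin (k * d) | (if j ∈ pick f then (1 : ℝ) else 0) ≠ 0} = pick f := by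
      ext j; simp
    rw [IsSparse, this, Set.ncard_coe_finset, card_pick]
  · have h1 : ∀ i : Fin k, (∑ j : Fin (k * d), if (j : ℕ) / (k * d / k) = i then
        (if j ∈ pick f then (1 : ℝ) else 0) else 0) = 1 := by
      intro i
      have hd : 0 < d := (Nat.zero_le _).trans_lt (f i).2
      have : ∀ j : Fin (k * d), (if (j : ℕ) / (k * d / k) = i then
          (if j ∈ pick f then (1 : ℝ) else 0) else 0) =
          if j ∈ pick f then (if (j : ℕ) / d = i then (1 : ℝ) else 0) else 0 := by
        intro j; rw [hkd]; split_ifs <;> rfl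
      simp only [this]
      rw [← Finset.sum_filter, Finset.filter_mem_eq_inter, Finset.univ_inter, sum_pick]
      have : ∀ i' : Fin k, ((finProdFinEquiv (i', f i') : Fin (k * d)) : ℕ) / d = i' := by
        intro i'
        rw [finProdFinEquiv_apply_val, Nat.add_mul_div_left _ _ hd, Nat.div_eq_of_lt (f i').2,
          zero_add]
      simp only [this, Fin.val_inj, Finset.sum_ite_eq', Finset.mem_univ, if_true]
    have h2 : ∀ i, (∑ j, A i j * if j ∈ pick f then (1 : ℝ) else 0) ^ 2 ≤ (1 / (m * m : ℝ)) ^ 2 := by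
      intro i
      have hi : |∑ j ∈ pick f, A i j| ≤ 1 / (m * m : ℝ) := h i (Set.mem_univ _)
      simp only [mul_ite, mul_one, mul_zero]
      rw [← Finset.sum_filter, Finset.filter_mem_eq_inter, Finset.univ_inter]
      exact sq_le_sq' (abs_le.1 hi).1 (abs_le.1 hi).2
    simp only [h1, sub_self]
    rw [div_le_iff₀ (by positivity)]
    calc _ ≤ ∑ _i : Fin m, (1 / (m * m : ℝ)) ^ 2 := by
          simpa using Finset.sum_le_sum fun i (_ : i ∈ Finset.univ) => h2 i
      _ = (1 / (m * m : ℝ)) ^ 2 * m := by simp [mul_comm]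
      _ ≤ _ := by
        refine mul_le_mul_of_nonneg_left ?_ (by positivity)
        have : (0 : ℝ) ≤ k := Nat.cast_nonneg k
        linarith

end GadgetReduction

/-! ### Rounding solutions -/

namespace GadgetReduction

open GaussianSum

variable {m n k d : ℕ}

theorem mem_sel {θ : ℕ → ℝ} {j : Fin n} : j ∈ sel n θ ↔ 1 / 2 < θ j := by
  rw [sel, Finset.mem_filter, half]
  simp

/-- The gadget forces one non-zero entry per block, so `θ` differs from the indicator of its support
only by the deviations of the block sums from 1. The weight `mn` makes these so small that,
multiplied by the Frobenius norm of `A`, they are negligible. -/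
theorem isValid_of_isSolution {A : Fin m → Fin (k * d) → ℝ} (hm : 20 ≤ m) (hk : 0 < k)
    (hkm : k ≤ m) (hd : 0 < d) (hA : ∑ i, ∑ j, A i j ^ 2 ≤ 20 * (m * (k * d : ℕ)))
    {θ : ℕ → ℝ} (h : (inst k A).IsSolution k fun j => θ j) : IsValid k A (sel (k * d) θ) := by
  classical
  have hm' : (20 : ℝ) ≤ m := by exact_mod_cast hm
  have hkm' : (k : ℝ) ≤ m := by exact_mod_cast hkm
  have hk' : (0 : ℝ) < k := by exact_mod_cast hk
  have hn' : (1 : ℝ) ≤ (k * d : ℕ) := by exact_mod_cast Nat.mul_pos hk hd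
  set N : ℝ := ((k * d : ℕ) : ℝ) with hN
  obtain ⟨hs, h⟩ := (isSolution_iff A _).1 h
  rw [Nat.mul_div_cancel_left d hk, div_le_iff₀ (by positivity)] at h
  set blk : Fin (k * d) → Fin k := fun j => (finProdFinEquiv.symm j).1 with hblk
  have hblk' : ∀ (j : Fin (k * d)) (i : Fin k), (j : ℕ) / d = i ↔ blk j = i := fun j i => by
    rw [Fin.ext_iff]; rfl
  simp only [hblk'] at h
  set B : Fin k → ℝ := fun i => ∑ j, if blk j = i then θ j else 0 with hB
  have hP : 0 ≤ ∑ i, (∑ j, A i j * θ j) ^ 2 := Finset.sum_nonneg fun i _ => sq_nonneg _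
  have hQ : 0 ≤ ∑ i, (B i - 1) ^ 2 := Finset.sum_nonneg fun i _ => sq_nonneg _
  -- Total squared error allowed over all `m + k` rows; it bounds the Gaussian part and the gadget
  -- part separately.
  have hbudget : (1 / (m * m : ℝ)) ^ 2 * (m + k) ≤ 2 / m ^ 3 := by
    calc (1 / (m * m : ℝ)) ^ 2 * (m + k) ≤ (1 / (m * m : ℝ)) ^ 2 * (m + m) := by gcongr
      _ = _ := by field_simp; ring
  have h1 : ∑ i, (∑ j, A i j * θ j) ^ 2 ≤ 2 / m ^ 3 := by
    have : 0 ≤ (m * N : ℝ) ^ 2 * ∑ i, (B i - 1) ^ 2 := by positivity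
    linarith
  have h2 : ∑ i, (B i - 1) ^ 2 ≤ 2 / (m ^ 5 * N ^ 2) := by
    have : (m * N : ℝ) ^ 2 * ∑ i, (B i - 1) ^ 2 ≤ 2 / m ^ 3 := by linarith
    rw [le_div_iff₀ (by positivity)] at this ⊢
    calc _ = (m * N) ^ 2 * ∑ i, (B i - 1) ^ 2 * m ^ 3 := by rw [← Finset.sum_mul]; ring
      _ ≤ _ := by rw [← Finset.sum_mul, ← mul_assoc]; exact this
  have hBi : ∀ i, 1 / 2 < B i := by
    intro i
    have h3 : (B i - 1) ^ 2 ≤ 2 / (m ^ 5 * N ^ 2) :=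
      (Finset.single_le_sum (f := fun i => (B i - 1) ^ 2) (fun i _ => sq_nonneg _)
        (Finset.mem_univ i)).trans h2
    have h4 : 2 / (m ^ 5 * N ^ 2) < (1 / 2 : ℝ) ^ 2 := by
      rw [div_lt_iff₀ (by positivity)]
      have h5 : (20 : ℝ) ^ 5 ≤ m ^ 5 := by gcongr
      have h6 : (1 : ℝ) ≤ N ^ 2 := one_le_pow₀ hn'
      nlinarith
    have := abs_lt_of_sq_lt_sq (h3.trans_lt h4) (by norm_num)
    linarith [(abs_lt.1 this).1]
  set s : Finset (Fin (k * d)) := Finset.univ.filter fun j => θ j ≠ 0 with hs_def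
  have hcard : s.card ≤ k := by
    have : {j : Fin (k * d) | θ j ≠ 0} = (s : Set (Fin (k * d))) := by ext; simp [s]
    rwa [IsSparse, this, Set.ncard_coe_finset] at hs
  -- A block sum above `1/2` needs a non-zero entry in its block; with at most `k` such entries for
  -- `k` blocks, surjectivity forces injectivity.
  have hsurj : Set.SurjOn blk s (Finset.univ : Finset (Fin k)) := by
    intro i _
    by_contra hcon
    have : B i = 0 := by
      refine Finset.sum_eq_zero fun j _ => ?_
      by_cases hj : blk j = i
      · rw [if_pos hj]
        by_contra h0
        exact hcon ⟨j, by simp [s, h0], hj⟩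
      · rw [if_neg hj]
    linarith [hBi i]
  have hinj : Set.InjOn blk s :=
    Finset.injOn_of_surjOn_of_card_le blk (fun _ _ => Finset.mem_coe.2 (Finset.mem_univ _)) hsurj
      (by simpa using hcard)
  have hθ : ∀ j ∈ s, B (blk j) = θ j := by
    intro j hj
    rw [hB]
    simp only
    rw [Finset.sum_eq_single j]
    · simp
    · intro j' _ hne
      split_ifs with he
      · by_contra h0
        exact hne (hinj (by simp [s, h0]) hj he)
      · rfl
    · simp
  have hsel : sel (k * d) θ = s := by
    ext j
    rw [mem_sel]
    constructor
    · intro hj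
      simp only [s, Finset.mem_filter, Finset.mem_univ, true_and]
      exact fun h0 => by rw [h0] at hj; norm_num at hj
    · intro hj
      rw [← hθ j hj]; exact hBi _
  have himg : s.image blk = Finset.univ := by
    ext i
    simpa using hsurj (Finset.mem_coe.2 (Finset.mem_univ i))
  rw [hsel]
  refine ⟨?_, ?_⟩
  · rw [← Finset.card_image_of_injOn hinj, himg, Finset.card_univ, Fintype.card_fin]
  · have hsum : ∑ j ∈ s, (1 - θ j) ^ 2 = ∑ i, (B i - 1) ^ 2 := by
      rw [← himg, Finset.sum_image hinj]
      exact Finset.sum_congr rfl fun j hj => by rw [hθ j hj]; ring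
    have hrow : ∀ i, (∑ j ∈ s, A i j) ^ 2 ≤
        2 * (∑ j, A i j * θ j) ^ 2 + 2 * ((∑ j, A i j ^ 2) * ∑ i, (B i - 1) ^ 2) := by
      intro i
      have e1 : ∑ j, A i j * θ j = ∑ j ∈ s, A i j * θ j := by
        refine (Finset.sum_subset (Finset.subset_univ s) fun j _ hj => ?_).symm
        have : θ j = 0 := by simpa [s] using hj
        rw [this, mul_zero]
      have e2 : ∑ j ∈ s, A i j = ∑ j, A i j * θ j + ∑ j ∈ s, A i j * (1 - θ j) := by
        rw [e1, ← Finset.sum_add_distrib]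
        exact Finset.sum_congr rfl fun j _ => by ring
      have e3 : (∑ j ∈ s, A i j * (1 - θ j)) ^ 2 ≤ (∑ j, A i j ^ 2) * ∑ i, (B i - 1) ^ 2 := by
        refine (Finset.sum_mul_sq_le_sq_mul_sq s (A i) fun j => 1 - θ j).trans ?_
        rw [hsum]
        exact mul_le_mul_of_nonneg_right (Finset.sum_le_sum_of_subset_of_nonneg
          (Finset.subset_univ s) fun _ _ _ => sq_nonneg _) hQ
      rw [e2]
      nlinarith [add_sq_le (a := ∑ j, A i j * θ j) (b := ∑ j ∈ s, A i j * (1 - θ j))]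
    calc _ ≤ ∑ i, (2 * (∑ j, A i j * θ j) ^ 2 + 2 * ((∑ j, A i j ^ 2) * ∑ i, (B i - 1) ^ 2)) :=
          Finset.sum_le_sum fun i _ => hrow i
      _ = 2 * ∑ i, (∑ j, A i j * θ j) ^ 2 + 2 * ((∑ i, ∑ j, A i j ^ 2) * ∑ i, (B i - 1) ^ 2) := by
          rw [Finset.sum_add_distrib, ← Finset.mul_sum, ← Finset.mul_sum, ← Finset.sum_mul]
      -- The factor `N ^ 2` comes from the choice of `α` and defeats the size `m N` of the squared
      -- Frobenius norm.
      _ ≤ 2 * (2 / m ^ 3) + 2 * ((20 * (m * N)) * (2 / (m ^ 5 * N ^ 2))) := by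
          gcongr
      _ = 4 / m ^ 3 + 80 / (m ^ 4 * N) := by field_simp; ring
      _ ≤ 4 / m ^ 3 + 80 / (m ^ 4 * 1) := by gcongr
      _ = (4 * m + 80) / m ^ 4 := by field_simp
      _ ≤ m ^ 2 / m ^ 4 := by gcongr; nlinarith
      _ = _ := by field_simp

/-! ### Moment bounds for the Gaussian matrix and the noise. -/

theorem gaussianRows_map_apply (i : Fin m) (j : Fin n) :
    (gaussianRows m n).map (fun A => A i j) = gaussianReal 0 1 := by
  have h := (measurePreserving_eval (fun _ : Fin n => gaussianReal 0 1) j).comp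
    (measurePreserving_eval (fun _ : Fin m => Measure.pi fun _ : Fin n => gaussianReal 0 1) i)
  exact h.map_eq

theorem integrable_sq_gaussianReal (v : NNReal) :
    Integrable (fun x : ℝ => x ^ 2) (gaussianReal 0 v) :=
  (memLp_id_gaussianReal' 2 (by simp)).integrable_sq

theorem integral_sq_gaussianReal (v : NNReal) : ∫ x, x ^ 2 ∂gaussianReal 0 v = v := by
  rw [← variance_fun_id_gaussianReal (μ := 0) (v := v), variance_of_integral_eq_zero]
  · exact measurable_id.aemeasurable
  · exact integral_id_gaussianReal

/-- Markov's inequality; the expected squared Frobenius norm is `m n`. -/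
theorem measure_frobenius_le (hm : 0 < m) (hn : 0 < n) :
    (gaussianRows m n).real {A | ∑ i, ∑ j, A i j ^ 2 ≤ 20 * (m * n)}ᶜ ≤ 1 / 20 := by
  have hm' : (0 : ℝ) < m := by exact_mod_cast hm
  have hn' : (0 : ℝ) < n := by exact_mod_cast hn
  have hmeas : ∀ (i : Fin m) (j : Fin n), Measurable fun A : Fin m → Fin n → ℝ => A i j := by
    intro i j; fun_prop
  have hi : ∀ (i : Fin m) (j : Fin n),
      Integrable (fun A : Fin m → Fin n → ℝ => A i j ^ 2) (gaussianRows m n) := fun i j => by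
    have := integrable_sq_gaussianReal 1
    rw [← gaussianRows_map_apply i j] at this
    exact this.comp_measurable (hmeas i j)
  have h1 : ∀ (i : Fin m) (j : Fin n), ∫ A, A i j ^ 2 ∂gaussianRows m n = 1 := fun i j => by
    have := integral_sq_gaussianReal 1
    rw [← gaussianRows_map_apply i j, integral_map (hmeas i j).aemeasurable
      (by fun_prop)] at this
    simpa using this
  have hint : Integrable (fun A : Fin m → Fin n → ℝ => ∑ i, ∑ j, A i j ^ 2) (gaussianRows m n) :=
    integrable_finsetSum _ fun i _ => integrable_finsetSum _ fun j _ => hi i j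
  have hE : ∫ A, ∑ i, ∑ j, A i j ^ 2 ∂gaussianRows m n = m * n := by
    rw [integral_finsetSum _ fun i _ => integrable_finsetSum _ fun j _ => hi i j]
    have : ∀ i : Fin m, ∫ A, ∑ j, A i j ^ 2 ∂gaussianRows m n = n := fun i => by
      rw [integral_finsetSum _ fun j _ => hi i j]
      simp [h1]
    simp [this]
  have hM := mul_meas_ge_le_integral_of_nonneg (μ := gaussianRows m n)
    (ae_of_all _ fun A => Finset.sum_nonneg fun i _ => Finset.sum_nonneg fun j _ => sq_nonneg (A i j))
    hint (20 * (m * n))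
  rw [hE] at hM
  have hsub : (gaussianRows m n).real {A | ∑ i, ∑ j, A i j ^ 2 ≤ 20 * (m * n)}ᶜ ≤
      (gaussianRows m n).real {A | 20 * (m * n) ≤ ∑ i, ∑ j, A i j ^ 2} := by
    refine measureReal_mono fun A hA => ?_
    simp only [Set.mem_compl_iff, Set.mem_ofPred_eq, not_le] at hA
    exact hA.le
  refine hsub.trans ?_
  have : 0 < (m * n : ℝ) := by positivity
  rw [le_div_iff₀ (by norm_num)]
  refine le_of_mul_le_mul_left ?_ this
  calc _ = 20 * (m * n) * (gaussianRows m n).real {A | 20 * (m * n) ≤ ∑ i, ∑ j, A i j ^ 2} := by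
        ring
    _ ≤ m * n := hM
    _ = _ := (mul_one _).symm

/-- Chebyshev's inequality for a Gaussian of variance `|T| v`, with `64 = (1/8)⁻²`. -/
theorem measure_abs_sum_gt (v : NNReal) (T : Finset (Fin n)) :
    (Measure.pi fun _ : Fin n => gaussianReal 0 v).real {e | |∑ j ∈ T, e j| ≤ 1 / 8}ᶜ ≤
      64 * (T.card * v) := by
  set w : NNReal := T.card * v with hw
  have h := map_sum_pi v T
  have e1 : {e : Fin n → ℝ | |∑ j ∈ T, e j| ≤ 1 / 8}ᶜ =
      (fun e => ∑ j ∈ T, e j) ⁻¹' {x | |x| ≤ 1 / 8}ᶜ := rfl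
  have hB : MeasurableSet {x : ℝ | |x| ≤ 1 / 8} := measurableSet_le (by fun_prop) measurable_const
  rw [e1, ← map_measureReal_apply (by fun_prop) hB.compl, h, ← hw]
  have hM := mul_meas_ge_le_integral_of_nonneg (μ := gaussianReal 0 w)
    (ae_of_all _ fun x => sq_nonneg x) (integrable_sq_gaussianReal w) ((1 / 8) ^ 2)
  rw [integral_sq_gaussianReal] at hM
  have hsub : (gaussianReal 0 w).real {x | |x| ≤ 1 / 8}ᶜ ≤
      (gaussianReal 0 w).real {x | (1 / 8 : ℝ) ^ 2 ≤ x ^ 2} := by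
    refine measureReal_mono fun x hx => ?_
    simp only [Set.mem_compl_iff, Set.mem_ofPred_eq, not_le] at hx ⊢
    rw [← sq_abs x]
    gcongr
  have : (w : ℝ) = T.card * v := by simp [hw]
  linarith

/-! ### Uniform phases -/

/-- The set is invariant under integer translations, so its measure is the same in every fundamental
domain. In the one centred at `-y` only `z = 0` is possible, which leaves an interval of length
`1/2`. -/
theorem volume_phase_le (y : ℝ) :
    ((volume : Measure ℝ).restrict (Set.Ico (-1 / 2) (1 / 2))) {x | ∃ z : ℤ, |y + x + z| ≤ 1 / 4} ≤
      ENNReal.ofReal (1 / 2) := by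
  set P : Set ℝ := {x | ∃ z : ℤ, |y + x + z| ≤ 1 / 4} with hP
  have hPm : MeasurableSet P := by
    have : P = ⋃ z : ℤ, {x | |y + x + z| ≤ 1 / 4} := by ext; simp [hP]
    rw [this]
    exact MeasurableSet.iUnion fun z =>
      measurableSet_le (f := fun x : ℝ => |y + x + z|) (by fun_prop) measurable_const
  have h1 := isAddFundamentalDomain_Ioc (T := (1 : ℝ)) one_pos (-1 / 2)
  have h2 := isAddFundamentalDomain_Ioc (T := (1 : ℝ)) one_pos (-y - 1 / 2)
  have h := h1.measure_set_eq h2 hPm (by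
    rintro ⟨g, hg⟩
    obtain ⟨w, rfl⟩ := AddSubgroup.mem_zmultiples_iff.1 hg
    ext x
    simp only [hP, Set.mem_preimage, Set.mem_ofPred_eq, AddSubgroup.vadd_def, vadd_eq_add,
      zsmul_eq_mul, mul_one]
    constructor
    · rintro ⟨z, hz⟩
      exact ⟨w + z, by push_cast; rwa [show y + x + (w + z : ℝ) = y + (w + x) + z by ring]⟩
    · rintro ⟨z, hz⟩
      exact ⟨z - w, by push_cast; rwa [show y + (w + x) + (z - w : ℝ) = y + x + z by ring]⟩)
  rw [Measure.restrict_congr_set Ico_ae_eq_Ioc, Measure.restrict_apply hPm,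
    show (1 / 2 : ℝ) = -1 / 2 + 1 by norm_num, h]
  calc volume (P ∩ Set.Ioc (-y - 1 / 2) (-y - 1 / 2 + 1))
      ≤ volume (Set.Icc (-y - 1 / 4) (-y + 1 / 4)) := by
        refine measure_mono fun x hx => ?_
        obtain ⟨⟨z, hz⟩, hx1, hx2⟩ := hx
        rw [abs_le] at hz
        have hz1 : (z : ℝ) < 1 := by linarith
        have hz2 : (-1 : ℝ) < z := by linarith
        have hz3 : z < 1 := by exact_mod_cast hz1
        have hz4 : -1 < z := by exact_mod_cast hz2
        have : z = 0 := by omega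
        subst this
        push_cast at hz
        constructor <;> linarith
    _ = _ := by rw [Real.volume_Icc]; congr 1; ring

/-- The uniform law on `[-1/2, 1/2)`. -/
noncomputable def unif : Measure ℝ := (volume : Measure ℝ).restrict (Set.Ico (-1 / 2) (1 / 2))

instance : IsProbabilityMeasure unif := by
  refine ⟨?_⟩
  rw [unif, Measure.restrict_apply_univ, Real.volume_Ico]
  norm_num

theorem measurableSet_phase (T : Finset (Fin n)) :
    MeasurableSet {b : Fin n → ℝ | ∃ z : ℤ, |∑ j ∈ T, b j + z| ≤ 1 / 4} := by
  have : {b : Fin n → ℝ | ∃ z : ℤ, |∑ j ∈ T, b j + z| ≤ 1 / 4} =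
      ⋃ z : ℤ, {b | |∑ j ∈ T, b j + (z : ℝ)| ≤ 1 / 4} := by ext; simp
  rw [this]
  exact MeasurableSet.iUnion fun z =>
    measurableSet_le (f := fun b : Fin n → ℝ => |∑ j ∈ T, b j + z|) (by fun_prop) measurable_const

/-- Fix all coordinates but one element of `T`; the shift by the others does not matter for a
uniform phase. -/
theorem measure_phase_le (T : Finset (Fin n)) (hT : T.Nonempty) :
    (Measure.pi fun _ : Fin n => unif).real {b | ∃ z : ℤ, |∑ j ∈ T, b j + z| ≤ 1 / 4} ≤ 1 / 2 := by
  classical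
  obtain ⟨i, hi⟩ := hT
  set μ := Measure.pi fun _ : Fin n => unif with hμ
  have h1 := (iIndepFun_eval (ι := Fin n) unif).indepFun_finsetSum_of_notMem
    (fun j => measurable_pi_apply j) (Finset.notMem_erase i T)
  have h3 : (∑ j ∈ T.erase i, fun a : Fin n → ℝ => a j) = fun a => ∑ j ∈ T.erase i, a j := by
    ext a; simp
  rw [h3] at h1
  set Y : (Fin n → ℝ) → ℝ := fun a => ∑ j ∈ T.erase i, a j with hY
  have hYm : Measurable Y := by fun_prop
  have hXm : Measurable fun a : Fin n → ℝ => a i := measurable_pi_apply i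
  have hmap := (indepFun_iff_map_prod_eq_prod_map_map hYm.aemeasurable hXm.aemeasurable).1 h1
  have hX : μ.map (fun a => a i) = unif := (measurePreserving_eval (fun _ : Fin n => unif) i).map_eq
  set W : Set (ℝ × ℝ) := {p | ∃ z : ℤ, |p.1 + p.2 + z| ≤ 1 / 4} with hW
  have hWm : MeasurableSet W := by
    have : W = ⋃ z : ℤ, {p | |p.1 + p.2 + (z : ℝ)| ≤ 1 / 4} := by ext; simp [hW]
    rw [this]
    exact MeasurableSet.iUnion fun z =>
      measurableSet_le (f := fun p : ℝ × ℝ => |p.1 + p.2 + z|) (by fun_prop) measurable_const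
  have e1 : {b : Fin n → ℝ | ∃ z : ℤ, |∑ j ∈ T, b j + z| ≤ 1 / 4} =
      (fun a => (Y a, a i)) ⁻¹' W := by
    ext a
    simp only [hW, hY, Set.mem_preimage, Set.mem_ofPred_eq, Finset.sum_erase_add T a hi]
  have : IsProbabilityMeasure (μ.map Y) := Measure.isProbabilityMeasure_map hYm.aemeasurable
  have key : (μ.map fun a => (Y a, a i)) W ≤ ENNReal.ofReal (1 / 2) := by
    rw [hμ] at hX this ⊢
    rw [hmap, hX, Measure.prod_apply hWm]
    calc _ ≤ ∫⁻ _, ENNReal.ofReal (1 / 2) ∂((Measure.pi fun _ : Fin n => unif).map Y) :=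
          lintegral_mono fun y => volume_phase_le y
      _ = _ := by rw [lintegral_const, measure_univ, mul_one]
  rw [Measure.map_apply (hYm.prodMk hXm) hWm, ← e1] at key
  exact ENNReal.toReal_le_of_le_ofReal (by norm_num) key

end GadgetReduction

/-! ### The advantage of the distinguisher -/

namespace GadgetReduction

open GaussianSum

/-- This expresses independence of the solver's view (matrix and coins) from the remaining
randomness, although the latter sits between the two in the product. -/
theorem measureReal_rect {α β γ : Type*} [MeasurableSpace α] [MeasurableSpace β]
    [MeasurableSpace γ] (μ : Measure α) (ν : Measure β) (c : Measure γ) [IsProbabilityMeasure μ]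
    [IsProbabilityMeasure ν] [IsProbabilityMeasure c] {V : Set (α × γ)} {B : Set β}
    (hV : MeasurableSet V) (hB : MeasurableSet B) :
    ((μ.prod ν).prod c).real {x | (x.1.1, x.2) ∈ V ∧ x.1.2 ∈ B} = (μ.prod c).real V * ν.real B := by
  have hm : MeasurableSet {x : (α × β) × γ | (x.1.1, x.2) ∈ V ∧ x.1.2 ∈ B} :=
    MeasurableSet.inter
      ((show Measurable fun x : (α × β) × γ => (x.1.1, x.2) by fun_prop) hV)
      ((show Measurable fun x : (α × β) × γ => x.1.2 by fun_prop) hB)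
  simp only [measureReal_def]
  rw [← ENNReal.toReal_mul, Measure.prod_apply hm, Measure.prod_apply hV,
    ← lintegral_indicator_one hB, ← lintegral_prod_mul
      (measurable_measure_prodMk_left hV).aemeasurable
      (measurable_one.indicator hB).aemeasurable]
  congr 2
  ext z
  by_cases hz : z.2 ∈ B
  · rw [Set.indicator_of_mem hz, Pi.one_apply, mul_one]
    congr 1
    ext ω
    simp [hz]
  · rw [Set.indicator_of_notMem hz, mul_zero]
    convert measure_empty (μ := c)
    ext ω
    simp [hz]

instance : IsProbabilityMeasure coinLaw := by
  unfold coinLaw; infer_instance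

theorem isProbabilityMeasure_sphereLaw {m : ℕ} (hm : 0 < m) :
    IsProbabilityMeasure (sphereLaw m) := by
  refine ⟨?_⟩
  have h0 : (volume : Measure (EuclideanSpace ℝ (Fin m))).toSphere Set.univ ≠ 0 := by
    rw [Measure.toSphere_apply_univ]
    refine mul_ne_zero ?_ (Metric.isOpen_ball.measure_pos _ (Metric.nonempty_ball.2 one_pos)).ne'
    simpa using hm.ne'
  rw [sphereLaw, Measure.smul_apply, smul_eq_mul]
  exact ENNReal.inv_mul_cancel h0 (measure_ne_top _ _)

theorem measurable_mod1 : Measurable mod1 := by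
  have : mod1 = fun x => x - ((⌊x + 1 / 2⌋ : ℤ) : ℝ) := by
    funext x; rw [mod1, round_eq]
  rw [this]
  have h : Measurable fun x : ℝ => ⌊x + 1 / 2⌋ := Int.measurable_floor.comp (by fun_prop)
  have h' : Measurable fun z : ℤ => (z : ℝ) := measurable_of_countable _
  exact measurable_id.sub (h'.comp h)

variable {m n k : ℕ}

/-- The map that turns `A`, the secret and the noise into a CLWE sample. -/
noncomputable def clweMap (m n : ℕ) (γ : ℝ)
    (x : (Fin m → Fin n → ℝ) × (Metric.sphere (0 : EuclideanSpace ℝ (Fin m)) 1 × (Fin n → ℝ))) :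
    (Fin m → Fin n → ℝ) × (Fin n → ℝ) :=
  (x.1, fun j => mod1 (∑ i, γ * (x.2.1 : EuclideanSpace ℝ (Fin m)) i * x.1 i j + x.2.2 j))

theorem measurable_clweMap (γ : ℝ) : Measurable (clweMap m n γ) := by
  refine measurable_fst.prodMk (measurable_pi_lambda _ fun j => measurable_mod1.comp ?_)
  refine Measurable.add (Finset.measurable_fun_sum _ fun i _ => ?_) (by fun_prop)
  refine Measurable.mul (Measurable.mul measurable_const ?_) (by fun_prop)
  have h : Measurable fun v : EuclideanSpace ℝ (Fin m) => v i := by fun_prop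
  exact h.comp (measurable_subtype_coe.comp (measurable_fst.comp measurable_snd))

theorem clweLaw_map_fst (hm : 0 < m) (γ β : ℝ) :
    (clweLaw m n γ β).map Prod.fst = gaussianRows m n := by
  have := isProbabilityMeasure_sphereLaw hm
  change Measure.map _ (Measure.map (clweMap m n γ) _) = _
  rw [Measure.map_map measurable_fst (measurable_clweMap γ)]
  exact measurePreserving_fst.map_eq

theorem nullLaw_eq : nullLaw m n = (gaussianRows m n).prod (Measure.pi fun _ : Fin n => unif) := rfl

theorem nullLaw_map_fst : (nullLaw m n).map Prod.fst = gaussianRows m n := by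
  rw [nullLaw_eq]
  exact measurePreserving_fst.map_eq

theorem measurable_storeMat {α : Type*} [MeasurableSpace α] {M n : ℕ} {X : α → Fin M → Fin n → ℝ}
    (hX : ∀ i j, Measurable fun x => X x i j) (a : ℕ) : Measurable fun x => storeMat (X x) a := by
  by_cases h : a < M * n
  · simp only [storeMat, storeVec, dif_pos h]; exact hX _ _
  · simp only [storeMat, storeVec, dif_neg h]; exact measurable_const

theorem measurable_slrInput : Measurable fun x : (Fin m → Fin n → ℝ) × Coins =>
    slrInput k (inst k x.1) x.2 := by
  refine measurable_state (fun r => measurable_const) (fun b a => ?_) measurable_snd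
  rcases b with _ | _ | _ | b
  · refine measurable_storeMat (X := fun x : (Fin m → Fin n → ℝ) × Coins => instMat k x.1)
      (fun i j => ?_) a
    refine Fin.addCases (fun i => ?_) (fun i => ?_) i
    · have : ∀ x : (Fin m → Fin n → ℝ) × Coins, instMat k x.1 (Fin.castAdd k i) j = x.1 i j :=
        fun x => congrFun (Fin.append_left x.1 ((m * n : ℝ) • partiteGadget k n) i) j
      simp only [this]
      fun_prop
    · have : ∀ x : (Fin m → Fin n → ℝ) × Coins, instMat k x.1 (Fin.natAdd m i) j =
          ((m * n : ℝ) • partiteGadget k n) i j :=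
        fun x => congrFun (Fin.append_right x.1 ((m * n : ℝ) • partiteGadget k n) i) j
      simp only [this]
      exact measurable_const
  · exact (measurable_const : Measurable fun _ : (Fin m → Fin n → ℝ) × Coins => storeVec (target m n k) a)
  · exact (measurable_const : Measurable fun _ : (Fin m → Fin n → ℝ) × Coins =>
      storeVec (fun _ : Fin 1 => 1 / (m * m : ℝ)) a)
  · exact measurable_const

theorem measurable_clweInput :
    Measurable fun x : ((Fin m → Fin n → ℝ) × (Fin n → ℝ)) × Coins =>
      clweInput k x.1.1 x.1.2 x.2 := by
  refine measurable_state (fun r => measurable_const) (fun b a => ?_) measurable_snd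
  rcases b with _ | _ | b
  · exact measurable_storeMat (X := fun x : ((Fin m → Fin n → ℝ) × (Fin n → ℝ)) × Coins => x.1.1)
      (fun i j => by fun_prop) a
  · change Measurable fun x : ((Fin m → Fin n → ℝ) × (Fin n → ℝ)) × Coins => storeVec x.1.2 a
    by_cases h : a < n
    · simp only [storeVec, dif_pos h]; fun_prop
    · simp only [storeVec, dif_neg h]; exact measurable_const
  · exact measurable_const

/-- The event that the solver halts with an output that selects `T` and passes the test for the
matrix. -/
def validSet (S : Prog) (m n k : ℕ) (T : Finset (Fin n)) : Set ((Fin m → Fin n → ℝ) × Coins) :=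
  {x | (∃ t u, Exec S (slrInput k (inst k x.1) x.2) t u ∧ sel n (u.mem 3) = T) ∧ IsValid k x.1 T}

theorem measurableSet_validSet (S : Prog) (T : Finset (Fin n)) :
    MeasurableSet (validSet S m n k T) := by
  have hB : MeasurableSet {u : State | sel n (u.mem 3) = T} := by
    have : {u : State | sel n (u.mem 3) = T} =
        ⋂ j : Fin n, {u | 1 / 2 < u.mem 3 j ↔ j ∈ T} := by
      ext u
      simp only [Set.mem_ofPred_eq, Set.mem_iInter, Finset.ext_iff, mem_sel]
    rw [this]
    refine MeasurableSet.iInter fun j => ?_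
    have h : MeasurableSet {u : State | 1 / 2 < u.mem 3 j} :=
      measurableSet_lt measurable_const (measurable_mem 3 j)
    by_cases hj : j ∈ T
    · simpa [hj] using h
    · have : {u : State | 1 / 2 < u.mem 3 j ↔ j ∈ T} = {u | 1 / 2 < u.mem 3 j}ᶜ := by
        ext; simp [hj]
      rw [this]
      exact h.compl
  have h1 : MeasurableSet {x : (Fin m → Fin n → ℝ) × Coins |
      ∃ t u, Exec S (slrInput k (inst k x.1) x.2) t u ∧ sel n (u.mem 3) = T} := by
    have : {x : (Fin m → Fin n → ℝ) × Coins |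
        ∃ t u, Exec S (slrInput k (inst k x.1) x.2) t u ∧ sel n (u.mem 3) = T} =
        ⋃ t, (fun x : (Fin m → Fin n → ℝ) × Coins => slrInput k (inst k x.1) x.2) ⁻¹'
          {s | ∃ u, Exec S s t u ∧ u ∈ {u : State | sel n (u.mem 3) = T}} := by
      ext x; simp
    rw [this]
    exact MeasurableSet.iUnion fun t => measurable_slrInput (measurableSet_exec S t hB)
  have h2 : MeasurableSet {x : (Fin m → Fin n → ℝ) × Coins |
      ∑ i, (∑ j ∈ T, x.1 i j) ^ 2 ≤ 1 / (m * m : ℝ)} :=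
    measurableSet_le (f := fun x : (Fin m → Fin n → ℝ) × Coins => ∑ i, (∑ j ∈ T, x.1 i j) ^ 2)
      (by fun_prop) measurable_const
  by_cases hT : T.card = k
  · convert h1.inter h2 using 1
    ext x
    simp [validSet, IsValid, hT]
  · convert MeasurableSet.empty using 1
    ext x
    simp [validSet, IsValid, hT]

/-- For given matrix and coins the solver is deterministic, so it selects only one set. -/
theorem disjoint_validSet (S : Prog) {T U : Finset (Fin n)} (h : T ≠ U) :
    Disjoint (validSet S m n k T) (validSet S m n k U) := by
  refine Set.disjoint_left.2 fun x hT hU => h ?_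
  obtain ⟨⟨t, u, e, rfl⟩, -⟩ := hT
  obtain ⟨⟨t', u', e', rfl⟩, -⟩ := hU
  rw [(e.det e').2]

/-- Splitting by the selected set turns the dependence on the solver's output into a sum of
independent rectangles. It is applied with `ν` the law of `b` in the null case and the joint law of
secret and noise in the CLWE case. -/
theorem measureReal_iUnion_rect {β : Type*} [MeasurableSpace β] (ν : Measure β)
    [IsProbabilityMeasure ν] (S : Prog) (B : Finset (Fin n) → Set β)
    (hB : ∀ T, MeasurableSet (B T)) :
    (((gaussianRows m n).prod ν).prod coinLaw).real
      (⋃ T, {x | (x.1.1, x.2) ∈ validSet S m n k T ∧ x.1.2 ∈ B T}) =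
      ∑ T, ((gaussianRows m n).prod coinLaw).real (validSet S m n k T) * ν.real (B T) := by
  have h : (⋃ T, {x : ((Fin m → Fin n → ℝ) × β) × Coins |
      (x.1.1, x.2) ∈ validSet S m n k T ∧ x.1.2 ∈ B T}) =
      ⋃ T ∈ (Finset.univ : Finset (Finset (Fin n))),
        {x | (x.1.1, x.2) ∈ validSet S m n k T ∧ x.1.2 ∈ B T} := by simp
  rw [h, measureReal_biUnion_finset]
  · exact Finset.sum_congr rfl fun T _ =>
      measureReal_rect _ ν coinLaw (measurableSet_validSet S T) (hB T)
  · intro T _ U _ hTU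
    exact Set.disjoint_left.2 fun x hT hU =>
      Set.disjoint_left.1 (disjoint_validSet S hTU) hT.1 hU.1
  · intro T _
    exact MeasurableSet.inter
      ((show Measurable fun x : ((Fin m → Fin n → ℝ) × β) × Coins => (x.1.1, x.2) by fun_prop)
        (measurableSet_validSet S T))
      ((show Measurable fun x : ((Fin m → Fin n → ℝ) × β) × Coins => x.1.2 by fun_prop) (hB T))

theorem acceptProb_null_le (hn : 0 < n) (hk : 0 < k) (hkn : k ∣ n) (S : Prog) :
    acceptProb (red.apply S) k (nullLaw m n) ≤
      ∑ T, ((gaussianRows m n).prod coinLaw).real (validSet S m n k T) * (1 / 2) := by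
  have hsub : {x : ((Fin m → Fin n → ℝ) × (Fin n → ℝ)) × Coins |
      ∃ t s, Exec (red.apply S) (clweInput k x.1.1 x.1.2 x.2) t s ∧ s.reg 0 = 1} ⊆
      ⋃ T, {x | (x.1.1, x.2) ∈ validSet S m n k T ∧
        x.1.2 ∈ {b : Fin n → ℝ | ∃ z : ℤ, |∑ j ∈ T, b j + z| ≤ 1 / 4}} := by
    intro x hx
    obtain ⟨t, u, e, h⟩ := (accept_iff x.1.1 x.1.2 hn hk hkn S).1 hx
    obtain ⟨h1, h2⟩ := isValid_of_accepts h
    exact Set.mem_iUnion.2 ⟨_, ⟨⟨t, u, e, rfl⟩, h1⟩, h2⟩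
  rw [acceptProb, nullLaw_eq]
  refine (measureReal_mono hsub).trans ?_
  rw [measureReal_iUnion_rect _ S _ measurableSet_phase]
  refine Finset.sum_le_sum fun T _ => ?_
  -- An empty selection would always have phase zero; it is ruled out by the cardinality test since
  -- `k > 0`.
  rcases T.eq_empty_or_nonempty with rfl | hT
  · have : validSet S m n k ∅ = ∅ := by
      refine Set.eq_empty_of_forall_notMem fun x hx => hk.ne ?_
      simpa using hx.2.1
    simp [this]
  · exact mul_le_mul_of_nonneg_left (measure_phase_le T hT) measureReal_nonneg

/-- By Cauchy–Schwarz the secret contributes at most `2√m · 1/m = 2/√m`, which is at most `1/8`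
exactly when `m ≥ 256`; the noise contributes another `1/8`. -/
theorem accepts_clwe {A : Fin m → Fin n → ℝ} {b : Fin n → ℝ} {θ : ℕ → ℝ} (hm : 256 ≤ m)
    (hv : IsValid k A (sel n θ)) (s : Metric.sphere (0 : EuclideanSpace ℝ (Fin m)) 1)
    {e : Fin n → ℝ} (he : |∑ j ∈ sel n θ, e j| ≤ 1 / 8)
    (hb : b = fun j => mod1 (∑ i, 2 * √(m : ℝ) * (s : EuclideanSpace ℝ (Fin m)) i * A i j + e j)) :
    Accepts m n k (storeMat A) (storeVec b) θ := by
  have hm' : (256 : ℝ) ≤ m := by exact_mod_cast hm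
  refine accepts_of_isValid hv (fun j => ?_) ?_
  · rw [hb]
    exact abs_sub_round _
  · set x : Fin n → ℝ := fun j =>
      ∑ i, 2 * √(m : ℝ) * (s : EuclideanSpace ℝ (Fin m)) i * A i j + e j with hx
    refine ⟨∑ j ∈ sel n θ, round (x j), ?_⟩
    have h1 : ∑ j ∈ sel n θ, b j + ((∑ j ∈ sel n θ, round (x j) : ℤ) : ℝ) =
        2 * √(m : ℝ) * ∑ i, (s : EuclideanSpace ℝ (Fin m)) i * (∑ j ∈ sel n θ, A i j) +
          ∑ j ∈ sel n θ, e j := by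
      rw [Int.cast_sum, ← Finset.sum_add_distrib]
      have : ∀ j, b j + ((round (x j) : ℤ) : ℝ) = x j := fun j => by
        rw [hb]; simp only [mod1, hx]; ring
      rw [Finset.sum_congr rfl fun j _ => this j]
      simp only [hx]
      rw [Finset.sum_add_distrib, Finset.sum_comm, Finset.mul_sum]
      congr 1
      refine Finset.sum_congr rfl fun i _ => ?_
      rw [Finset.mul_sum, Finset.mul_sum]
      exact Finset.sum_congr rfl fun j _ => by ring
    rw [h1]
    have hs : ∑ i, (s : EuclideanSpace ℝ (Fin m)) i ^ 2 = 1 := by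
      have := EuclideanSpace.norm_sq_eq (s : EuclideanSpace ℝ (Fin m))
      rw [norm_eq_of_mem_sphere s] at this
      simpa using this.symm
    set w := ∑ i, (s : EuclideanSpace ℝ (Fin m)) i * (∑ j ∈ sel n θ, A i j) with hw
    have h2 : w ^ 2 ≤ 1 / (m * m : ℝ) := by
      have := Finset.sum_mul_sq_le_sq_mul_sq Finset.univ
        (fun i => (s : EuclideanSpace ℝ (Fin m)) i) fun i => ∑ j ∈ sel n θ, A i j
      rw [hs, one_mul] at this
      exact this.trans hv.2
    have h3 : |2 * √(m : ℝ) * w| ≤ 1 / 8 := by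
      refine abs_le_of_sq_le_sq ?_ (by norm_num)
      rw [mul_pow, mul_pow, Real.sq_sqrt (by positivity)]
      calc (2 : ℝ) ^ 2 * m * w ^ 2 ≤ 2 ^ 2 * m * (1 / (m * m : ℝ)) := by gcongr
        _ = 4 / (m : ℝ) := by field_simp; norm_num
        _ ≤ (4 / 256 : ℝ) := by gcongr
        _ = _ := by norm_num
    exact (abs_add_le _ _).trans (by linarith)

/-- For every set of size `k` the noise sum exceeds `1/8` with probability at most `64 k β² ≤ 1/8`,
and the noise is independent of which set the solver selects. -/
theorem le_acceptProb_clwe (hm : 256 ≤ m) (hn : 0 < n) (hk : 0 < k) (hkn : k ∣ n) (S : Prog)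
    {β : ℝ} (hβ : (k : ℝ) * β ^ 2 ≤ 1 / 512) :
    ∑ T, ((gaussianRows m n).prod coinLaw).real (validSet S m n k T) * (7 / 8) ≤
      acceptProb (red.apply S) k (clweLaw m n (2 * √(m : ℝ)) β) := by
  have := isProbabilityMeasure_sphereLaw (show 0 < m by omega)
  set v : NNReal := Real.toNNReal (β ^ 2) with hv
  set ν : Measure (Metric.sphere (0 : EuclideanSpace ℝ (Fin m)) 1 × (Fin n → ℝ)) :=
    (sphereLaw m).prod (Measure.pi fun _ : Fin n => gaussianReal 0 v) with hν
  set B : Finset (Fin n) → Set (Metric.sphere (0 : EuclideanSpace ℝ (Fin m)) 1 × (Fin n → ℝ)) :=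
    fun T => Prod.snd ⁻¹' {e | |∑ j ∈ T, e j| ≤ 1 / 8} with hB
  have hBm : ∀ T, MeasurableSet (B T) := fun T => measurable_snd (measurableSet_abs_sum_le T _)
  have hBν : ∀ T : Finset (Fin n), T.card = k → 7 / 8 ≤ ν.real (B T) := by
    intro T hT
    have h1 : ν.real (B T) =
        (Measure.pi fun _ : Fin n => gaussianReal 0 v).real {e | |∑ j ∈ T, e j| ≤ 1 / 8} := by
      rw [← (measurePreserving_snd (μ := sphereLaw m)
        (ν := Measure.pi fun _ : Fin n => gaussianReal 0 v)).map_eq,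
        map_measureReal_apply measurable_snd (measurableSet_abs_sum_le T _)]
    have h2 := measure_abs_sum_gt v T
    rw [probReal_compl_eq_one_sub (measurableSet_abs_sum_le T _), hT, hv,
      Real.coe_toNNReal _ (sq_nonneg β)] at h2
    rw [h1]
    linarith
  have hW : MeasurableSet {x : ((Fin m → Fin n → ℝ) × (Fin n → ℝ)) × Coins |
      ∃ t s, Exec (red.apply S) (clweInput k x.1.1 x.1.2 x.2) t s ∧ s.reg 0 = 1} := by
    have : {x : ((Fin m → Fin n → ℝ) × (Fin n → ℝ)) × Coins |
        ∃ t s, Exec (red.apply S) (clweInput k x.1.1 x.1.2 x.2) t s ∧ s.reg 0 = 1} =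
        ⋃ t, (fun x : ((Fin m → Fin n → ℝ) × (Fin n → ℝ)) × Coins =>
          clweInput k x.1.1 x.1.2 x.2) ⁻¹'
          {s | ∃ u, Exec (red.apply S) s t u ∧ u ∈ {u : State | u.reg 0 = 1}} := by
      ext x; simp
    rw [this]
    exact MeasurableSet.iUnion fun t => measurable_clweInput
      (measurableSet_exec _ t (measurable_reg 0 (measurableSet_singleton 1)))
  have hmap : (clweLaw m n (2 * √(m : ℝ)) β).prod coinLaw =
      (((gaussianRows m n).prod ν).prod coinLaw).map
        (Prod.map (clweMap m n (2 * √(m : ℝ))) id) := by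
    rw [← Measure.map_prod_map _ _ (measurable_clweMap _) measurable_id, Measure.map_id]
    rfl
  rw [acceptProb, hmap, map_measureReal_apply ((measurable_clweMap _).prodMap measurable_id) hW]
  calc _ ≤ ∑ T, ((gaussianRows m n).prod coinLaw).real (validSet S m n k T) * ν.real (B T) := by
        refine Finset.sum_le_sum fun T _ => ?_
        by_cases hT : T.card = k
        · exact mul_le_mul_of_nonneg_left (hBν T hT) measureReal_nonneg
        · have : validSet S m n k T = ∅ :=
            Set.eq_empty_of_forall_notMem fun x hx => hT hx.2.1
          simp [this]
    _ = _ := (measureReal_iUnion_rect ν S B hBm).symm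
    _ ≤ _ := by
        refine measureReal_mono fun x hx => ?_
        obtain ⟨T, ⟨⟨t, u, e, rfl⟩, hv⟩, hx2⟩ := Set.mem_iUnion.1 hx
        exact (accept_iff _ _ hn hk hkn S).2 ⟨t, u, e, accepts_clwe hm hv x.1.2.1 hx2 rfl⟩

theorem sum_validSet (S : Prog) :
    ∑ T, ((gaussianRows m n).prod coinLaw).real (validSet S m n k T) =
      ((gaussianRows m n).prod coinLaw).real (⋃ T, validSet S m n k T) := by
  have h : (⋃ T, validSet S m n k T) =
      ⋃ T ∈ (Finset.univ : Finset (Finset (Fin n))), validSet S m n k T := by simp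
  rw [h, measureReal_biUnion_finset]
  · intro T _ U _ hTU
    exact disjoint_validSet S hTU
  · exact fun T _ => measurableSet_validSet S T

/-- A matrix is good if a solution exists and its Frobenius norm is moderate; each condition fails
with probability at most `1/20`. On every good matrix the solver succeeds with probability `q` over
its coins, and its output rounds to a valid set. -/
theorem le_measure_validSet {d : ℕ} (hm : 20 ≤ m) (hk : 0 < k) (hkm : k ≤ m) (hd : 0 < d)
    {S : Prog} {q : ℝ} (hq : 0 < q) (hS : SolvesSLR S (m + k) (k * d) k q)
    (hsmall : (gaussianRows m (k * d)).real
      (⋃ f : Fin k → Fin d, small m (1 / (m * m : ℝ)) f)ᶜ ≤ 1 / 20) :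
    q * (9 / 10) ≤
      ((gaussianRows m (k * d)).prod coinLaw).real (⋃ T, validSet S m (k * d) k T) := by
  have hm0 : 0 < m := by omega
  have hm' : (0 : ℝ) < m := by exact_mod_cast hm0
  set V := ⋃ T, validSet S m (k * d) k T with hV
  have hVm : MeasurableSet V := MeasurableSet.iUnion fun T => measurableSet_validSet S T
  set g : Set (Fin m → Fin (k * d) → ℝ) := (⋃ f : Fin k → Fin d, small m (1 / (m * m : ℝ)) f) ∩
    {A | ∑ i, ∑ j, A i j ^ 2 ≤ 20 * (m * (k * d : ℕ))} with hg
  have hgm : MeasurableSet g := by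
    refine MeasurableSet.inter (MeasurableSet.iUnion fun f => measurableSet_small m _ f) ?_
    exact measurableSet_le (f := fun A : Fin m → Fin (k * d) → ℝ => ∑ i, ∑ j, A i j ^ 2)
      (by fun_prop) measurable_const
  have hgμ : 9 / 10 ≤ (gaussianRows m (k * d)).real g := by
    have h1 := measure_frobenius_le hm0 (Nat.mul_pos hk hd)
    have h2 : (gaussianRows m (k * d)).real gᶜ ≤ 1 / 20 + 1 / 20 := by
      rw [hg, Set.compl_inter]
      exact (measureReal_union_le _ _).trans (add_le_add hsmall h1)
    rw [probReal_compl_eq_one_sub hgm] at h2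
    linarith
  have hsec : ∀ A ∈ g, ENNReal.ofReal q ≤ coinLaw (Prod.mk A ⁻¹' V) := by
    intro A hA
    obtain ⟨hA1, hA2⟩ := hA
    obtain ⟨f, hf⟩ := Set.mem_iUnion.1 hA1
    have h := hS (inst k A) (by simp only [inst, gadgetInstance]; positivity)
      ⟨_, isSolution_of_small hm0 hk hf⟩
    have hsub : {ω | ∃ t s, Exec S (slrInput k (inst k A) ω) t s ∧
        (inst k A).IsSolution k (slrOutput (k * d) s)} ⊆ Prod.mk A ⁻¹' V := by
      rintro ω ⟨t, u, e, h⟩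
      exact Set.mem_iUnion.2 ⟨_, ⟨t, u, e, rfl⟩, isValid_of_isSolution hm hk hkm hd hA2 h⟩
    exact ENNReal.ofReal_le_of_le_toReal (h.trans (measureReal_mono hsub))
  have hM : ENNReal.ofReal q * gaussianRows m (k * d) g ≤
      ((gaussianRows m (k * d)).prod coinLaw) V := by
    rw [Measure.prod_apply hVm]
    calc _ ≤ ENNReal.ofReal q * gaussianRows m (k * d)
          {A | ENNReal.ofReal q ≤ coinLaw (Prod.mk A ⁻¹' V)} := by
          gcongr
          exact hsec
      _ ≤ _ := mul_meas_ge_le_lintegral (measurable_measure_prodMk_left hVm) _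
  have := ENNReal.toReal_mono (measure_ne_top _ _) hM
  rw [ENNReal.toReal_mul, ENNReal.toReal_ofReal hq.le] at this
  exact (mul_le_mul_of_nonneg_left hgμ hq.le).trans this

/-- The constants combine to `(7/8 - 1/2) · 9/10 = 27/80 ≥ 1/4`. -/
theorem le_clweAdvantage {d : ℕ} (hm : 256 ≤ m) (hk : 0 < k) (hkm : k ≤ m) (hd : 0 < d)
    {S : Prog} {q β : ℝ} (hq : 0 < q) (hS : SolvesSLR S (m + k) (k * d) k q)
    (hβ : (k : ℝ) * β ^ 2 ≤ 1 / 512)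
    (hsmall : (gaussianRows m (k * d)).real
      (⋃ f : Fin k → Fin d, small m (1 / (m * m : ℝ)) f)ᶜ ≤ 1 / 20) :
    q / 4 ≤ clweAdvantage (red.apply S) m (k * d) k (2 * √(m : ℝ)) β := by
  have hn : 0 < k * d := Nat.mul_pos hk hd
  have h1 := acceptProb_null_le (m := m) hn hk ⟨d, rfl⟩ S
  have h2 := le_acceptProb_clwe hm hn hk ⟨d, rfl⟩ S hβ
  have h3 := le_measure_validSet (by omega) hk hkm hd hq hS hsmall
  rw [← Finset.sum_mul, sum_validSet] at h1 h2
  rw [clweAdvantage]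
  linarith

end GadgetReduction

/-! ### Asymptotics -/

namespace GadgetReduction

variable {m k d : ℕ}

/-- Concavity of the logarithm: `k - l` is the mean of `k` and `1` with weights `1 - t` and `t = l /
(k - 1)`, hence at least `k ^ (1 - t)`. Finally `k - 1 ≥ k / 2` when `k ≥ 2`. -/
theorem div_sub_le_rpow {l : ℕ} (hl : l < k) :
    (k / (k - l) : ℝ) ≤ (k : ℝ) ^ (2 * l / k : ℝ) := by
  rcases Nat.eq_zero_or_pos l with rfl | hl0
  · have : (k : ℝ) ≠ 0 := by exact_mod_cast hl.ne'
    simp [this]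
  have hk2 : (2 : ℝ) ≤ k := by exact_mod_cast (show 2 ≤ k by omega)
  have hl0' : (0 : ℝ) ≤ l := Nat.cast_nonneg l
  have hlk : (l : ℝ) ≤ k - 1 := by
    have : (l : ℝ) + 1 ≤ k := by exact_mod_cast hl
    linarith
  set t : ℝ := l / (k - 1) with ht
  have ht0 : 0 ≤ t := div_nonneg hl0' (by linarith)
  have ht1 : t ≤ 1 := (div_le_one (by linarith)).2 hlk
  have h := Real.geom_mean_le_arith_mean2_weighted (sub_nonneg.2 ht1) ht0
    (show (0 : ℝ) ≤ k by linarith) zero_le_one (by ring)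
  have e : (1 - t) * k + t * 1 = k - l := by
    rw [ht]
    have : (k - 1 : ℝ) ≠ 0 := by linarith
    field_simp
    ring
  rw [Real.one_rpow, mul_one, e] at h
  have hk0 : (0 : ℝ) < k := by linarith
  have hp : 0 < (k : ℝ) ^ (1 - t) := Real.rpow_pos_of_pos hk0 _
  calc (k / (k - l) : ℝ) ≤ k / (k : ℝ) ^ (1 - t) := by gcongr
    _ = (k : ℝ) ^ t := by
      rw [div_eq_iff hp.ne', ← Real.rpow_add hk0, add_sub_cancel, Real.rpow_one]
    _ ≤ (k : ℝ) ^ (2 * l / k : ℝ) := by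
      refine Real.rpow_le_rpow_of_exponent_le (by linarith) ?_
      rw [ht, div_le_div_iff₀ (by linarith) hk0]
      nlinarith

/-- The price per agreeing block is `x = m ^ (4m/k)`, so that `x ^ k = m ^ (4m)` outweighs the
probability `q ^ m` of a single choice. The two factors of the second-moment ratio are then at most
`exp (1/m)` each. -/
theorem measure_small_compl_le_exp (hm : 7 ≤ m) (hk : 0 < k) (hkm : k ≤ m)
    (hd : (m : ℝ) ^ (6 * (m / k) : ℝ) ≤ d) :
    (gaussianRows m (k * d)).real (⋃ f : Fin k → Fin d, small m (1 / (m * m : ℝ)) f)ᶜ ≤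
      Real.exp (2 / m) - 1 := by
  have hm' : (7 : ℝ) ≤ m := by exact_mod_cast hm
  have hm0 : (0 : ℝ) < m := by linarith
  have hk1 : (1 : ℝ) ≤ k := by exact_mod_cast hk
  have hk0 : (0 : ℝ) < k := by linarith
  have hkm' : (k : ℝ) ≤ m := by exact_mod_cast hkm
  have hmk : (1 : ℝ) ≤ m / k := (one_le_div hk0).2 hkm'
  have hd0 : (0 : ℝ) < d := (Real.rpow_pos_of_pos hm0 _).trans_le hd
  set ρ : ℝ := 1 / (m * m) with hρ
  have hρ0 : 0 < ρ := by positivity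
  have hρ1 : ρ ≤ 1 := by
    rw [hρ, div_le_one (by positivity)]
    nlinarith
  set x : ℝ := (m : ℝ) ^ (4 * (m / k) : ℝ) with hx
  have hx1 : 1 ≤ x := Real.one_le_rpow (by linarith) (by positivity)
  have h1 : ∀ l < k, √(k / (k - l : ℝ)) ^ m ≤ x ^ l := by
    intro l hl
    have hlk : (0 : ℝ) < k - l := sub_pos.2 (by exact_mod_cast hl)
    have hl0 : (0 : ℝ) ≤ l := Nat.cast_nonneg l
    have h2 : √(k / (k - l : ℝ)) ≤ (m : ℝ) ^ (4 * l / k : ℝ) := by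
      have h3 : (1 : ℝ) ≤ k / (k - l) := by
        rw [one_le_div hlk]; linarith
      calc √(k / (k - l : ℝ)) ≤ k / (k - l) := by
            rw [Real.sqrt_le_iff]
            exact ⟨by positivity, by nlinarith⟩
        _ ≤ (k : ℝ) ^ (2 * l / k : ℝ) := div_sub_le_rpow hl
        _ ≤ (m : ℝ) ^ (2 * l / k : ℝ) := Real.rpow_le_rpow hk0.le hkm' (by positivity)
        _ ≤ _ := by
          refine Real.rpow_le_rpow_of_exponent_le (by linarith) ?_
          gcongr
          norm_num
    calc √(k / (k - l : ℝ)) ^ m ≤ ((m : ℝ) ^ (4 * l / k : ℝ)) ^ m := by gcongr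
      _ = x ^ l := by
        rw [hx, ← Real.rpow_natCast, ← Real.rpow_natCast, ← Real.rpow_mul hm0.le,
          ← Real.rpow_mul hm0.le]
        congr 1
        ring
  -- Per row, the probability is at least `ρ / m = m⁻³`, which `m ^ 4` exceeds. The bound `√(2πk) ≤
  -- m` is where `m ≥ 7` is needed.
  have h2 : 1 ≤ (2 * ρ / √(2 * Real.pi * k) * Real.exp (-ρ ^ 2 / (2 * k))) ^ m * x ^ k := by
    have hxk : x ^ k = ((m : ℝ) ^ 4) ^ m := by
      rw [hx, ← Real.rpow_natCast, ← Real.rpow_mul hm0.le, ← pow_mul, ← Real.rpow_natCast]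
      congr 1
      push_cast
      field_simp
    rw [hxk, ← mul_pow]
    refine one_le_pow₀ ?_
    have hs : √(2 * Real.pi * k) ≤ m := by
      rw [Real.sqrt_le_iff]
      refine ⟨hm0.le, ?_⟩
      have := Real.pi_lt_d2
      have : 2 * Real.pi * k ≤ 2 * 3.15 * m := by gcongr
      nlinarith
    have he : 1 / 2 ≤ Real.exp (-ρ ^ 2 / (2 * k)) := by
      have h3 := Real.add_one_le_exp (-ρ ^ 2 / (2 * k))
      have h4 : ρ ^ 2 / (2 * k) ≤ 1 / 2 := by
        rw [div_le_div_iff₀ (by positivity) (by norm_num)]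
        nlinarith
      rw [neg_div] at h3 ⊢
      linarith
    have hs0 : 0 < √(2 * Real.pi * k) := by positivity
    calc (1 : ℝ) ≤ m := by linarith
      _ = 2 * ρ / m * (1 / 2) * m ^ 4 := by rw [hρ]; field_simp
      _ ≤ _ := by gcongr
  refine (measure_small_compl_le hk (by exact_mod_cast hd0) hρ0 hx1 h1 h2).trans ?_
  have h3 : Real.exp (ρ ^ 2 / (2 * k)) ^ m ≤ Real.exp (1 / m) := by
    rw [← Real.exp_nat_mul]
    refine Real.exp_le_exp.2 ?_
    calc (m : ℝ) * (ρ ^ 2 / (2 * k)) ≤ (m : ℝ) * (ρ ^ 2 / 1) := by gcongr; linarith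
      _ = 1 / (m : ℝ) ^ 3 := by rw [hρ]; field_simp
      _ ≤ 1 / (m : ℝ) ^ 1 := one_div_pow_le_one_div_pow_of_le (by linarith) (by norm_num)
      _ = 1 / (m : ℝ) := by rw [pow_one]
  have h4 : (1 + (x - 1) / d) ^ k ≤ Real.exp (1 / m) := by
    have h5 : (x - 1) / d ≤ 1 / m ^ 2 := by
      -- Since `m / k ≥ 1`, the exponent `6m/k` is at least `4m/k + 2`; this is the origin of the
      -- constant `6`.
      have h6 : x * m ^ 2 ≤ d := by
        refine le_trans ?_ hd
        rw [hx, ← Real.rpow_natCast, ← Real.rpow_add hm0]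
        refine Real.rpow_le_rpow_of_exponent_le (by linarith) ?_
        push_cast
        linarith
      rw [div_le_div_iff₀ hd0 (by positivity)]
      nlinarith [sq_nonneg (m : ℝ)]
    calc (1 + (x - 1) / d) ^ k ≤ Real.exp ((x - 1) / d) ^ k := by
          have h0 : 0 ≤ (x - 1) / d := div_nonneg (by linarith) hd0.le
          gcongr
          rw [add_comm]
          exact Real.add_one_le_exp _
      _ = Real.exp (k * ((x - 1) / d)) := (Real.exp_nat_mul _ _).symm
      _ ≤ _ := by
        refine Real.exp_le_exp.2 ?_
        calc (k : ℝ) * ((x - 1) / d) ≤ m * (1 / m ^ 2) := by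
              gcongr
          _ = 1 / m := by field_simp
  have h5 : 0 ≤ (1 + (x - 1) / d) ^ k := by
    have h0 : 0 ≤ (x - 1) / d := div_nonneg (by linarith) hd0.le
    positivity
  have h6 : Real.exp (ρ ^ 2 / (2 * k)) ^ m * (1 + (x - 1) / d) ^ k ≤ Real.exp (2 / m) := by
    calc _ ≤ Real.exp (1 / m) * Real.exp (1 / m) := mul_le_mul h3 h4 h5 (Real.exp_pos _).le
      _ = _ := by rw [← Real.exp_add]; congr 1; ring
  linarith

theorem rpow_le_of_le {m n : ℝ} (hm : 0 < m) (hk : (0 : ℝ) < k) {t : ℝ}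
    (h : k * (2 : ℝ) ^ (6 * (t * Real.logb 2 m)) ≤ k * n) : m ^ (6 * t) ≤ n := by
  have h1 := le_of_mul_le_mul_left h hk
  rwa [show 6 * (t * Real.logb 2 m) = Real.logb 2 m * (6 * t) by ring,
    Real.rpow_mul (by norm_num), Real.rpow_logb (by norm_num) (by norm_num) hm] at h1

theorem eventually_parameters {k : ℕ → ℕ} {β : ℕ → ℝ} {ε η : ℝ} (hε : 0 < ε) (hε1 : ε < 1)
    (hk : ∀ m : ℕ, |(k m : ℝ) - (m : ℝ) ^ ε| < 1)
    (hβ : β =o[atTop] (fun m => 1 / √(k m : ℝ))) (hη : 0 < η) :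
    ∀ᶠ m : ℕ in atTop, 256 ≤ m ∧ 0 < k m ∧ k m ≤ m ∧ (k m : ℝ) * β m ^ 2 ≤ 1 / 512 ∧
      Real.exp (2 / m) - 1 ≤ η ∧ Real.exp (2 / m) - 1 ≤ 1 / 20 := by
  have h1 : ∀ᶠ m : ℕ in atTop, 1 ≤ (m : ℝ) ^ ε :=
    ((tendsto_rpow_atTop hε).comp tendsto_natCast_atTop_atTop).eventually_ge_atTop 1
  have h2 : ∀ᶠ m : ℕ in atTop, (m : ℝ) ^ ε ≤ 1 / 2 * m := by
    have h := (tendsto_rpow_neg_atTop (sub_pos.2 hε1)).comp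
      (tendsto_natCast_atTop_atTop (R := ℝ))
    filter_upwards [h.eventually_le_const (show (0 : ℝ) < 1 / 2 by norm_num),
      eventually_gt_atTop 0] with m hm hm0
    have hm0' : (0 : ℝ) < m := by exact_mod_cast hm0
    calc (m : ℝ) ^ ε = (m : ℝ) ^ (-(1 - ε)) * m := by
          conv_rhs => rw [← Real.rpow_add_one hm0'.ne']
          congr 1
          ring
      _ ≤ _ := by
          gcongr
          exact hm
  have h3 : Tendsto (fun m : ℕ => Real.exp (2 / m) - 1) atTop (𝓝 0) := by
    have h := (Real.continuous_exp.tendsto 0).comp (tendsto_const_div_atTop_nhds_zero_nat (2 : ℝ))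
    have := h.sub_const 1
    simpa using this
  filter_upwards [h1, h2, eventually_ge_atTop 256, hβ.def (show (0 : ℝ) < 1 / 32 by norm_num),
    h3.eventually_le_const hη, h3.eventually_le_const (show (0 : ℝ) < 1 / 20 by norm_num)]
    with m h1 h2 hm hb he1 he2
  have hm' : (256 : ℝ) ≤ m := by exact_mod_cast hm
  obtain ⟨h4, h5⟩ := abs_lt.1 (hk m)
  have hk0 : (0 : ℝ) < k m := by linarith
  refine ⟨hm, by exact_mod_cast hk0, ?_, ?_, he1, he2⟩
  · have : (k m : ℝ) ≤ m := by linarith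
    exact_mod_cast this
  · have h6 : β m ^ 2 ≤ (1 / 32 * (1 / √(k m : ℝ))) ^ 2 := by
      rw [Real.norm_eq_abs, Real.norm_of_nonneg (by positivity)] at hb
      rw [← sq_abs]
      gcongr
    have e : (1 / √(k m : ℝ)) ^ 2 = 1 / k m := by
      rw [div_pow, one_pow, Real.sq_sqrt hk0.le]
    rw [mul_pow, e] at h6
    calc (k m : ℝ) * β m ^ 2 ≤ k m * ((1 / 32) ^ 2 * (1 / k m)) := by gcongr
      _ = 1 / 1024 := by field_simp; norm_num
      _ ≤ _ := by norm_num

end GadgetReduction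

open GadgetReduction in
theorem mainTheorem3 :
    ∃ (R : Reduction) (a : ℕ)
      (α δ : ℕ → ℕ → ℕ → ℝ) (y : (m n k : ℕ) → Fin (m + k) → ℝ),
      -- the reduction, its running time, and the shape of the instances
      (∀ m n k : ℕ, 0 < m → 0 < n → 0 < k → k ∣ n →
        0 < α m n k ∧ 0 < δ m n k ∧
        (∀ (A : Fin m → Fin n → ℝ) (b : Fin n → ℝ) (ω : Coins),
          R.Queries (clweInput k A b ω) (a * (n + m) ^ a) k
            (gadgetInstance (k := k) A (α m n k) (y m n k) (δ m n k))) ∧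
        (∀ γ β : ℝ, (clweLaw m n γ β).map Prod.fst = gaussianRows m n) ∧
        (nullLaw m n).map Prod.fst = gaussianRows m n ∧
        (∀ (S : Prog) (T : ℕ), SLRTime S (m + k) n k T →
          ∀ (A : Fin m → Fin n → ℝ) (b : Fin n → ℝ) (ω : Coins),
            HaltsWithin (R.apply S) (clweInput k A b ω) (T + a * (n + m) ^ a))) ∧
      -- completeness and distinguishing advantage
      ∃ c : ℝ, 0 < c ∧
        ∀ (C ε : ℝ), 0 < ε → ε < 1 →
        ∀ (k : ℕ → ℕ) (β : ℕ → ℝ), (∀ m : ℕ, |(k m : ℝ) - (m : ℝ) ^ ε| < 1) →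
          (∀ m, 0 ≤ β m) → β =o[atTop] (fun m => 1 / √(k m : ℝ)) →
        ∀ (q η : ℝ), 0 < q → 0 < η →
        ∀ᶠ m : ℕ in atTop, ∀ n : ℕ, k m ∣ n →
          (k m : ℝ) * 2 ^ (c * ((m / k m) * Real.logb 2 m)) ≤ n →
          (n : ℝ) ≤ k m * 2 ^ (C * ((m / k m) * Real.logb 2 m)) →
          1 - η ≤ (gaussianRows m n).real
            {A | ∃ θ, (gadgetInstance (k := k m) A (α m n (k m)) (y m n (k m))
              (δ m n (k m))).IsSolution (k m) θ} ∧
          ∀ S : Prog, SolvesSLR S (m + k m) n (k m) q →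
            q / 4 ≤ clweAdvantage (R.apply S) m n (k m) (2 * √(m : ℝ)) (β m) := by
  -- With these witnesses the instance is `inst` by definition, and `c = 6` turns the lower bound on
  -- `n` into `d ≥ m ^ (6m/k)`.
  refine ⟨red, 60, fun m n _ => m * n, fun m _ _ => 1 / (m * m), target, ?_, 6, by norm_num, ?_⟩
  · intro m n k hm hn hk hkn
    have hm' : (0 : ℝ) < m := by exact_mod_cast hm
    have hn' : (0 : ℝ) < n := by exact_mod_cast hn
    exact ⟨by positivity, by positivity, fun A b ω => queries A b hm hn hk hkn ω,
      clweLaw_map_fst hm, nullLaw_map_fst,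
      fun S T hS A b ω => haltsWithin A b hm hn hk hkn ω hS⟩
  · intro C ε hε hε1 k β hk _ hβ q η hq hη
    filter_upwards [eventually_parameters hε hε1 hk hβ hη] with m ⟨hm, hk0, hkm, hβ, he, he'⟩
    rintro _ ⟨d, rfl⟩ hlow -
    have hm0 : 0 < m := by omega
    have hm' : (0 : ℝ) < m := by exact_mod_cast hm0
    rw [Nat.cast_mul] at hlow
    have hd := rpow_le_of_le hm' (by exact_mod_cast hk0) hlow
    have hd0 : 0 < d := by exact_mod_cast (Real.rpow_pos_of_pos hm' _).trans_le hd
    have hsmall := measure_small_compl_le_exp (by omega) hk0 hkm hd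
    refine ⟨?_, fun S hS => le_clweAdvantage hm hk0 hkm hd0 hq hS hβ (hsmall.trans he')⟩
    have hsub : (⋃ f : Fin (k m) → Fin d, small m (1 / (m * m : ℝ)) f) ⊆
        {A | ∃ θ, (inst (k m) A).IsSolution (k m) θ} := by
      intro A hA
      obtain ⟨f, hf⟩ := Set.mem_iUnion.1 hA
      exact ⟨_, isSolution_of_small hm0 hk0 hf⟩
    have hmeas : MeasurableSet (⋃ f : Fin (k m) → Fin d, small m (1 / (m * m : ℝ)) f) :=
      MeasurableSet.iUnion fun f => measurableSet_small m _ f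
    have h := measureReal_mono (μ := gaussianRows m (k m * d)) hsub
    rw [probReal_compl_eq_one_sub hmeas] at hsmall
    exact le_trans (by linarith) h
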